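/- Let $0<T\le\infty$, let $x+iy:[0,T)\to\mathbb H=\{\Im z>0\}$ and $f:[0,T)\to(0,\infty)$ be measurable, let $u_0,u_1\in\mathbb R^2$ be nonzero and not parallel, and put $$R=\frac fy\begin{pmatrix}1&-x\\-x&x^2+y^2\end{pmatrix},\qquad J=\begin{pmatrix}0&-1\\1&0\end{pmatrix}.$$ Assume: (A) $R(t)$ is positive definite for all $t\in[0,T)$; (B) $R$ is measurable and $\|R\|,\|R^{-1}\|$ are locally bounded on $[0,T)$; (C) there is a nonzero $u_*\in\mathbb R^2$ with $\int_0^Tu_*^tR(s)u_*\,ds<\infty$. The *limit circle* case is the one in which $\|R\|$ is integrable on $[0,T)$; otherwise we are in the *limit point* case, and then $u_1$ is, by convention, a vector $u_*$ as in (C), i.e. $\int_0^T u_1^tRu_1\,ds<\infty$. Let $L^2_R$ be the Hilbert space of (real or complex, the result holds for both) two-dimensional vector functions on $[0,T)$ with inner product $\langle v,w\rangle_R=\int_0^T \bar v^tRw\,dt$. Let $\tau=\mathtt{Dir}(x+iy,u_0,u_1,f)$ be the operator $\tau v=R^{-1}Jv'$ on $L^2_R$ whose domain consists of all $v\in L^2_R$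 that are absolutely continuous on $[0,t]$ for every $t<T$, with $\tau v\in L^2_R$, $v(0)^tJu_0=0$ and, in the limit circle case, $\lim_{s\uparrow T}v(s)^tJu_1=0$. Assume that $\tau$ has a Hilbert–Schmidt inverse: a bounded, everywhere defined inverse $\tau^{-1}$ with $\sum_k\|\tau^{-1}e_k\|_R^2<\infty$ for an orthonormal basis $(e_k)$ of $L^2_R$. The hyperbolic carousel $\mathcal{HC}(\gamma,\eta_0,\eta_1,f)$ is defined for a measurable, locally bounded path $\gamma:[0,T)\to\mathbb H$ in the hyperbolic plane, distinct boundary points $\eta_0,\eta_1\in\mathbb R\cup\{\infty\}$ and a positive locally integrable $f$ as follows. For $\lambda\in\mathbb R$ let $r_\lambda(t)$, $t\in[0,T)$, be the boundary point that starts at $\eta_0$ and is rotated continuously about $\gamma(t)$ with rate $2\lambda f(t)$; that is, with $U(w)=\frac{w-i}{w+i}$, $U(\infty)=1$, we have $U(r_\lambda(t))=e^{i\phi_\lambda(t)}$ where $$\phi_\lambda'=2f\lambda\,\frac{|e^{i\phi_\lambda}-U(\gamma)|^2}{1-|U(\gamma)|^2},\qquad \phi_\lambda(0)=\arg U(\eta_0),$$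 in the integrated sense. Let $N$ be the right-continuous version of $\lambda\mapsto\operatorname{sgn}(\lambda)\cdot|\{t\in[0,T):r_\lambda(t)=\eta_1\}|$, that is, its limit from the right at each $\lambda$. If $N$ is finite, then $\mathcal{HC}(\gamma,\eta_0,\eta_1,f)$ is the discrete (locally finite) set $S\subset\mathbb R$ whose counting function is $N$, where the counting function of $S$ is $|S\cap[0,\lambda]|$ for $\lambda\ge0$ and $-|S\cap(\lambda,0)|$ for $\lambda<0$. Write $\eta_j\in\mathbb R\cup\{\infty\}$ for the quotient of the first by the second coordinate of $u_j$, $j=0,1$. Then $\mathcal{HC}(x+iy,\eta_0,\eta_1,f)$ is well defined: its ingredients are as required above, each $r_\lambda$ exists and is unique, it visits $\eta_1$ only finitely often, the right limits $N(\lambda)$ exist, and there is exactly one locally finite set $S$ with counting function $N$. Moreover $$\mathcal{HC}(x+iy,\eta_0,\eta_1,f)=\operatorname{spec}\,\mathtt{Dir}(x+iy,u_0,u_1,f).$$ -/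

import Mathlib

open MeasureTheory Filter Topology

noncomputable section

/-! ### Dirac operators -/

/-- The interval `[0, T)`, where `T` may be `∞`. -/
def timeInterval (T : EReal) : Set ℝ := {t | 0 ≤ t ∧ (t : EReal) < T}

/-- Lebesgue measure on `[0, T)`. -/
def timeMeasure (T : EReal) : Measure ℝ := volume.restrict (timeInterval T)

/-- The filter `s ↑ T` on the real line, for `T ≤ ∞`. -/
def leftEnd (T : EReal) : Filter ℝ := comap (fun t : ℝ => (t : EReal)) (𝓝[<] T)

/-- The ingredients of the Dirac operator `Dir(x + i y, u₀, u₁, f)` on `[0, T)`: a measurable path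
`z = x + i y` in the upper half plane, a measurable positive function `f`, and two nonzero real
vectors. Only the values of `z` and `f` on `[0, T)` matter. -/
structure DiracData where
  T : EReal
  T_pos : 0 < T
  z : ℝ → UpperHalfPlane
  f : ℝ → ℝ
  u₀ : Fin 2 → ℝ
  u₁ : Fin 2 → ℝ
  z_meas : AEMeasurable (fun t => (z t : ℂ)) (timeMeasure T)
  f_meas : AEMeasurable f (timeMeasure T)
  f_pos : ∀ t ∈ timeInterval T, 0 < f t
  u₀_ne : u₀ ≠ 0
  u₁_ne : u₁ ≠ 0

namespace DiracData

variable (D : DiracData)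

/-- The weight `R = (f / y) [[1, -x], [-x, x² + y²]]`. -/
def R (t : ℝ) : Matrix (Fin 2) (Fin 2) ℝ :=
  (D.f t / (D.z t).im) •
    !![1, -(D.z t).re; -(D.z t).re, (D.z t).re ^ 2 + (D.z t).im ^ 2]

/-- Condition (A): `R(t)` is positive definite for all `t ∈ [0, T)`. -/
def CondA : Prop := ∀ t ∈ timeInterval D.T, (D.R t).PosDef

/-- Condition (B): `R` is measurable and `‖R‖`, `‖R⁻¹‖` are locally bounded on `[0, T)`. -/
def CondB : Prop :=
  (∀ i j, AEMeasurable (fun t => D.R t i j) (timeMeasure D.T)) ∧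
  ∀ b ∈ timeInterval D.T, ∃ C : ℝ, ∀ t ∈ Set.Icc 0 b, ∀ i j,
    |D.R t i j| ≤ C ∧ |(D.R t)⁻¹ i j| ≤ C

/-- `∫₀ᵀ uᵗ R(s) u ds < ∞`. -/
def FiniteEnergy (u : Fin 2 → ℝ) : Prop :=
  Integrable (fun t => u ⬝ᵥ (D.R t).mulVec u) (timeMeasure D.T)

/-- Condition (C): some nonzero constant vector has finite energy. -/
def CondC : Prop := ∃ u : Fin 2 → ℝ, u ≠ 0 ∧ D.FiniteEnergy u

/-- The operator is limit circle at `T` if `‖R‖` is integrable on `[0, T)`, and limit point at `T`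
otherwise. -/
def LimitCircle : Prop := ∀ i j, Integrable (fun t => D.R t i j) (timeMeasure D.T)

/-- The convention for `u₁` in the limit point case: `u₁` is the vector of condition (C). -/
def EndConvention : Prop := ¬ D.LimitCircle → D.FiniteEnergy D.u₁

/-- `u₀` and `u₁` are not parallel. -/
def NonParallel : Prop := LinearIndependent ℝ ![D.u₀, D.u₁]

/-! ### The Hilbert space `L²_R` -/

section Space

variable {𝕜 : Type*} [RCLike 𝕜]

/-- `v(t)ᵗ R(t) w(t)`, with a complex conjugate on `v` if the scalars are complex. -/
def form (v w : ℝ → Fin 2 → 𝕜) (t : ℝ) : 𝕜 :=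
  star (v t) ⬝ᵥ ((D.R t).map (algebraMap ℝ 𝕜)).mulVec (w t)

theorem form_eq (v w : ℝ → Fin 2 → 𝕜) (t : ℝ) :
    D.form v w t = ((D.f t / (D.z t).im : ℝ) : 𝕜) *
      (star (v t 0 - ((D.z t).re : 𝕜) * v t 1) * (w t 0 - ((D.z t).re : 𝕜) * w t 1) +
        (((D.z t).im ^ 2 : ℝ) : 𝕜) * (star (v t 1) * w t 1)) := by
  simp [form, R, dotProduct, Matrix.mulVec, Fin.sum_univ_two]
  ring

theorem form_self_eq (v : ℝ → Fin 2 → 𝕜) (t : ℝ) :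
    D.form v v t = ((D.f t / (D.z t).im *
      (‖v t 0 - ((D.z t).re : 𝕜) * v t 1‖ ^ 2 + (D.z t).im ^ 2 * ‖v t 1‖ ^ 2) : ℝ) : 𝕜) := by
  rw [form_eq]
  have h : ∀ a : 𝕜, star a * a = ((‖a‖ ^ 2 : ℝ) : 𝕜) := fun a => by
    have := RCLike.conj_mul a
    simpa using this
  rw [h, h]
  push_cast
  ring

theorem weight_nonneg {t : ℝ} (ht : t ∈ timeInterval D.T) : 0 ≤ D.f t / (D.z t).im :=
  div_nonneg (D.f_pos t ht).le (D.z t).im_pos.le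

theorem measurableSet_timeInterval (T : EReal) : MeasurableSet (timeInterval T) :=
  (measurableSet_le measurable_const measurable_id).inter
    (measurableSet_lt measurable_coe_real_ereal measurable_const)

theorem ae_mem : ∀ᵐ t ∂timeMeasure D.T, t ∈ timeInterval D.T :=
  ae_restrict_mem (measurableSet_timeInterval D.T)

theorem aesm_form {v w : ℝ → Fin 2 → 𝕜} (hv : AEStronglyMeasurable v (timeMeasure D.T))
    (hw : AEStronglyMeasurable w (timeMeasure D.T)) :
    AEStronglyMeasurable (D.form v w) (timeMeasure D.T) := by
  have hv' : ∀ i, AEStronglyMeasurable (fun t => v t i) (timeMeasure D.T) := fun i =>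
    (continuous_apply i).comp_aestronglyMeasurable hv
  have hw' : ∀ i, AEStronglyMeasurable (fun t => w t i) (timeMeasure D.T) := fun i =>
    (continuous_apply i).comp_aestronglyMeasurable hw
  have hre : AEStronglyMeasurable (fun t => (D.z t).re) (timeMeasure D.T) :=
    (Complex.measurable_re.comp_aemeasurable D.z_meas).aestronglyMeasurable
  have him' : AEMeasurable (fun t => (D.z t).im) (timeMeasure D.T) :=
    Complex.measurable_im.comp_aemeasurable D.z_meas
  have him := him'.aestronglyMeasurable
  have hq : AEStronglyMeasurable (fun t => D.f t / (D.z t).im) (timeMeasure D.T) :=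
    (D.f_meas.div him').aestronglyMeasurable
  have hof : ∀ {g : ℝ → ℝ}, AEStronglyMeasurable g (timeMeasure D.T) →
      AEStronglyMeasurable (fun t => (g t : 𝕜)) (timeMeasure D.T) := fun hg =>
    RCLike.continuous_ofReal.comp_aestronglyMeasurable hg
  have hst : ∀ {g : ℝ → 𝕜}, AEStronglyMeasurable g (timeMeasure D.T) →
      AEStronglyMeasurable (fun t => star (g t)) (timeMeasure D.T) := fun hg =>
    continuous_star.comp_aestronglyMeasurable hg
  have e : D.form v w = fun t => _ := funext (D.form_eq v w)
  rw [e]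
  exact (hof hq).mul (((hst ((hv' 0).sub ((hof hre).mul (hv' 1)))).mul
    ((hw' 0).sub ((hof hre).mul (hw' 1)))).add ((hof (him.pow 2)).mul ((hst (hv' 1)).mul (hw' 1))))

theorem norm_form_le (v w : ℝ → Fin 2 → 𝕜) {t : ℝ} (ht : t ∈ timeInterval D.T) :
    ‖D.form v w t‖ ≤ ‖D.form v v t‖ + ‖D.form w w t‖ := by
  have hq := D.weight_nonneg ht
  rw [form_self_eq, form_self_eq, form_eq, norm_mul]
  have hn : ∀ r : ℝ, 0 ≤ r → ‖(r : 𝕜)‖ = r := fun r hr => by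
    rw [RCLike.norm_ofReal, abs_of_nonneg hr]
  rw [hn _ hq, hn _ (by positivity), hn _ (by positivity), ← mul_add]
  refine mul_le_mul_of_nonneg_left ?_ hq
  refine (norm_add_le _ _).trans ?_
  rw [norm_mul, norm_mul, norm_mul, norm_star, norm_star, hn _ (by positivity)]
  set a := ‖v t 0 - ((D.z t).re : 𝕜) * v t 1‖
  set b := ‖w t 0 - ((D.z t).re : 𝕜) * w t 1‖
  have h1 : a * b ≤ a ^ 2 + b ^ 2 := by nlinarith [sq_nonneg (a - b), sq_nonneg (a + b)]
  have h2 : ‖v t 1‖ * ‖w t 1‖ ≤ ‖v t 1‖ ^ 2 + ‖w t 1‖ ^ 2 := by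
    nlinarith [sq_nonneg (‖v t 1‖ - ‖w t 1‖), sq_nonneg (‖v t 1‖ + ‖w t 1‖)]
  nlinarith [mul_le_mul_of_nonneg_left h2 (sq_nonneg (D.z t).im)]

theorem integrable_form {v w : ℝ → Fin 2 → 𝕜} (hv : AEStronglyMeasurable v (timeMeasure D.T))
    (hw : AEStronglyMeasurable w (timeMeasure D.T))
    (hv2 : Integrable (D.form v v) (timeMeasure D.T))
    (hw2 : Integrable (D.form w w) (timeMeasure D.T)) :
    Integrable (D.form v w) (timeMeasure D.T) := by
  refine (hv2.norm.add hw2.norm).mono' (D.aesm_form hv hw) ?_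
  filter_upwards [D.ae_mem] with t ht
  exact D.norm_form_le v w ht

theorem form_congr {v w v' w' : ℝ → Fin 2 → 𝕜} (hv : v =ᵐ[timeMeasure D.T] v')
    (hw : w =ᵐ[timeMeasure D.T] w') : D.form v w =ᵐ[timeMeasure D.T] D.form v' w' := by
  filter_upwards [hv, hw] with t h1 h2
  simp only [form, h1, h2]

theorem form_add_left (u v w : ℝ → Fin 2 → 𝕜) :
    D.form (u + v) w = D.form u w + D.form v w := by
  ext t
  simp [form, add_dotProduct]

theorem form_smul_left (c : 𝕜) (v w : ℝ → Fin 2 → 𝕜) :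
    D.form (c • v) w = star c • D.form v w := by
  ext t
  simp [form]

theorem form_conj (v w : ℝ → Fin 2 → 𝕜) (t : ℝ) :
    star (D.form w v t) = D.form v w t := by
  rw [form_eq, form_eq]
  simp only [star_add, star_mul', star_sub, RCLike.star_def, RCLike.conj_ofReal, RCLike.conj_conj]
  ring

theorem form_add_right (u v w : ℝ → Fin 2 → 𝕜) :
    D.form u (v + w) = D.form u v + D.form u w := by
  ext t
  simp only [form, Pi.add_apply, Matrix.mulVec_add, dotProduct_add]

theorem form_smul_right (c : 𝕜) (v w : ℝ → Fin 2 → 𝕜) :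
    D.form v (c • w) = c • D.form v w := by
  ext t
  simp only [form, Pi.smul_apply, Matrix.mulVec_smul, dotProduct_smul]

variable (𝕜) in
/-- The `𝕜²`-valued measurable functions `v` on `[0, T)`, up to equality almost everywhere, with
`∫₀ᵀ v(t)ᵗ R(t) v(t) dt < ∞`. -/
def l2Submodule : Submodule 𝕜 (ℝ →ₘ[timeMeasure D.T] (Fin 2 → 𝕜)) where
  carrier := {v | Integrable (D.form v v) (timeMeasure D.T)}
  zero_mem' := by
    have h : D.form (𝕜 := 𝕜) 0 0 = fun _ => 0 := by ext t; simp [form]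
    refine (integrable_congr (D.form_congr AEEqFun.coeFn_zero AEEqFun.coeFn_zero)).2 ?_
    rw [h]
    exact integrable_zero _ _ _
  add_mem' := by
    intro v w hv hw
    refine (integrable_congr
      (D.form_congr (AEEqFun.coeFn_add v w) (AEEqFun.coeFn_add v w))).2 ?_
    rw [form_add_left, form_add_right, form_add_right]
    exact (Integrable.add hv (D.integrable_form v.aestronglyMeasurable w.aestronglyMeasurable
      hv hw)).add ((D.integrable_form w.aestronglyMeasurable v.aestronglyMeasurable
      hw hv).add hw)
  smul_mem' := by
    intro c v hv
    refine (integrable_congr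
      (D.form_congr (AEEqFun.coeFn_smul c v) (AEEqFun.coeFn_smul c v))).2 ?_
    rw [form_smul_left, form_smul_right]
    exact (Integrable.smul c hv).smul (star c)

variable (𝕜) in
/-- The Hilbert space `L²_R[0, T)`. -/
def L2R : Type _ := D.l2Submodule 𝕜

/-- The underlying class of functions. -/
def L2R.toFun' (v : D.L2R 𝕜) : ℝ →ₘ[timeMeasure D.T] (Fin 2 → 𝕜) := v.1

instance : CoeFun (D.L2R 𝕜) (fun _ => ℝ → Fin 2 → 𝕜) := ⟨fun v => (L2R.toFun' D v : _)⟩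

instance : AddCommGroup (D.L2R 𝕜) := inferInstanceAs (AddCommGroup (D.l2Submodule 𝕜))

instance : Module 𝕜 (D.L2R 𝕜) := inferInstanceAs (Module 𝕜 (D.l2Submodule 𝕜))

theorem L2R.coeFn_add (v w : D.L2R 𝕜) : (v + w : D.L2R 𝕜) =ᵐ[timeMeasure D.T] v + w :=
  AEEqFun.coeFn_add v.1 w.1

theorem L2R.coeFn_smul (c : 𝕜) (v : D.L2R 𝕜) : (c • v : D.L2R 𝕜) =ᵐ[timeMeasure D.T] c • ⇑v :=
  AEEqFun.coeFn_smul c v.1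

theorem L2R.coeFn_zero : (0 : D.L2R 𝕜) =ᵐ[timeMeasure D.T] (0 : ℝ → Fin 2 → 𝕜) :=
  AEEqFun.coeFn_zero

theorem L2R.ext_ae {v w : D.L2R 𝕜} (h : v =ᵐ[timeMeasure D.T] w) : v = w :=
  Subtype.ext (AEEqFun.ext h)

theorem L2R.aesm (v : D.L2R 𝕜) : AEStronglyMeasurable v (timeMeasure D.T) :=
  AEEqFun.aestronglyMeasurable v.1

theorem L2R.integrable (v w : D.L2R 𝕜) : Integrable (D.form v w) (timeMeasure D.T) :=
  D.integrable_form (L2R.aesm D v) (L2R.aesm D w) v.2 w.2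

/-- The inner product `⟨v, w⟩_R = ∫₀ᵀ v(t)ᵗ R(t) w(t) dt`. -/
@[reducible]
def innerCore : InnerProductSpace.Core 𝕜 (D.L2R 𝕜) where
  inner v w := ∫ t, D.form v w t ∂timeMeasure D.T
  conj_inner_symm v w := by
    rw [← integral_conj]
    exact integral_congr_ae (Eventually.of_forall fun t => D.form_conj v w t)
  re_inner_nonneg v := by
    have h : ∀ t, D.form v v t = ((RCLike.re (D.form v v t) : ℝ) : 𝕜) := fun t => by
      rw [form_self_eq, RCLike.ofReal_re]
    rw [integral_congr_ae (Eventually.of_forall h), integral_ofReal, RCLike.ofReal_re]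
    refine integral_nonneg_of_ae ?_
    filter_upwards [D.ae_mem] with t ht
    have hq := D.weight_nonneg ht
    rw [form_self_eq, RCLike.ofReal_re]
    simp only [Pi.zero_apply]
    positivity
  add_left u v w := by
    rw [integral_congr_ae (D.form_congr (L2R.coeFn_add D u v) (ae_eq_refl _)), form_add_left]
    exact integral_add (L2R.integrable D u w) (L2R.integrable D v w)
  smul_left v w c := by
    rw [integral_congr_ae (D.form_congr (L2R.coeFn_smul D c v) (ae_eq_refl _)), form_smul_left]
    exact integral_const_mul _ _
  definite v hv := by
    have h : ∀ t, D.form v v t = ((RCLike.re (D.form v v t) : ℝ) : 𝕜) := fun t => by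
      rw [form_self_eq, RCLike.ofReal_re]
    have hv' : ∫ t, D.form v v t ∂timeMeasure D.T = 0 := hv
    rw [integral_congr_ae (Eventually.of_forall h), integral_ofReal, RCLike.ofReal_eq_zero,
      integral_eq_zero_iff_of_nonneg_ae ?_ (L2R.integrable D v v).re] at hv'
    · refine L2R.ext_ae D (EventuallyEq.trans ?_ (L2R.coeFn_zero D).symm)
      filter_upwards [hv', D.ae_mem] with t h0 ht
      rw [form_self_eq, RCLike.ofReal_re] at h0
      have hq : 0 < D.f t / (D.z t).im := div_pos (D.f_pos t ht) (D.z t).im_pos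
      have hy := (D.z t).im_pos
      have h0' := (mul_eq_zero.1 h0).resolve_left hq.ne'
      have h1 : 0 ≤ (D.z t).im ^ 2 * ‖(v : ℝ → Fin 2 → 𝕜) t 1‖ ^ 2 := by positivity
      have h2 := sq_nonneg ‖(v : ℝ → Fin 2 → 𝕜) t 0 -
        ((D.z t).re : 𝕜) * (v : ℝ → Fin 2 → 𝕜) t 1‖
      have h3 : (v : ℝ → Fin 2 → 𝕜) t 1 = 0 := by
        have : (D.z t).im ^ 2 * ‖(v : ℝ → Fin 2 → 𝕜) t 1‖ ^ 2 = 0 := by linarith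
        simpa [hy.ne'] using this
      have h4 : (v : ℝ → Fin 2 → 𝕜) t 0 = 0 := by
        have : ‖(v : ℝ → Fin 2 → 𝕜) t 0 -
          ((D.z t).re : 𝕜) * (v : ℝ → Fin 2 → 𝕜) t 1‖ ^ 2 = 0 := by linarith
        simpa [h3] using this
      ext i
      fin_cases i
      · simpa using h4
      · simpa using h3
    · filter_upwards [D.ae_mem] with t ht
      have hq := D.weight_nonneg ht
      rw [form_self_eq, RCLike.ofReal_re]
      simp only [Pi.zero_apply]
      positivity

instance : NormedAddCommGroup (D.L2R 𝕜) :=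
  @InnerProductSpace.Core.toNormedAddCommGroup 𝕜 (D.L2R 𝕜) _ _ _ D.innerCore

instance : InnerProductSpace 𝕜 (D.L2R 𝕜) :=
  InnerProductSpace.ofCore D.innerCore.toCore

theorem inner_def (v w : D.L2R 𝕜) : inner 𝕜 v w = ∫ t, D.form v w t ∂timeMeasure D.T := rfl

variable (𝕜)

/-! ### The operator -/

/-- The matrix `J = [[0, -1], [1, 0]]`. -/
def J : Matrix (Fin 2) (Fin 2) ℝ := !![0, -1; 1, 0]

variable {𝕜}

/-- The Wronskian `vᵗ J u` with a real vector `u`. -/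
def wronskian (v : Fin 2 → 𝕜) (u : Fin 2 → ℝ) : 𝕜 :=
  v ⬝ᵥ fun i => algebraMap ℝ 𝕜 (J.mulVec u i)

/-- `g` is absolutely continuous on `[0, T)` with derivative `h`: the function `h` is integrable on
`[0, t]` and `g(t) = g(0) + ∫₀ᵗ h(s) ds` for all `t ∈ [0, T)`. -/
def HasACDeriv (g h : ℝ → Fin 2 → 𝕜) : Prop :=
  ∀ t ∈ timeInterval D.T, IntervalIntegrable h volume 0 t ∧ g t = g 0 + ∫ s in (0 : ℝ)..t, h s

/-- `τ g = R⁻¹ J g'`, where `h` is the derivative of `g`. -/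
def tau (h : ℝ → Fin 2 → 𝕜) (t : ℝ) : Fin 2 → 𝕜 :=
  ((D.R t)⁻¹.map (algebraMap ℝ 𝕜)).mulVec ((J.map (algebraMap ℝ 𝕜)).mulVec (h t))

/-- The pair `(v, τ v)` of elements of `L²_R`, with `v` in the domain of `τ`: the class `v` has an
absolutely continuous representative `g` with `R⁻¹ J g' = τ v` almost everywhere, `g(0)ᵗ J u₀ = 0`
and, in the limit circle case, `g(s)ᵗ J u₁ → 0` as `s ↑ T`. -/
def IsPair (v w : D.L2R 𝕜) : Prop :=
  ∃ g h : ℝ → Fin 2 → 𝕜, D.HasACDeriv g h ∧ v =ᵐ[timeMeasure D.T] g ∧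
    w =ᵐ[timeMeasure D.T] D.tau h ∧ wronskian (g 0) D.u₀ = 0 ∧
    (D.LimitCircle → Tendsto (fun s => wronskian (g s) D.u₁) (leftEnd D.T) (𝓝 0))

theorem wronskian_add (v w : Fin 2 → 𝕜) (u : Fin 2 → ℝ) :
    wronskian (v + w) u = wronskian v u + wronskian w u := by
  simp only [wronskian, add_dotProduct]

theorem wronskian_smul (c : 𝕜) (v : Fin 2 → 𝕜) (u : Fin 2 → ℝ) :
    wronskian (c • v) u = c • wronskian v u := by
  simp only [wronskian, smul_dotProduct]

variable (𝕜) in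
/-- The graph of `Dir(x + i y, u₀, u₁, f)`. -/
def graph : Submodule 𝕜 (D.L2R 𝕜 × D.L2R 𝕜) where
  carrier := {p | D.IsPair p.1 p.2}
  zero_mem' := by
    refine ⟨0, 0, fun t _ => ⟨by simp [Pi.zero_def], by simp⟩, L2R.coeFn_zero D, ?_, ?_, fun _ => ?_⟩
    · refine (L2R.coeFn_zero D).trans (Eventually.of_forall fun t => ?_)
      simp [tau]
    · simp [wronskian]
    · simpa [wronskian] using tendsto_const_nhds
  add_mem' := by
    rintro ⟨v, w⟩ ⟨v', w'⟩ ⟨g, h, h1, h2, h3, h4, h5⟩ ⟨g', h', h1', h2', h3', h4', h5'⟩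
    refine ⟨g + g', h + h', fun t ht => ⟨(h1 t ht).1.add (h1' t ht).1, ?_⟩,
      (L2R.coeFn_add D v v').trans (h2.add h2'), (L2R.coeFn_add D w w').trans ?_, ?_, fun hl => ?_⟩
    · have e : ∫ s in (0 : ℝ)..t, (h + h') s = (∫ s in (0 : ℝ)..t, h s) + ∫ s in (0 : ℝ)..t, h' s :=
        intervalIntegral.integral_add (h1 t ht).1 (h1' t ht).1
      rw [e, Pi.add_apply, Pi.add_apply, (h1 t ht).2, (h1' t ht).2]
      abel
    · filter_upwards [h3, h3'] with t e e'
      simp only [Pi.add_apply, e, e', tau, Matrix.mulVec_add]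
    · rw [Pi.add_apply, wronskian_add, h4, h4', add_zero]
    · simp only [Pi.add_apply, wronskian_add]
      simpa using (h5 hl).add (h5' hl)
  smul_mem' := by
    rintro c ⟨v, w⟩ ⟨g, h, h1, h2, h3, h4, h5⟩
    refine ⟨c • g, c • h, fun t ht => ⟨(h1 t ht).1.smul c, ?_⟩,
      (L2R.coeFn_smul D c v).trans (h2.const_smul c), (L2R.coeFn_smul D c w).trans ?_, ?_,
      fun hl => ?_⟩
    · have e : ∫ s in (0 : ℝ)..t, (c • h) s = c • ∫ s in (0 : ℝ)..t, h s :=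
        intervalIntegral.integral_smul c h
      rw [e, Pi.smul_apply, Pi.smul_apply, (h1 t ht).2, smul_add]
    · filter_upwards [h3] with t e
      simp only [Pi.smul_apply, e, tau, Matrix.mulVec_smul]
    · rw [Pi.smul_apply, wronskian_smul, h4, smul_zero]
    · simp only [Pi.smul_apply, wronskian_smul]
      simpa using (h5 hl).const_smul c

/-- `τ v` is determined by `v`. -/
theorem graph_functional (p : D.L2R 𝕜 × D.L2R 𝕜) (hp : p ∈ D.graph 𝕜) (h0 : p.1 = 0) :
    p.2 = 0 := by
  obtain ⟨v, w⟩ := p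
  obtain ⟨g, h, h1, h2, h3, -, -⟩ := hp
  simp only at h0 h2 h3 ⊢
  subst h0
  have hU : IsOpen {t : ℝ | 0 < t ∧ (t : EReal) < D.T} :=
    isOpen_Ioi.inter (isOpen_Iio.preimage continuous_coe_real_ereal)
  set U : Set ℝ := {t : ℝ | 0 < t ∧ (t : EReal) < D.T} with hUdef
  have hq : ∀ x ∈ U, ∃ q : ℚ, x < q ∧ (q : ℝ) ∈ timeInterval D.T := by
    intro x hx
    obtain ⟨q, h1, h2⟩ := EReal.lt_iff_exists_rat_btwn.1 hx.2
    have h1' : x < (q : ℝ) := by exact_mod_cast h1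
    exact ⟨q, h1', (hx.1.trans h1').le, by exact_mod_cast h2⟩
  have hgc : ContinuousOn g U := by
    intro x hx
    obtain ⟨q, hxq, hqT⟩ := hq x hx
    have hc := intervalIntegral.continuousOn_primitive_interval
      ((intervalIntegrable_iff' (by simp)).1 (h1 q hqT).1)
    have hn : Set.Ioo (0 : ℝ) q ∈ 𝓝 x := Ioo_mem_nhds hx.1 hxq
    have hn' : Set.uIcc (0 : ℝ) q ∈ 𝓝 x := by
      rw [Set.uIcc_of_le hqT.1]
      exact Icc_mem_nhds hx.1 hxq
    have hc' := (hc.continuousAt hn').const_add (g 0)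
    refine (hc'.congr ?_).continuousWithinAt
    filter_upwards [hn] with t ht
    exact ((h1 t ⟨ht.1.le, (EReal.coe_lt_coe_iff.2 ht.2).trans hqT.2⟩).2).symm
  have hg0 : Set.EqOn g 0 U := by
    refine Measure.eqOn_open_of_ae_eq (μ := volume) ?_ hU hgc continuousOn_const
    have : g =ᵐ[timeMeasure D.T] 0 := h2.symm.trans (L2R.coeFn_zero D)
    have hs : U ⊆ timeInterval D.T := fun t ht => ⟨ht.1.le, ht.2⟩
    exact ae_restrict_of_ae_restrict_of_subset hs this
  have hae : ∀ᵐ x : ℝ, ∀ q : ℚ, (q : ℝ) ∈ timeInterval D.T → x ∈ Set.uIcc (0 : ℝ) q →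
      HasDerivAt (fun y => ∫ s in (0 : ℝ)..y, h s) (h x) x := by
    refine ae_all_iff.2 fun q => ?_
    by_cases hqT : (q : ℝ) ∈ timeInterval D.T
    · filter_upwards [(h1 q hqT).1.ae_hasDerivAt_integral] with x hx _ hx'
      exact hx hx' 0 Set.left_mem_uIcc
    · exact Eventually.of_forall fun x h => absurd h hqT
  have hne : ∀ᵐ x : ℝ, x ≠ 0 := by simp [ae_iff]
  refine L2R.ext_ae D (h3.trans (EventuallyEq.trans ?_ (L2R.coeFn_zero D).symm))
  filter_upwards [ae_restrict_of_ae hae, ae_restrict_of_ae hne, D.ae_mem] with x hx hx0 hxT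
  have hxU : x ∈ U := ⟨lt_of_le_of_ne hxT.1 (Ne.symm hx0), hxT.2⟩
  obtain ⟨q, hxq, hqT⟩ := hq x hxU
  have hd := hx q hqT (by rw [Set.uIcc_of_le hqT.1]; exact ⟨hxT.1, hxq.le⟩)
  have hd' : HasDerivAt (fun y => ∫ s in (0 : ℝ)..y, h s) 0 x := by
    refine (hasDerivAt_const x (-g 0)).congr_of_eventuallyEq ?_
    filter_upwards [hU.mem_nhds hxU] with y hy
    have e := (h1 y ⟨hy.1.le, hy.2⟩).2
    rw [hg0 hy] at e
    exact (neg_eq_of_add_eq_zero_right e.symm).symm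
  simp [tau, hd.unique hd']

variable (𝕜) in
/-- The operator `Dir(x + i y, u₀, u₁, f)` on `L²_R`, as a partially defined linear operator. -/
def operator : D.L2R 𝕜 →ₗ.[𝕜] D.L2R 𝕜 := (D.graph 𝕜).toLinearPMap

theorem operator_graph : (D.operator 𝕜).graph = D.graph 𝕜 :=
  Submodule.toLinearPMap_graph_eq _ D.graph_functional

end Space

end DiracData

/-! ### Spectrum and Hilbert–Schmidt inverse -/

section Spectrum

variable {𝕜 H : Type*} [RCLike 𝕜] [NormedAddCommGroup H] [InnerProductSpace 𝕜 H]

/-- `K` is the bounded, everywhere defined, inverse of `A - μ`. -/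
def IsResolvent (A : H →ₗ.[𝕜] H) (μ : 𝕜) (K : H →L[𝕜] H) : Prop :=
  (∀ v : A.domain, K (A v - μ • (v : H)) = v) ∧
  ∀ w : H, ∃ v : A.domain, (v : H) = K w ∧ A v - μ • (v : H) = w

/-- The spectrum of an unbounded operator. -/
def operatorSpectrum (A : H →ₗ.[𝕜] H) : Set 𝕜 := {μ | ¬ ∃ K : H →L[𝕜] H, IsResolvent A μ K}

/-- `K` is Hilbert–Schmidt: `∑ₖ ‖K eₖ‖² < ∞` for an orthonormal basis `(eₖ)` of `H`. -/
def IsHilbertSchmidt (K : H →L[𝕜] H) : Prop :=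
  ∃ (s : Set H) (b : HilbertBasis s 𝕜 H), Summable fun k => ‖K (b k)‖ ^ 2

/-- `A` has a Hilbert–Schmidt inverse. -/
def HasHilbertSchmidtInverse (A : H →ₗ.[𝕜] H) : Prop :=
  ∃ K : H →L[𝕜] H, IsResolvent A 0 K ∧ IsHilbertSchmidt K

end Spectrum

/-! ### The hyperbolic carousel -/

/-- The Cayley transform `U(w) = (w - i) / (w + i)` from the half plane to the disk. -/
def cayley (w : ℂ) : ℂ := (w - Complex.I) / (w + Complex.I)

/-- The Cayley transform on the boundary `ℝ ∪ {∞}` of the half plane. -/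
def cayleyBoundary (η : OnePoint ℝ) : ℂ := η.elim 1 fun r : ℝ => cayley r

/-- The boundary point `u₁ / u₂` of the half plane given by a nonzero vector `(u₁, u₂)`. -/
def boundaryPoint (u : Fin 2 → ℝ) : OnePoint ℝ :=
  if u 1 = 0 then OnePoint.infty else ((u 0 / u 1 : ℝ) : OnePoint ℝ)

section Carousel

variable (T : EReal) (z : ℝ → UpperHalfPlane) (η₀ η₁ : OnePoint ℝ) (f : ℝ → ℝ)

/-- In the disk model, the velocity of the angle `φ` of a boundary point `e^{iφ}` which is rotated
about `z(s)` with rate `2 lam f(s)`. -/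
def angularVelocity (lam : ℝ) (φ : ℝ → ℝ) (s : ℝ) : ℝ :=
  2 * f s * lam * (‖Complex.exp (φ s * Complex.I) - cayley (z s)‖ ^ 2 / (1 - ‖cayley (z s)‖ ^ 2))

/-- `φ` is the angle on `[0, T)` of the moving boundary point `r_lam(t) = e^{iφ(t)}` in the disk
model: it starts at `η₀` and is rotated continuously about `z(t)` with rate `2 lam f(t)`. -/
structure IsCarouselAngle (lam : ℝ) (φ : ℝ → ℝ) : Prop where
  initial : φ 0 = Complex.arg (cayleyBoundary η₀)
  continuousOn : ContinuousOn φ (timeInterval T)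
  integrable : ∀ t ∈ timeInterval T,
    IntervalIntegrable (angularVelocity z f lam φ) volume 0 t
  evolution : ∀ t ∈ timeInterval T, φ t = φ 0 + ∫ s in (0 : ℝ)..t, angularVelocity z f lam φ s

/-- The times in `[0, T)` at which the moving boundary point is at `η₁`. -/
def crossingTimes (lam : ℝ) : Set ℝ :=
  {t ∈ timeInterval T | ∃ φ, IsCarouselAngle T z η₀ f lam φ ∧
    Complex.exp (φ t * Complex.I) = cayleyBoundary η₁}

/-- `sgn(lam) · |{t ∈ [0, T) : r_lam(t) = η₁}|`. -/
def signedCrossings (lam : ℝ) : ℤ :=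
  (SignType.sign lam : ℤ) * ((crossingTimes T z η₀ η₁ f lam).ncard : ℤ)

/-- The (right-continuous) counting function of a locally finite set of reals. -/
def countingFunction (S : Set ℝ) (lam : ℝ) : ℤ :=
  if 0 ≤ lam then ((S ∩ Set.Icc 0 lam).ncard : ℤ) else -((S ∩ Set.Ioo lam 0).ncard : ℤ)

/-- `N` is the right-continuous version of `n`. -/
def IsRightContinuousVersion (n N : ℝ → ℤ) : Prop :=
  ∀ lam, Tendsto n (𝓝[>] lam) (𝓝 (N lam))

/-- `S` is a discrete (locally finite) set whose counting function is the right-continuous version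
of the signed number of crossings. -/
def IsCarouselSet (S : Set ℝ) : Prop :=
  (∀ a b : ℝ, (S ∩ Set.Icc a b).Finite) ∧
  IsRightContinuousVersion (signedCrossings T z η₀ η₁ f) (countingFunction S)

/-- The hyperbolic carousel `HC(z, η₀, η₁, f)`. -/
def hyperbolicCarousel : Set ℝ := {lam | ∃ S, IsCarouselSet T z η₀ η₁ f S ∧ lam ∈ S}

/-- The hyperbolic carousel `HC(z, η₀, η₁, f)` is well defined. -/
structure CarouselWellDefined : Prop where
  path_measurable : AEMeasurable (fun t => (z t : ℂ)) (timeMeasure T)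
  /-- The path is locally bounded for the hyperbolic metric. -/
  path_bounded : ∀ b ∈ timeInterval T, Bornology.IsBounded (z '' Set.Icc 0 b)
  boundary_ne : η₀ ≠ η₁
  f_pos : ∀ t ∈ timeInterval T, 0 < f t
  f_integrable : ∀ b ∈ timeInterval T, IntegrableOn f (Set.Icc 0 b)
  /-- For all `lam` the moving boundary point exists and is unique. -/
  exists_unique : ∀ lam, ∃ φ, IsCarouselAngle T z η₀ f lam φ ∧
    ∀ ψ, IsCarouselAngle T z η₀ f lam ψ → Set.EqOn ψ φ (timeInterval T)
  finite : ∀ lam, (crossingTimes T z η₀ η₁ f lam).Finite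
  /-- There is exactly one set that the carousel produces. -/
  set_unique : ∃! S, IsCarouselSet T z η₀ η₁ f S

end Carousel

end

/-! Let `K` be the Hilbert–Schmidt inverse of the operator. It is compact and, by Lagrange's
identity, symmetric, so the spectrum consists of the real reciprocals `1/κ` of its nonzero
eigenvalues (`operatorSpectrum_eq`, `isSymmetric_of_isResolvent`, `image_reciprocalEigenvalues`). It
remains to count these by crossings.

The link is the solution `V_μ` of `V' = -μ J R V`, `V(0) = u₀`. In polar coordinates its direction,
read as a boundary point of the half plane, obeys exactly the carousel equation (`cayley_rate`,
`exists_solution`). So the moving point for `μ` is at `η₁` at time `t` if and only if `V_μ(t)` is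
parallel to `u₁`. Uniqueness for the linear equation makes every eigenvector for `μ` a multiple of
`V_μ`, so all eigenvalues are simple.

Take `lam > 0`; the negative case is the same with `-K`, which a sign `σ = ±1` takes care of. The
number of crossings is squeezed between two eigenvalue counts (`crossingTimes_bounds`).

Crossings are at most the eigenvalues in `(0, lam]`. For each crossing time `t` cut `V_lam` off
after `t`. Since `V_lam(t)` is parallel to `u₁`, the operator `lam K` sends the cut to the solution
stopped at `t`. Hence the form of `K` equals `lam⁻¹ ‖x‖²` on the span of the cuts
(`inner_apply_cut`). The cuts are linearly independent, and the min-max principle for simple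
eigenvalues (`exists_eigenvalues_ge`) yields as many eigenvalues of `K` that are at least `lam⁻¹`
(`exists_eigenvalues_of_crossings`).

Crossings are at least the eigenvalues in `(0, lam)`. Let `P_b` be the restriction to `[0, b]`. As
`b` tends to `T`, `P_b K P_b` tends strongly to `K`, so for some `b` it has as many eigenvalues
above `lam⁻¹`; these are reciprocals of values `μ < lam` for which `V_μ(b)` is parallel to `u₁`
(`exists_time_of_eigenvalues`). The angle `φ_μ(b)` increases strictly with `μ`, and `φ_0(b)` is the
starting angle. By the intermediate value theorem the path `φ_lam` on `[0, b]` passes through each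
of the distinct values `φ_μ(b)`, and each passage is a crossing (`exists_crossings`).

The two counts differ at most by the point `lam` itself. Eigenvalues are isolated and `0` is not
one, so the two bounds agree just to the right of any point, and the right limit of the crossing
number is the counting function of the spectrum. A counting function determines its locally finite
set. -/

/-! ### Absolutely continuous functions and their derivatives -/

section AbsolutelyContinuous

variable {E F : Type*} [NormedAddCommGroup E] [NormedSpace ℝ E] [NormedAddCommGroup F]
  [NormedSpace ℝ F]

/-- `g` is absolutely continuous on `[0, b]` with derivative `h`. -/
structure ACDeriv (g h : ℝ → E) (b : ℝ) : Prop where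
  nonneg : 0 ≤ b
  int : IntervalIntegrable h volume 0 b
  eq : ∀ t ∈ Set.Icc 0 b, g t = g 0 + ∫ s in (0 : ℝ)..t, h s

namespace ACDeriv

variable {g g' h h' : ℝ → E} {b : ℝ}

theorem int_of_mem (H : ACDeriv g h b) {s t : ℝ} (hs : s ∈ Set.Icc 0 b) (ht : t ∈ Set.Icc 0 b) :
    IntervalIntegrable h volume s t := by
  refine H.int.mono_set ?_
  rw [Set.uIcc_of_le H.nonneg]
  exact Set.uIcc_subset_Icc hs ht

theorem sub_eq (H : ACDeriv g h b) {s t : ℝ} (hs : s ∈ Set.Icc 0 b) (ht : t ∈ Set.Icc 0 b) :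
    g t - g s = ∫ r in s..t, h r := by
  have h0 : (0 : ℝ) ∈ Set.Icc 0 b := ⟨le_rfl, H.nonneg⟩
  rw [H.eq t ht, H.eq s hs, add_sub_add_left_eq_sub,
    intervalIntegral.integral_interval_sub_left (H.int_of_mem h0 ht) (H.int_of_mem h0 hs)]

/-- Increments of `g` are dominated by increments of the primitive of `‖h‖`, whose absolute
continuity is known. -/
theorem ac (H : ACDeriv g h b) : AbsolutelyContinuousOnInterval g 0 b := by
  have A := H.int.norm.absolutelyContinuousOnInterval_intervalIntegral
    (c := 0) Set.left_mem_uIcc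
  unfold AbsolutelyContinuousOnInterval at A ⊢
  refine squeeze_zero' (Eventually.of_forall fun _ => Finset.sum_nonneg fun i _ => dist_nonneg)
    ?_ A
  rw [eventually_inf_principal]
  refine Eventually.of_forall ?_
  rintro ⟨n, I⟩ hI
  refine Finset.sum_le_sum fun i hi => ?_
  have h1 := (hI.1 i hi).1
  have h2 := (hI.1 i hi).2
  rw [Set.uIcc_of_le H.nonneg] at h1 h2
  have h0 : (0 : ℝ) ∈ Set.Icc 0 b := ⟨le_rfl, H.nonneg⟩
  rw [dist_comm, dist_eq_norm, H.sub_eq h1 h2, dist_comm, Real.dist_eq,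
    intervalIntegral.integral_interval_sub_left (H.int_of_mem h0 h2).norm
      (H.int_of_mem h0 h1).norm]
  exact intervalIntegral.norm_integral_le_abs_integral_norm

theorem continuousOn (H : ACDeriv g h b) : ContinuousOn g (Set.Icc 0 b) := by
  simpa [Set.uIcc_of_le H.nonneg] using H.ac.continuousOn

theorem ae_hasDerivAt [CompleteSpace E] (H : ACDeriv g h b) :
    ∀ᵐ x : ℝ, x ∈ Set.Ioo 0 b → HasDerivAt g (h x) x := by
  filter_upwards [H.int.ae_hasDerivAt_integral] with x hx hxb
  have h1 := (hx (by rw [Set.uIcc_of_le H.nonneg]; exact ⟨hxb.1.le, hxb.2.le⟩) 0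
    Set.left_mem_uIcc).const_add (g 0)
  refine h1.congr_of_eventuallyEq ?_
  filter_upwards [Ioo_mem_nhds hxb.1 hxb.2] with y hy
  exact H.eq y ⟨hy.1.le, hy.2.le⟩

theorem ae_ne (a : ℝ) : ∀ᵐ x : ℝ, x ≠ a := by simp [ae_iff]

/-- The difference of `g` and the primitive of `h` is absolutely continuous with derivative zero
almost everywhere, hence constant. This reduces the product and chain rules to pointwise
derivatives. -/
theorem of_ac [CompleteSpace E] (hb : 0 ≤ b) (hg : AbsolutelyContinuousOnInterval g 0 b)
    (hi : IntervalIntegrable h volume 0 b)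
    (hd : ∀ᵐ x : ℝ, x ∈ Set.Ioo 0 b → HasDerivAt g (h x) x) : ACDeriv g h b := by
  have H0 : ACDeriv (fun t => ∫ s in (0 : ℝ)..t, h s) h b := ⟨hb, hi, fun t _ => by simp⟩
  obtain ⟨C, hC⟩ := (hg.sub H0.ac).const_of_ae_hasDerivAt_zero (by
    filter_upwards [hd, H0.ae_hasDerivAt, ae_ne 0, ae_ne b] with x h1 h2 hx0 hxb hx
    rw [Set.uIcc_of_le hb] at hx
    have hx' : x ∈ Set.Ioo 0 b := ⟨lt_of_le_of_ne hx.1 hx0.symm, lt_of_le_of_ne hx.2 hxb⟩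
    simpa using (h1 hx').sub (h2 hx'))
  rw [Set.uIcc_of_le hb] at hC
  refine ⟨hb, hi, fun t ht => ?_⟩
  have e0 := hC 0 ⟨le_rfl, hb⟩
  have e1 := hC t ht
  simp only [Pi.sub_apply, intervalIntegral.integral_same, sub_zero] at e0 e1
  rw [e0, ← e1]
  abel

theorem congr_deriv (H : ACDeriv g h b) (he : ∀ᵐ x : ℝ, x ∈ Set.Ioo 0 b → h x = h' x) :
    ACDeriv g h' b := by
  have he' : ∀ t ∈ Set.Icc 0 b, ∀ᵐ x : ℝ, x ∈ Set.uIoc 0 t → h x = h' x := by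
    intro t ht
    filter_upwards [he, ae_ne b] with x hx hxb hxt
    rw [Set.uIoc_of_le ht.1] at hxt
    exact hx ⟨hxt.1, lt_of_le_of_ne (hxt.2.trans ht.2) hxb⟩
  refine ⟨H.nonneg, ?_, fun t ht => ?_⟩
  · refine H.int.congr_ae ((ae_restrict_iff' measurableSet_uIoc).2 ?_)
    exact he' b ⟨H.nonneg, le_rfl⟩
  · rw [H.eq t ht, intervalIntegral.integral_congr_ae (he' t ht)]

theorem const (hb : 0 ≤ b) (c : E) : ACDeriv (fun _ => c) (fun _ => 0) b :=
  ⟨hb, by simp, by simp⟩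

theorem add (H : ACDeriv g h b) (H' : ACDeriv g' h' b) :
    ACDeriv (fun t => g t + g' t) (fun t => h t + h' t) b := by
  refine ⟨H.nonneg, H.int.add H'.int, fun t ht => ?_⟩
  have h0 : (0 : ℝ) ∈ Set.Icc 0 b := ⟨le_rfl, H.nonneg⟩
  rw [intervalIntegral.integral_add (H.int_of_mem h0 ht) (H'.int_of_mem h0 ht), H.eq t ht,
    H'.eq t ht]
  abel

theorem clm [CompleteSpace E] [CompleteSpace F] (L : E →L[ℝ] F) (H : ACDeriv g h b) :
    ACDeriv (fun t => L (g t)) (fun t => L (h t)) b := by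
  have h0 : (0 : ℝ) ∈ Set.Icc 0 b := ⟨le_rfl, H.nonneg⟩
  refine ⟨H.nonneg, ⟨L.integrable_comp H.int.1, L.integrable_comp H.int.2⟩, fun t ht => ?_⟩
  rw [L.intervalIntegral_comp_comm (H.int_of_mem h0 ht), ← map_add, ← H.eq t ht]

theorem neg (H : ACDeriv g h b) : ACDeriv (fun t => -g t) (fun t => -h t) b :=
  ⟨H.nonneg, H.int.neg, fun t ht => by
    rw [intervalIntegral.integral_neg, H.eq t ht]; abel⟩

theorem sub (H : ACDeriv g h b) (H' : ACDeriv g' h' b) :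
    ACDeriv (fun t => g t - g' t) (fun t => h t - h' t) b := by
  simpa only [sub_eq_add_neg] using H.add H'.neg

theorem mul {𝕜 : Type*} [RCLike 𝕜] {g g' h h' : ℝ → 𝕜} (H : ACDeriv g h b)
    (H' : ACDeriv g' h' b) :
    ACDeriv (fun t => g t * g' t) (fun t => h t * g' t + g t * h' t) b := by
  have hb := H.nonneg
  have u := Set.uIcc_of_le hb
  refine of_ac hb (H.ac.smul H'.ac) ((H.int.mul_continuousOn (by rw [u]; exact H'.continuousOn)).add
    (H'.int.continuousOn_mul (by rw [u]; exact H.continuousOn))) ?_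
  filter_upwards [H.ae_hasDerivAt, H'.ae_hasDerivAt] with x h1 h2 hx
  exact (h1 hx).mul (h2 hx)

theorem comp {g h G dG : ℝ → ℝ} (hF : ∀ x, HasDerivAt G (dG x) x) (hF' : Continuous dG)
    (H : ACDeriv g h b) : ACDeriv (fun t => G (g t)) (fun t => dG (g t) * h t) b := by
  have hb := H.nonneg
  have u := Set.uIcc_of_le hb
  have hc : ContinuousOn (fun t => dG (g t)) (Set.uIcc 0 b) := by
    rw [u]
    exact hF'.comp_continuousOn H.continuousOn
  refine of_ac hb ?_ (H.int.continuousOn_mul hc) ?_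
  · obtain ⟨M, hM⟩ := isCompact_Icc.exists_bound_of_continuousOn H.continuousOn
    -- `G` need only be Lipschitz on the compact range of `g`; the bound `C` of its derivative there
    -- makes the variation sums at most `C` times those of `g`.
    obtain ⟨C, hC⟩ := (isCompact_Icc (a := -M) (b := M)).exists_bound_of_continuousOn
      hF'.continuousOn
    have A := H.ac.const_mul C
    unfold AbsolutelyContinuousOnInterval at A ⊢
    refine squeeze_zero' (Eventually.of_forall fun _ => Finset.sum_nonneg fun i _ => dist_nonneg)
      ?_ A
    rw [eventually_inf_principal]
    refine Eventually.of_forall ?_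
    rintro ⟨n, I⟩ hI
    refine Finset.sum_le_sum fun i hi => ?_
    have h1 := (hI.1 i hi).1
    have h2 := (hI.1 i hi).2
    rw [u] at h1 h2
    have hg : ∀ x ∈ Set.Icc 0 b, g x ∈ Set.Icc (-M) M := fun x hx => abs_le.1 (hM x hx)
    have hC0 : 0 ≤ C := (norm_nonneg _).trans (hC _ (hg _ h1))
    have := (convex_Icc (-M) M).norm_image_sub_le_of_norm_hasDerivWithin_le
      (fun x _ => (hF x).hasDerivWithinAt) hC (hg _ h2) (hg _ h1)
    simp only [dist_eq_norm, ← mul_sub, norm_mul, Real.norm_of_nonneg hC0]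
    exact this
  · filter_upwards [H.ae_hasDerivAt] with x h1 hx
    exact (hF (g x)).comp x (h1 hx)

end ACDeriv

end AbsolutelyContinuous

/-! ### Differential equations that are only measurable in time -/

section CaratheodoryODE

/-- Grönwall's inequality wants a derivative everywhere, which `g` lacks. It is applied to the
majorant `U(t) = ∫₀ᵗ |C| ‖g‖` instead, which is continuously differentiable and bounds `‖g‖`. -/
theorem ACDeriv.eq_zero_of_norm_deriv_le {E : Type*} [NormedAddCommGroup E] [NormedSpace ℝ E]
    {g h : ℝ → E} {b C : ℝ} (H : ACDeriv g h b) (h0 : g 0 = 0)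
    (hle : ∀ᵐ x : ℝ, x ∈ Set.Ioo 0 b → ‖h x‖ ≤ C * ‖g x‖) : ∀ t ∈ Set.Icc 0 b, g t = 0 := by
  have hb := H.nonneg
  set u : ℝ → ℝ := fun t => ‖g (Set.projIcc 0 b hb t)‖ with hu
  have huc : Continuous u := by
    have := H.continuousOn.domRestrict.comp (continuous_projIcc (h := hb))
    exact this.norm
  have hue : ∀ t ∈ Set.Icc 0 b, u t = ‖g t‖ := fun t ht => by
    simp only [hu, Set.projIcc_of_mem hb ht]
  set U : ℝ → ℝ := fun t => ∫ s in (0 : ℝ)..t, |C| * u s with hU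
  have hUc : Continuous fun s => |C| * u s := continuous_const.mul huc
  have hUd : ∀ t, HasDerivAt U (|C| * u t) t := fun t => hUc.integral_hasStrictDerivAt 0 t
    |>.hasDerivAt
  have hle1 : ∀ t ∈ Set.Icc 0 b, u t ≤ U t := by
    intro t ht
    rw [hue t ht, H.eq t ht, h0, zero_add]
    refine (intervalIntegral.norm_integral_le_integral_norm ht.1).trans ?_
    refine intervalIntegral.integral_mono_ae_restrict ht.1
      (H.int_of_mem ⟨le_rfl, hb⟩ ht).norm (hUc.intervalIntegrable _ _) ?_
    refine (ae_restrict_iff' measurableSet_Icc).2 ?_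
    filter_upwards [hle, ACDeriv.ae_ne 0, ACDeriv.ae_ne b] with x hx hx0 hxb hxt
    have hx' : x ∈ Set.Ioo 0 b :=
      ⟨lt_of_le_of_ne hxt.1 hx0.symm, lt_of_le_of_ne (hxt.2.trans ht.2) hxb⟩
    rw [hue x ⟨hx'.1.le, hx'.2.le⟩]
    exact (hx hx').trans (by gcongr; exact le_abs_self C)
  have hU0 : ∀ t ∈ Set.Icc 0 b, 0 ≤ U t := fun t ht => (norm_nonneg _).trans (hle1 t ht)
  have hG := norm_le_gronwallBound_of_norm_deriv_right_le (f := U) (f' := fun t => |C| * u t)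
    (δ := 0) (K := |C|) (ε := 0) (a := 0) (b := b)
    (fun t _ => (hUd t).continuousAt.continuousWithinAt) (fun t _ => (hUd t).hasDerivWithinAt)
    (by simp [hU]) (fun t ht => by
      have ht' : t ∈ Set.Icc 0 b := ⟨ht.1, ht.2.le⟩
      rw [add_zero, norm_mul, Real.norm_of_nonneg (abs_nonneg C), Real.norm_of_nonneg (hU0 t ht'),
        Real.norm_of_nonneg (norm_nonneg _)]
      exact mul_le_mul_of_nonneg_left (hle1 t ht') (abs_nonneg C))
  intro t ht
  have h1 := hG t ht
  rw [gronwallBound_ε0_δ0] at h1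
  have h2 : U t = 0 := norm_eq_zero.1 (le_antisymm h1 (norm_nonneg _))
  have h3 := hle1 t ht
  rw [h2, hue t ht] at h3
  exact norm_eq_zero.1 (le_antisymm h3 (norm_nonneg _))

/-- A vector field on the line, depending measurably on time, which is bounded and Lipschitz on
the time interval `[0, b]`. -/
structure LipField (Q : ℝ → ℝ → ℝ) (b C : ℝ) : Prop where
  pos : 0 < C
  meas : ∀ φ : ℝ → ℝ, AEMeasurable φ (volume.restrict (Set.Icc 0 b)) →
    AEMeasurable (fun s => Q s (φ s)) (volume.restrict (Set.Icc 0 b))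
  bound : ∀ s ∈ Set.Icc 0 b, ∀ x, |Q s x| ≤ C
  lip : ∀ s ∈ Set.Icc 0 b, ∀ x y, |Q s x - Q s y| ≤ C * |x - y|

namespace LipField

variable {Q : ℝ → ℝ → ℝ} {b C : ℝ}

theorem mono (hQ : LipField Q b C) {c : ℝ} (hc : c ≤ b) : LipField Q c C := by
  have hs : Set.Icc 0 c ⊆ Set.Icc 0 b := Set.Icc_subset_Icc_right hc
  refine ⟨hQ.pos, fun φ hφ => ?_, fun s hs' => hQ.bound s (hs hs'), fun s hs' => hQ.lip s (hs hs')⟩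
  -- The measurability in `hQ` concerns functions on the longer interval, so `φ` is extended by
  -- zero.
  have h1 : AEMeasurable ((Set.Icc 0 c).indicator φ) (volume.restrict (Set.Icc 0 b)) :=
    ((aemeasurable_indicator_iff measurableSet_Icc).2 hφ).restrict
  refine ((hQ.meas _ h1).mono_set hs).congr ?_
  filter_upwards [ae_restrict_mem measurableSet_Icc] with s hs
  simp [Set.indicator_of_mem hs]

theorem intervalIntegrable (hQ : LipField Q b C) (hb : 0 ≤ b) {φ : ℝ → ℝ}
    (hφ : AEMeasurable φ (volume.restrict (Set.Icc 0 b))) :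
    IntervalIntegrable (fun s => Q s (φ s)) volume 0 b := by
  rw [intervalIntegrable_iff_integrableOn_Icc_of_le hb]
  refine Integrable.of_bound (hQ.meas φ hφ).aestronglyMeasurable C ?_
  filter_upwards [ae_restrict_mem measurableSet_Icc] with s hs
  exact hQ.bound s hs _

theorem unique (hQ : LipField Q b C) {φ ψ : ℝ → ℝ} (hφ : ACDeriv φ (fun s => Q s (φ s)) b)
    (hψ : ACDeriv ψ (fun s => Q s (ψ s)) b) (h0 : φ 0 = ψ 0) : ∀ t ∈ Set.Icc 0 b, φ t = ψ t := by
  intro t ht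
  refine sub_eq_zero.1 ((hφ.sub hψ).eq_zero_of_norm_deriv_le (C := C) (by simp [h0]) ?_ t ht)
  exact Eventually.of_forall fun x hx => hQ.lip x ⟨hx.1.le, hx.2.le⟩ _ _

/-- Existence for the initial value problem, by Picard iteration. -/
theorem exists_solution {I : Set ℝ} (hI : ∀ b ∈ I, 0 ≤ b ∧ ∀ c ∈ Set.Icc 0 b, c ∈ I)
    (hQ : ∀ b ∈ I, ∃ C, LipField Q b C) (x₀ : ℝ) :
    ∃ φ : ℝ → ℝ, φ 0 = x₀ ∧ ∀ b ∈ I, ACDeriv φ (fun s => Q s (φ s)) b := by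
  classical
  obtain ⟨P, P0, PS⟩ : ∃ P : ℕ → ℝ → ℝ, P 0 = (fun _ => x₀) ∧
      ∀ n t, P (n + 1) t = x₀ + ∫ s in (0 : ℝ)..t, Q s (P n s) :=
    ⟨fun n => Nat.rec (fun _ => x₀) (fun _ φ t => x₀ + ∫ s in (0 : ℝ)..t, Q s (φ s)) n,
      rfl, fun _ _ => rfl⟩
  have Pz : ∀ n, P n 0 = x₀ := fun n => by cases n <;> simp [P0, PS]
  have hcont : ∀ b ∈ I, ∀ n, ContinuousOn (P n) (Set.Icc 0 b) := by
    intro b hb n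
    induction n with
    | zero =>
      rw [P0]
      exact continuousOn_const
    | succ n ih =>
      obtain ⟨C, hC⟩ := hQ b hb
      have : ACDeriv (P (n + 1)) (fun s => Q s (P n s)) b :=
        ⟨(hI b hb).1, hC.intervalIntegrable (hI b hb).1 (ih.aemeasurable measurableSet_Icc),
          fun t _ => by rw [Pz, PS]⟩
      exact this.continuousOn
  have hPi : ∀ b ∈ I, ∀ n, ∀ t ∈ Set.Icc 0 b,
      IntervalIntegrable (fun s => Q s (P n s)) volume 0 t := by
    intro b hb n t ht
    obtain ⟨C, hC⟩ := hQ b hb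
    exact (hC.mono ht.2).intervalIntegrable ht.1
      ((hcont t ((hI b hb).2 t ht) n).aemeasurable measurableSet_Icc)
  -- With the weight `exp (2 C t)` the Picard map contracts by `1/2`, since `∫₀ᵗ C exp (2 C s) ds ≤
  -- exp (2 C t) / 2`. The iterates therefore converge on all of `I` without gluing short intervals.
  have hstep : ∀ b ∈ I, ∀ C, LipField Q b C → ∀ n, ∀ t ∈ Set.Icc 0 b,
      |P (n + 1) t - P n t| ≤ Real.exp (2 * C * t) * (1 / 2) ^ n := by
    intro b hb C hC n
    induction n with
    | zero =>
      intro t ht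
      have hbd : ∀ s ∈ Set.uIoc 0 t, ‖Q s (P 0 s)‖ ≤ C := fun s hs => by
        rw [Set.uIoc_of_le ht.1] at hs
        exact hC.bound s ⟨hs.1.le, hs.2.trans ht.2⟩ _
      have : |∫ s in (0 : ℝ)..t, Q s (P 0 s)| ≤ C * |t - 0| :=
        intervalIntegral.norm_integral_le_of_norm_le_const hbd
      rw [PS, P0, add_sub_cancel_left]
      rw [sub_zero, abs_of_nonneg ht.1] at this
      have h1 := Real.add_one_le_exp (2 * C * t)
      have h2 : 0 ≤ C * t := mul_nonneg hC.pos.le ht.1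
      rw [P0] at this
      simp only [pow_zero, mul_one]
      linarith
    | succ n ih =>
      intro t ht
      rw [PS, PS n, add_sub_add_left_eq_sub, ← intervalIntegral.integral_sub
        (hPi b hb (n + 1) t ht) (hPi b hb n t ht)]
      have hd : ∀ s, HasDerivAt (fun s => Real.exp (2 * C * s) * (1 / 2) ^ (n + 1))
          (C * (Real.exp (2 * C * s) * (1 / 2) ^ n)) s := by
        intro s
        have := (((hasDerivAt_id' s).const_mul (2 * C)).exp).mul_const ((1 / 2 : ℝ) ^ (n + 1))
        exact this.congr_deriv (by ring)
      have hc : Continuous fun s => C * (Real.exp (2 * C * s) * (1 / 2) ^ n) := by fun_prop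
      have hint := intervalIntegral.integral_eq_sub_of_hasDerivAt (a := 0) (b := t)
        (fun s _ => hd s) (hc.intervalIntegrable _ _)
      calc |∫ s in (0 : ℝ)..t, (Q s (P (n + 1) s) - Q s (P n s))|
          ≤ ∫ s in (0 : ℝ)..t, C * (Real.exp (2 * C * s) * (1 / 2) ^ n) := by
            rw [← Real.norm_eq_abs]
            refine intervalIntegral.norm_integral_le_of_norm_le ht.1 ?_ (hc.intervalIntegrable _ _)
            refine Eventually.of_forall fun s hs => ?_
            have hs' : s ∈ Set.Icc 0 b := ⟨hs.1.le, hs.2.trans ht.2⟩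
            exact (hC.lip s hs' _ _).trans (mul_le_mul_of_nonneg_left (ih s hs') hC.pos.le)
        _ ≤ _ := by
            rw [hint]
            simp only [mul_zero, Real.exp_zero, one_mul]
            have : (0 : ℝ) ≤ (1 / 2) ^ (n + 1) := by positivity
            linarith
  have hlim : ∀ t, ∃ x, t ∈ I → Tendsto (fun n => P n t) atTop (𝓝 x) := by
    intro t
    by_cases ht : t ∈ I
    · obtain ⟨C, hC⟩ := hQ t ht
      have : CauchySeq fun n => P n t :=
        cauchySeq_of_le_geometric (1 / 2) (Real.exp (2 * C * t)) (by norm_num) fun n => by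
          rw [dist_comm, Real.dist_eq]
          exact hstep t ht C hC n t ⟨(hI t ht).1, le_rfl⟩
      obtain ⟨x, hx⟩ := cauchySeq_tendsto_of_complete this
      exact ⟨x, fun _ => hx⟩
    · exact ⟨0, fun h => absurd h ht⟩
  choose φ hφ using hlim
  -- If `I` is empty, the limits say nothing about the value at `0`, which is therefore set by hand.
  refine ⟨fun t => if t = 0 then x₀ else φ t, by simp, fun b hb => ?_⟩
  set ψ : ℝ → ℝ := fun t => if t = 0 then x₀ else φ t with hψ
  have hψlim : ∀ t ∈ I, Tendsto (fun n => P n t) atTop (𝓝 (ψ t)) := by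
    intro t ht
    by_cases h : t = 0
    · simp only [hψ, h, if_true, Pz]
      exact tendsto_const_nhds
    · simp only [hψ, h, if_false]
      exact hφ t ht
  have hψm : ∀ b ∈ I, AEMeasurable ψ (volume.restrict (Set.Icc 0 b)) := by
    intro b hb
    refine aemeasurable_of_tendsto_metrizable_ae atTop
      (fun n => (hcont b hb n).aemeasurable measurableSet_Icc) ?_
    filter_upwards [ae_restrict_mem measurableSet_Icc] with s hs
    exact hψlim s ((hI b hb).2 s hs)
  obtain ⟨C, hC⟩ := hQ b hb
  refine ⟨(hI b hb).1, hC.intervalIntegrable (hI b hb).1 (hψm b hb), fun t ht => ?_⟩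
  have htI := (hI b hb).2 t ht
  have hL : Tendsto (fun n => ∫ s in (0 : ℝ)..t, Q s (P n s)) atTop
      (𝓝 (∫ s in (0 : ℝ)..t, Q s (ψ s))) := by
    refine intervalIntegral.tendsto_integral_filter_of_dominated_convergence (fun _ => C)
      (Eventually.of_forall fun n => ?_) (Eventually.of_forall fun n => ?_) (by simp)
      (Eventually.of_forall fun s hs => ?_)
    · exact (hPi b hb n t ht).aestronglyMeasurable_restrict_uIoc
    · refine Eventually.of_forall fun s hs => ?_
      rw [Set.uIoc_of_le ht.1] at hs
      exact hC.bound s ⟨hs.1.le, hs.2.trans ht.2⟩ _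
    · rw [Set.uIoc_of_le ht.1] at hs
      have hs' : s ∈ Set.Icc 0 b := ⟨hs.1.le, hs.2.trans ht.2⟩
      refine tendsto_iff_norm_sub_tendsto_zero.2 (squeeze_zero (fun _ => norm_nonneg _)
        (fun n => hC.lip s hs' _ _) ?_)
      have := (tendsto_iff_norm_sub_tendsto_zero.1 (hψlim s ((hI b hb).2 s hs'))).const_mul C
      simpa using this
  have h1 := (hψlim t htI).comp (tendsto_add_atTop_nat 1)
  have h2 := hL.const_add x₀
  have h3 : ψ 0 = x₀ := by simp [hψ]
  rw [h3]
  exact tendsto_nhds_unique (h1.congr fun n => PS n t) h2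

/-- Comparison: a faster positive multiple of the field moves strictly ahead. -/
theorem lt_of_lt (hQ : LipField Q b C) (hb : 0 < b) (hpos : ∀ s ∈ Set.Icc 0 b, ∀ x, 0 < Q s x)
    {l m : ℝ} (hlm : l < m) {φ ψ : ℝ → ℝ} (hφ : ACDeriv φ (fun s => l * Q s (φ s)) b)
    (hψ : ACDeriv ψ (fun s => m * Q s (ψ s)) b) (h0 : φ 0 = ψ 0) : φ b < ψ b := by
  have hφm : AEMeasurable φ (volume.restrict (Set.Icc 0 b)) :=
    hφ.continuousOn.aemeasurable measurableSet_Icc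
  have hψm : AEMeasurable ψ (volume.restrict (Set.Icc 0 b)) :=
    hψ.continuousOn.aemeasurable measurableSet_Icc
  -- With this difference quotient, `δ = ψ - φ` satisfies the linear equation `δ' = k δ + (m - l)
  -- Q(ψ)`. It is bounded by the Lipschitz condition; where `δ = 0` the division gives `k = 0`,
  -- which is harmless.
  set k : ℝ → ℝ := fun s => l * ((Q s (ψ s) - Q s (φ s)) / (ψ s - φ s)) with hk
  have hkm : AEMeasurable k (volume.restrict (Set.Icc 0 b)) :=
    (((hQ.meas ψ hψm).sub (hQ.meas φ hφm)).div (hψm.sub hφm)).const_mul l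
  have hki : IntervalIntegrable k volume 0 b := by
    rw [intervalIntegrable_iff_integrableOn_Icc_of_le hb.le]
    refine Integrable.of_bound hkm.aestronglyMeasurable (|l| * C) ?_
    filter_upwards [ae_restrict_mem measurableSet_Icc] with s hs
    rw [hk, Real.norm_eq_abs, abs_mul, abs_div]
    exact mul_le_mul_of_nonneg_left (div_le_of_le_mul₀ (abs_nonneg _) hQ.pos.le
      (hQ.lip s hs _ _)) (abs_nonneg l)
  have hK : ACDeriv (fun t => ∫ s in (0 : ℝ)..t, k s) k b := ⟨hb.le, hki, fun t _ => by simp⟩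
  have hE := hK.neg.comp Real.hasDerivAt_exp Real.continuous_exp
  -- `E` is the integrating factor: `(δ E)' = (m - l) Q(ψ) E` is positive, so `δ E` has grown from
  -- zero.
  set E : ℝ → ℝ := fun t => Real.exp (-∫ s in (0 : ℝ)..t, k s) with hEdef
  have hM := (hψ.sub hφ).mul hE
  have hM' : ACDeriv (fun t => (ψ t - φ t) * E t) (fun s => (m - l) * Q s (ψ s) * E s) b := by
    refine hM.congr_deriv (Eventually.of_forall fun s _ => ?_)
    have hkd : k s * (ψ s - φ s) = l * (Q s (ψ s) - Q s (φ s)) := by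
      rcases eq_or_ne (ψ s - φ s) 0 with h | h
      · have : ψ s = φ s := sub_eq_zero.1 h
        rw [h, this]; ring
      · rw [hk]; field_simp
    rw [show (-∫ r in (0 : ℝ)..s, k r).exp = E s from rfl]
    linear_combination (-E s) * hkd
  have := intervalIntegral.intervalIntegral_pos_of_pos_on hM'.int (fun s hs =>
    mul_pos (mul_pos (sub_pos.2 hlm) (hpos s ⟨hs.1.le, hs.2.le⟩ _)) (Real.exp_pos _)) hb
  rw [← hM'.sub_eq ⟨le_rfl, hb.le⟩ ⟨hb.le, le_rfl⟩] at this
  simp only [h0, sub_self, zero_mul, sub_zero] at this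
  exact sub_pos.1 (pos_of_mul_pos_left this (Real.exp_pos _).le)

end LipField

end CaratheodoryODE

/-! ### Compact symmetric operators -/

section Operators

variable {𝕜 H : Type*} [RCLike 𝕜] [NormedAddCommGroup H] [InnerProductSpace 𝕜 H]

/-- A Hilbert basis is an isometry onto `ℓ²`. For `L²_R` completeness thus comes with the basis in
the Hilbert–Schmidt hypothesis and needs no direct proof. -/
theorem HilbertBasis.completeSpace {ι : Type*} (b : HilbertBasis ι 𝕜 H) : CompleteSpace H :=
  (completeSpace_congr (e := b.repr.toEquiv) b.repr.isometry.isUniformEmbedding).2 inferInstance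

theorem IsHilbertSchmidt.completeSpace {K : H →L[𝕜] H} (hK : IsHilbertSchmidt K) :
    CompleteSpace H := by
  obtain ⟨s, b, -⟩ := hK
  exact b.completeSpace

/-- `K` is the norm limit of its finite rank parts `∑ ⟨b k, ·⟩ K (b k)`. By Cauchy–Schwarz and
Bessel, the norm of a remainder is at most the square root of the tail of `∑ ‖K (b k)‖²`. -/
theorem IsHilbertSchmidt.isCompactOperator {K : H →L[𝕜] H} (hK : IsHilbertSchmidt K) :
    IsCompactOperator K := by
  have := hK.completeSpace
  obtain ⟨s, b, hs⟩ := hK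
  set F : Finset s → H →L[𝕜] H := fun t =>
    ∑ k ∈ t, (ContinuousLinearMap.toSpanSingleton 𝕜 (K (b k))).comp (innerSL 𝕜 (b k)) with hF
  have hFa : ∀ t w, F t w = ∑ k ∈ t, inner 𝕜 (b k) w • K (b k) := by
    intro t w
    simp [hF]
  refine isCompactOperator_of_tendsto (l := atTop) (F := F) ?_ (Eventually.of_forall fun t => ?_)
  · rw [Metric.tendsto_nhds]
    intro ε hε
    obtain ⟨s₀, hs₀⟩ := summable_iff_vanishing_norm.1 hs ((ε / 2) ^ 2) (by positivity)
    filter_upwards [eventually_ge_atTop s₀] with t ht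
    rw [dist_eq_norm, norm_sub_rev]
    refine lt_of_le_of_lt (ContinuousLinearMap.opNorm_le_bound _ (half_pos hε).le fun w => ?_)
      (half_lt_self hε)
    have hsum : HasSum (fun k => inner 𝕜 (b k) w • K (b k)) (K w) := by
      have := (b.hasSum_repr w).mapL K
      simpa [b.repr_apply_apply] using this
    have hlim : Tendsto (fun r : Finset s => ‖F r w - F t w‖) atTop (𝓝 ‖K w - F t w‖) := by
      refine (Tendsto.sub_const ?_ _).norm
      simp only [hFa]
      exact hsum
    rw [sub_apply]
    refine le_of_tendsto hlim ?_
    filter_upwards [eventually_ge_atTop t] with r hr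
    classical
    have e : F r w - F t w = ∑ k ∈ r \ t, inner 𝕜 (b k) w • K (b k) := by
      rw [hFa, hFa, ← Finset.sum_sdiff hr, add_sub_cancel_right]
    rw [e]
    have h1 := hs₀ (r \ t) (Finset.disjoint_of_subset_right ht Finset.sdiff_disjoint)
    rw [Real.norm_of_nonneg (Finset.sum_nonneg fun _ _ => sq_nonneg _)] at h1
    have h2 : ∑ k ∈ r \ t, ‖inner 𝕜 (b k) w‖ ^ 2 ≤ ‖w‖ ^ 2 := b.orthonormal.sum_inner_products_le w
    calc ‖∑ k ∈ r \ t, inner 𝕜 (b k) w • K (b k)‖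
        ≤ ∑ k ∈ r \ t, ‖K (b k)‖ * ‖inner 𝕜 (b k) w‖ := by
          refine (norm_sum_le _ _).trans (Finset.sum_le_sum fun k _ => ?_)
          rw [norm_smul, mul_comm]
      _ ≤ √(∑ k ∈ r \ t, ‖K (b k)‖ ^ 2) * √(∑ k ∈ r \ t, ‖inner 𝕜 (b k) w‖ ^ 2) :=
          Real.sum_mul_le_sqrt_mul_sqrt _ _ _
      _ ≤ ε / 2 * ‖w‖ := by
          refine mul_le_mul ?_ ?_ (Real.sqrt_nonneg _) (half_pos hε).le
          · exact Real.sqrt_le_iff.2 ⟨(half_pos hε).le, h1.le⟩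
          · exact Real.sqrt_le_iff.2 ⟨norm_nonneg _, h2⟩
  · have : ∀ t : Finset s, IsCompactOperator (F t) := by
      intro t
      classical
      induction t using Finset.induction_on with
      | empty => simpa [hF] using (isCompactOperator_zero : IsCompactOperator (0 : H → H))
      | insert k t hk ih =>
        have e : F (insert k t) =
            (ContinuousLinearMap.toSpanSingleton 𝕜 (K (b k))).comp (innerSL 𝕜 (b k)) + F t := by
          simp only [hF, Finset.sum_insert hk]
        rw [e]
        refine IsCompactOperator.add ?_ ih
        exact (isCompactOperator_of_locallyCompactSpace_rng
          (ContinuousLinearMap.toSpanSingleton 𝕜 (K (b k)))).comp_clm _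
    exact this t

/-- The top of the spectrum of a compact symmetric operator is an eigenvalue. -/
theorem exists_eigenvector_ge [CompleteSpace H] {T : H →L[𝕜] H} (hT : IsCompactOperator T)
    (hsym : T.toLinearMap.IsSymmetric) {c : ℝ} (hc : 0 < c) {x : H} (hx : x ≠ 0)
    (hxc : c * ‖x‖ ^ 2 ≤ RCLike.re (inner 𝕜 (T x) x)) :
    ∃ (κ : ℝ) (e : H), c ≤ κ ∧ e ≠ 0 ∧ T e = (κ : 𝕜) • e := by
  set q : H → ℝ := fun y => RCLike.re (inner 𝕜 (T y) y) with hq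
  set S : Set ℝ := q '' {y | ‖y‖ = 1} with hS
  have hSb : BddAbove S := by
    refine ⟨‖T‖, ?_⟩
    rintro _ ⟨y, hy, rfl⟩
    have hy' : ‖y‖ = 1 := hy
    have h1 := T.le_opNorm y
    have h2 : ‖inner 𝕜 (T y) y‖ ≤ ‖T y‖ * ‖y‖ := norm_inner_le_norm (T y) y
    rw [hy', mul_one] at h1 h2
    exact ((RCLike.re_le_norm _).trans h2).trans h1
  have hqs : ∀ (a : ℝ) (y : H), q ((a : 𝕜) • y) = a ^ 2 * q y := by
    intro a y
    simp only [hq, map_smul, inner_smul_left, inner_smul_right, RCLike.conj_ofReal,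
      RCLike.re_ofReal_mul]
    ring
  have hunit : ∀ y : H, y ≠ 0 → ‖((‖y‖⁻¹ : ℝ) : 𝕜) • y‖ = 1 := by
    intro y hy
    rw [norm_smul, RCLike.norm_ofReal, abs_of_nonneg (inv_nonneg.2 (norm_nonneg y)),
      inv_mul_cancel₀ (norm_ne_zero_iff.2 hy)]
  set s : ℝ := sSup S with hs
  have hle : ∀ y, q y ≤ s * ‖y‖ ^ 2 := by
    intro y
    rcases eq_or_ne y 0 with rfl | hy
    · simp [hq]
    · have h1 : q (((‖y‖⁻¹ : ℝ) : 𝕜) • y) ≤ s := le_csSup hSb ⟨_, hunit y hy, rfl⟩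
      rw [hqs] at h1
      have hn : 0 < ‖y‖ ^ 2 := by positivity
      rw [inv_pow, inv_mul_le_iff₀ hn] at h1
      linarith
  have hcs : c ≤ s := by
    have hn : 0 < ‖x‖ ^ 2 := by positivity
    exact le_of_mul_le_mul_right (hxc.trans (hle x)) hn
  have hs0 : 0 < s := hc.trans_le hcs
  by_contra hno
  push Not at hno
  -- The supremum `s` of the quadratic form on the unit sphere should be an eigenvalue. If it is
  -- not, compactness makes `s - T` bounded below, and the form cannot come near `s`.
  have hnev : ¬ Module.End.HasEigenvalue (T : Module.End 𝕜 H) (s : 𝕜) := by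
    intro h
    obtain ⟨e, he⟩ := h.exists_hasEigenvector
    exact hno s e hcs he.2 he.apply_eq_smul
  obtain ⟨L, hL⟩ := hT.antilipschitz_of_not_hasEigenvalue
    (by exact_mod_cast hs0.ne') hnev
  set A : H →L[𝕜] H := (s : 𝕜) • 1 - T with hA
  have hAL : ∀ y, ‖y‖ ≤ L * ‖A y‖ := by
    intro y
    have h1 := hL.le_mul_dist y 0
    rw [map_zero, dist_zero_right, dist_zero_right] at h1
    have e : A y = -((T - (s : 𝕜) • 1 : H →L[𝕜] H) y) := by simp [hA]
    rw [e, norm_neg]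
    exact h1
  have hAq : ∀ y, RCLike.re (inner 𝕜 (A y) y) = s * ‖y‖ ^ 2 - q y := by
    intro y
    simp only [hA, sub_apply, smul_apply,
      one_apply_eq_self, inner_sub_left, inner_smul_left, RCLike.conj_ofReal, map_sub,
      RCLike.re_ofReal_mul, inner_self_eq_norm_sq, hq]
  have hApos : ∀ y, 0 ≤ RCLike.re (inner 𝕜 (A y) y) := fun y => by
    rw [hAq]; linarith [hle y]
  have hAsym : ∀ y z, inner 𝕜 (A y) z = inner 𝕜 y (A z) := by
    intro y z
    have := hsym y z
    simp only [ContinuousLinearMap.coe_coe] at this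
    simp only [hA, sub_apply, smul_apply,
      one_apply_eq_self, inner_sub_left, inner_sub_right, inner_smul_left,
      inner_smul_right, RCLike.conj_ofReal, this]
  -- Cauchy–Schwarz for the nonnegative form of `A = s - T`, obtained by testing positivity on `y -
  -- t A y`. The summand `1` keeps `t = 1 / (‖A‖ + 1)` meaningful when `A = 0`.
  have hCS : ∀ y, ‖A y‖ ^ 2 ≤ (‖A‖ + 1) * RCLike.re (inner 𝕜 (A y) y) := by
    intro y
    set t : ℝ := (‖A‖ + 1)⁻¹ with ht
    have hA1 : 0 < ‖A‖ + 1 := by positivity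
    have ht0 : 0 < t := inv_pos.2 hA1
    have h1 := hApos (y - (t : 𝕜) • A y)
    have h2 : RCLike.re (inner 𝕜 (A (A y)) (A y)) ≤ ‖A‖ * ‖A y‖ ^ 2 := by
      refine (RCLike.re_le_norm _).trans ((norm_inner_le_norm _ _).trans ?_)
      have := mul_le_mul_of_nonneg_right (A.le_opNorm (A y)) (norm_nonneg (A y))
      linarith
    have e : RCLike.re (inner 𝕜 (A (y - (t : 𝕜) • A y)) (y - (t : 𝕜) • A y)) =
        RCLike.re (inner 𝕜 (A y) y) - 2 * t * ‖A y‖ ^ 2 +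
          t ^ 2 * RCLike.re (inner 𝕜 (A (A y)) (A y)) := by
      simp only [map_sub, map_smul, inner_sub_left, inner_sub_right, inner_smul_left,
        inner_smul_right, RCLike.conj_ofReal, RCLike.re_ofReal_mul, hAsym (A y) y,
        inner_self_eq_norm_sq]
      ring
    rw [e] at h1
    have h3 : t * (‖A‖ + 1) = 1 := inv_mul_cancel₀ hA1.ne'
    have h4 : t ^ 2 * RCLike.re (inner 𝕜 (A (A y)) (A y)) ≤ t * ‖A y‖ ^ 2 := by
      calc _ ≤ t ^ 2 * (‖A‖ * ‖A y‖ ^ 2) := mul_le_mul_of_nonneg_left h2 (sq_nonneg t)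
        _ = t * (t * (‖A‖ + 1)) * ‖A y‖ ^ 2 - t ^ 2 * ‖A y‖ ^ 2 := by ring
        _ ≤ _ := by rw [h3]; nlinarith [mul_nonneg (sq_nonneg t) (sq_nonneg ‖A y‖)]
    have h5 : t * ‖A y‖ ^ 2 ≤ RCLike.re (inner 𝕜 (A y) y) := by linarith
    calc ‖A y‖ ^ 2 = (‖A‖ + 1) * (t * ‖A y‖ ^ 2) := by
          rw [← mul_assoc, mul_comm (‖A‖ + 1), h3, one_mul]
      _ ≤ _ := mul_le_mul_of_nonneg_left h5 hA1.le
  set D : ℝ := (L : ℝ) ^ 2 * (‖A‖ + 1) with hD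
  have hgap : ∀ y, ‖y‖ = 1 → 1 ≤ D * (s - q y) := by
    intro y hy
    have h1 := hAL y
    have h2 := hCS y
    rw [hAq, hy] at h2
    rw [hy] at h1
    have h3 : (1 : ℝ) ≤ (L * ‖A y‖) ^ 2 := one_le_pow₀ h1
    calc (1 : ℝ) ≤ (L * ‖A y‖) ^ 2 := h3
      _ = (L : ℝ) ^ 2 * ‖A y‖ ^ 2 := by ring
      _ ≤ (L : ℝ) ^ 2 * ((‖A‖ + 1) * (s * 1 ^ 2 - q y)) :=
        mul_le_mul_of_nonneg_left h2 (sq_nonneg _)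
      _ = _ := by rw [hD]; ring
  have hne : S.Nonempty := ⟨_, _, hunit x hx, rfl⟩
  have hD0 : 0 < D := by
    rcases (show 0 ≤ D by positivity).lt_or_eq with h | h
    · exact h
    · have := hgap _ (hunit x hx)
      rw [← h] at this
      linarith
  have : s ≤ s - D⁻¹ := by
    refine csSup_le hne ?_
    rintro _ ⟨y, hy, rfl⟩
    have h1 := hgap y hy
    rw [← inv_le_iff_one_le_mul₀' hD0] at h1
    linarith
  have := inv_pos.2 hD0
  linarith

theorem exists_eigenvector_ge_of_invariant [CompleteSpace H] {T : H →L[𝕜] H}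
    (hT : IsCompactOperator T) (hsym : T.toLinearMap.IsSymmetric) {c : ℝ} (hc : 0 < c)
    (M : Submodule 𝕜 H) (hM : IsClosed (M : Set H)) (hinv : ∀ x ∈ M, T x ∈ M) {x : H}
    (hxM : x ∈ M) (hx : x ≠ 0) (hxc : c * ‖x‖ ^ 2 ≤ RCLike.re (inner 𝕜 (T x) x)) :
    ∃ (κ : ℝ) (e : H), e ∈ M ∧ c ≤ κ ∧ e ≠ 0 ∧ T e = (κ : 𝕜) • e := by
  have : CompleteSpace M := hM.completeSpace_coe
  obtain ⟨κ, e, h1, h2, h3⟩ := exists_eigenvector_ge (T := T.restrict hinv) (hT.restrict' hinv)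
    (hsym.restrict_invariant hinv) hc (x := ⟨x, hxM⟩) (by simpa using hx) hxc
  exact ⟨κ, e, e.2, h1, by simpa using h2, by simpa using congrArg Subtype.val h3⟩

/-- A compact symmetric operator whose quadratic form is at least `c > 0` on a subspace of
dimension `n`, and whose eigenvalues above `c` are simple, has `n` distinct eigenvalues above
`c`. -/
theorem exists_eigenvalues_ge [CompleteSpace H] {T : H →L[𝕜] H} (hT : IsCompactOperator T)
    (hsym : T.toLinearMap.IsSymmetric) {c : ℝ} (hc : 0 < c) (E : Submodule 𝕜 H)
    [FiniteDimensional 𝕜 E]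
    (hE : ∀ x ∈ E, c * ‖x‖ ^ 2 ≤ RCLike.re (inner 𝕜 (T x) x))
    (hsimple : ∀ κ : ℝ, c ≤ κ → ∀ v w, v ≠ 0 → T v = (κ : 𝕜) • v → T w = (κ : 𝕜) • w →
      ∃ a : 𝕜, w = a • v) :
    ∃ s : Finset ℝ, s.card = Module.finrank 𝕜 E ∧
      ∀ κ ∈ s, c ≤ κ ∧ ∃ v, v ≠ 0 ∧ T v = (κ : 𝕜) • v := by
  suffices ∀ n ≤ Module.finrank 𝕜 E, ∃ s : Finset ℝ, s.card = n ∧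
      ∀ κ ∈ s, c ≤ κ ∧ ∃ v, v ≠ 0 ∧ T v = (κ : 𝕜) • v from this _ le_rfl
  intro n
  induction n with
  | zero => exact fun _ => ⟨∅, rfl, by simp⟩
  | succ n ih =>
    intro hn
    obtain ⟨s, hs, hsE⟩ := ih (by omega)
    choose hge e he0 he using fun κ : s => hsE κ.1 κ.2
    set Φ : H →L[𝕜] (s → 𝕜) := ContinuousLinearMap.pi fun κ => innerSL 𝕜 (e κ) with hΦ
    have hΦa : ∀ x, Φ x = 0 ↔ ∀ κ, inner 𝕜 (e κ) x = 0 := by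
      intro x
      simp [hΦ, funext_iff]
    -- `E` has dimension larger than the number of eigenvectors found so far, so it contains a
    -- nonzero vector orthogonal to all of them. Their orthogonal complement is invariant by
    -- symmetry and supplies a further eigenvector.
    have hker : LinearMap.ker (Φ.toLinearMap.domRestrict E) ≠ ⊥ := by
      refine LinearMap.ker_ne_bot_of_finrank_lt ?_
      rw [Module.finrank_fintype_fun_eq_card, Fintype.card_coe, hs]
      omega
    obtain ⟨x, hx, hx0⟩ := Submodule.exists_mem_ne_zero_of_ne_bot hker
    have hxM : Φ x.1 = 0 := by simpa using hx
    obtain ⟨κ, v, hv, h1, h2, h3⟩ := exists_eigenvector_ge_of_invariant hT hsym hc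
      (LinearMap.ker Φ.toLinearMap) Φ.isClosed_ker (fun y hy => by
        rw [LinearMap.mem_ker, ContinuousLinearMap.coe_coe, hΦa] at hy ⊢
        intro κ
        have := hsym (e κ) y
        simp only [ContinuousLinearMap.coe_coe] at this
        rw [← this, he, inner_smul_left, hy κ, mul_zero])
      (x := x.1) (by simpa using hxM) (by simpa using hx0) (hE x.1 x.2)
    -- An old eigenvalue is impossible: by simplicity `v` would be a multiple of an old eigenvector,
    -- to which it is orthogonal.
    have hκ : κ ∉ s := by
      intro hκ
      obtain ⟨a, rfl⟩ := hsimple κ h1 (e ⟨κ, hκ⟩) v (he0 _) (he ⟨κ, hκ⟩) h3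
      rw [LinearMap.mem_ker, ContinuousLinearMap.coe_coe, hΦa] at hv
      have := hv ⟨κ, hκ⟩
      rw [inner_smul_right, mul_eq_zero] at this
      rcases this with h | h
      · exact h2 (by rw [h, zero_smul])
      · exact he0 _ (inner_self_eq_zero.1 h)
    refine ⟨insert κ s, by rw [Finset.card_insert_of_notMem hκ, hs], fun κ' hκ' => ?_⟩
    rcases Finset.mem_insert.1 hκ' with rfl | h
    · exact ⟨h1, v, h2, h3⟩
    · exact hsE κ' h

/-- The eigenvalues of a compact symmetric operator accumulate only at zero. -/
theorem finite_eigenvalues {T : H →L[𝕜] H} (hT : IsCompactOperator T)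
    (hsym : T.toLinearMap.IsSymmetric) {c : ℝ} (hc : 0 < c) :
    {κ : ℝ | c ≤ |κ| ∧ ∃ v, v ≠ 0 ∧ T v = (κ : 𝕜) • v}.Finite := by
  by_contra hinf
  have hinf' : {κ : ℝ | c ≤ |κ| ∧ ∃ v, v ≠ 0 ∧ T v = (κ : 𝕜) • v}.Infinite := hinf
  set f := hinf'.natEmbedding with hf
  have hu : ∀ n, ∃ v : H, ‖v‖ = 1 ∧ T v = ((f n : ℝ) : 𝕜) • v := by
    intro n
    obtain ⟨-, v, hv0, hv⟩ := (f n).2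
    refine ⟨((‖v‖⁻¹ : ℝ) : 𝕜) • v, ?_, by rw [map_smul, hv, smul_comm]⟩
    rw [norm_smul, RCLike.norm_ofReal, abs_of_nonneg (inv_nonneg.2 (norm_nonneg v)),
      inv_mul_cancel₀ (norm_ne_zero_iff.2 hv0)]
  choose v hv1 hv using hu
  have horth : ∀ m n, m ≠ n → inner 𝕜 (v m) (v n) = 0 := by
    intro m n hmn
    have := hsym (v m) (v n)
    simp only [ContinuousLinearMap.coe_coe] at this
    rw [hv, hv, inner_smul_left, inner_smul_right, RCLike.conj_ofReal, ← sub_eq_zero,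
      ← sub_mul, mul_eq_zero] at this
    refine this.resolve_left fun h => hmn (f.injective (Subtype.ext ?_))
    exact_mod_cast sub_eq_zero.1 h
  -- By Pythagoras the images of orthonormal eigenvectors stay `c` apart, so they have no convergent
  -- subsequence, against compactness.
  have hfar : ∀ m n, m ≠ n → c ≤ ‖T (v m) - T (v n)‖ := by
    intro m n hmn
    have h0 : inner 𝕜 (T (v m)) (-T (v n)) = 0 := by
      rw [hv, hv, inner_neg_right, inner_smul_left, inner_smul_right, horth m n hmn]
      simp
    have h1 := norm_add_sq_eq_norm_sq_add_norm_sq_of_inner_eq_zero _ _ h0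
    rw [← sub_eq_add_neg] at h1
    have h2 : ‖T (v m)‖ = |(f m : ℝ)| := by
      rw [hv, norm_smul, hv1, mul_one, RCLike.norm_ofReal]
    have h3 : c ≤ ‖T (v m)‖ := h2 ▸ (f m).2.1
    nlinarith [norm_nonneg (T (v m) - T (v n)), mul_self_nonneg ‖-T (v n)‖]
  obtain ⟨C, hC, hC'⟩ := hT.image_closedBall_subset_compact 1
  obtain ⟨y, -, ψ, hψ, hψy⟩ := hC.tendsto_subseq (x := fun n => T (v n))
    (fun n => hC' ⟨v n, by simp [hv1], rfl⟩)
  obtain ⟨N, hN⟩ := Metric.cauchySeq_iff'.1 hψy.cauchySeq c hc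
  have := hN (N + 1) (Nat.le_succ N)
  rw [dist_eq_norm] at this
  exact absurd (hfar _ _ (hψ.injective.ne (Nat.succ_ne_self N))) (not_le.2 this)

/-- For `μ ≠ 0`, `A v - μ v = μ (μ⁻¹ - K) (A v)` on the domain, so the Fredholm alternative for `K`
at `μ⁻¹` decides. Off the eigenvalues the resolvent is `μ⁻¹ K (μ⁻¹ - K)⁻¹`. Writing the eigenvalue
equation as `μ • K v = v` avoids the inverse and excludes `μ = 0` automatically. -/
theorem operatorSpectrum_eq [CompleteSpace H] {A : H →ₗ.[𝕜] H} {K : H →L[𝕜] H}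
    (hAK : IsResolvent A 0 K) (hK : IsCompactOperator K) :
    operatorSpectrum A = {μ | ∃ v, v ≠ 0 ∧ μ • K v = v} := by
  have hK1 : ∀ v : A.domain, K (A v) = v := fun v => by simpa using hAK.1 v
  have hK2 : ∀ w : H, ∃ v : A.domain, (v : H) = K w ∧ A v = w := fun w => by simpa using hAK.2 w
  ext μ
  simp only [operatorSpectrum, Set.mem_ofPred_eq]
  constructor
  · intro h
    by_contra hno
    push Not at hno
    apply h
    rcases eq_or_ne μ 0 with rfl | hμ
    · exact ⟨K, hAK⟩
    have hnev : ¬ Module.End.HasEigenvalue (K : Module.End 𝕜 H) μ⁻¹ := by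
      intro h
      obtain ⟨e, he⟩ := h.exists_hasEigenvector
      refine hno e he.2 ?_
      have := he.apply_eq_smul
      simp only [ContinuousLinearMap.coe_coe] at this
      rw [this, smul_inv_smul₀ hμ]
    have hres := (hK.hasEigenvalue_or_mem_resolventSet (inv_ne_zero hμ)).resolve_left hnev
    rw [spectrum.mem_resolventSet_iff] at hres
    obtain ⟨B, hB⟩ := hres
    have hBe : ∀ w, (B : H →L[𝕜] H) w = μ⁻¹ • w - K w := by
      intro w
      rw [hB]
      simp [Algebra.algebraMap_eq_smul_one]
    have hl : ∀ w, (↑B⁻¹ : H →L[𝕜] H) ((B : H →L[𝕜] H) w) = w := fun w => by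
      rw [← mul_apply_eq_comp, Units.inv_mul, one_apply_eq_self]
    have hr : ∀ w, (B : H →L[𝕜] H) ((↑B⁻¹ : H →L[𝕜] H) w) = w := fun w => by
      rw [← mul_apply_eq_comp, Units.mul_inv, one_apply_eq_self]
    refine ⟨μ⁻¹ • K.comp (↑B⁻¹ : H →L[𝕜] H), fun v => ?_, fun w => ?_⟩
    · have e : A v - μ • (v : H) = μ • (B : H →L[𝕜] H) (A v) := by
        rw [hBe, hK1, smul_sub, smul_inv_smul₀ hμ]
      rw [e, smul_apply, ContinuousLinearMap.comp_apply, map_smul, hl,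
        map_smul, inv_smul_smul₀ hμ, hK1]
    · obtain ⟨v, hv, hv'⟩ := hK2 (μ⁻¹ • (↑B⁻¹ : H →L[𝕜] H) w)
      refine ⟨v, by rw [hv, map_smul]; rfl, ?_⟩
      have := hBe (μ • μ⁻¹ • (↑B⁻¹ : H →L[𝕜] H) w)
      rw [hv', hv]
      rw [smul_inv_smul₀ hμ, hr] at this
      rw [map_smul, smul_inv_smul₀ hμ, ← this]
  · rintro ⟨v, hv, hμv⟩ ⟨R, hR⟩
    obtain ⟨u, hu, hu'⟩ := hK2 v
    have h1 := hR.1 u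
    rw [hu', hu, hμv, sub_self, map_zero] at h1
    rw [← h1, smul_zero] at hμv
    exact hv hμv.symm

end Operators

/-! ### Orthonormal eigenvectors and strong limits -/

section Operators

variable {𝕜 H : Type*} [RCLike 𝕜] [NormedAddCommGroup H] [InnerProductSpace 𝕜 H]

/-- Eigenvectors of a symmetric operator can be chosen orthonormal, one for each eigenvalue. -/
theorem exists_orthonormal_eigenvectors {T : H →L[𝕜] H} (hsym : T.toLinearMap.IsSymmetric)
    {ι : Type*} {κ : ι → ℝ} (hκ : Function.Injective κ)
    (h : ∀ i, ∃ v, v ≠ 0 ∧ T v = (κ i : 𝕜) • v) :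
    ∃ f : ι → H, Orthonormal 𝕜 f ∧ ∀ i, T (f i) = (κ i : 𝕜) • f i := by
  have hu : ∀ i, ∃ v : H, ‖v‖ = 1 ∧ T v = (κ i : 𝕜) • v := by
    intro i
    obtain ⟨v, hv0, hv⟩ := h i
    refine ⟨((‖v‖⁻¹ : ℝ) : 𝕜) • v, ?_, by rw [map_smul, hv, smul_comm]⟩
    rw [norm_smul, RCLike.norm_ofReal, abs_of_nonneg (inv_nonneg.2 (norm_nonneg v)),
      inv_mul_cancel₀ (norm_ne_zero_iff.2 hv0)]
  choose f hf1 hf using hu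
  refine ⟨f, ⟨hf1, fun i j hij => ?_⟩, hf⟩
  have := hsym (f i) (f j)
  simp only [ContinuousLinearMap.coe_coe] at this
  rw [hf, hf, inner_smul_left, inner_smul_right, RCLike.conj_ofReal, ← sub_eq_zero,
    ← sub_mul, mul_eq_zero] at this
  refine this.resolve_left fun h => hij (hκ ?_)
  exact_mod_cast sub_eq_zero.1 h

/-- If the operators `S b` converge strongly to `T`, their quadratic forms eventually exceed `c` on
a finite-dimensional space spanned by eigenvectors of `T` with eigenvalues above `c`. -/
theorem eventually_form_ge {T : H →L[𝕜] H} {ι : Type*} [Fintype ι] {f : ι → H}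
    (hf : Orthonormal 𝕜 f) {κ : ι → ℝ} (hT : ∀ i, T (f i) = (κ i : 𝕜) • f i) {c d : ℝ}
    (hcd : c < d) (hd : ∀ i, d ≤ κ i) {β : Type*} {l : Filter β} {S : β → H →L[𝕜] H}
    (hS : ∀ x, Tendsto (fun b => S b x) l (𝓝 (T x))) :
    ∀ᶠ b in l, ∀ x ∈ Submodule.span 𝕜 (Set.range f),
      c * ‖x‖ ^ 2 ≤ RCLike.re (inner 𝕜 (S b x) x) := by
  have hlim : Tendsto (fun b => ∑ i, ‖S b (f i) - T (f i)‖) l (𝓝 0) := by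
    have := tendsto_finsetSum (Finset.univ : Finset ι)
      (fun i _ => tendsto_iff_norm_sub_tendsto_zero.1 (hS (f i)))
    simpa using this
  filter_upwards [hlim.eventually_lt_const (sub_pos.2 hcd)] with b hb x hx
  obtain ⟨a, rfl⟩ := (Submodule.mem_span_range_iff_exists_fun 𝕜).1 hx
  set x := ∑ i, a i • f i with hxdef
  have hai : ∀ i, ‖a i‖ ≤ ‖x‖ := by
    intro i
    have e : inner 𝕜 (f i) x = a i := by
      rw [hxdef, hf.inner_right_fintype]
    rw [← e]
    simpa [hf.1 i] using norm_inner_le_norm (𝕜 := 𝕜) (f i) x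
  have hnorm : ‖x‖ ^ 2 = ∑ i, ‖a i‖ ^ 2 := by
    rw [← inner_self_eq_norm_sq (𝕜 := 𝕜), hxdef, hf.inner_sum, map_sum]
    refine Finset.sum_congr rfl fun i _ => ?_
    rw [RCLike.conj_mul, ← RCLike.ofReal_pow, RCLike.ofReal_re]
  have hTx : T x = ∑ i, ((κ i : 𝕜) * a i) • f i := by
    rw [hxdef, map_sum]
    refine Finset.sum_congr rfl fun i _ => ?_
    rw [map_smul, hT, smul_smul, mul_comm]
  have hform : d * ‖x‖ ^ 2 ≤ RCLike.re (inner 𝕜 (T x) x) := by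
    rw [hTx, hnorm, hxdef, hf.inner_sum, map_sum, Finset.mul_sum]
    refine Finset.sum_le_sum fun i _ => ?_
    rw [map_mul (starRingEnd 𝕜), RCLike.conj_ofReal, mul_assoc, RCLike.conj_mul, ← RCLike.ofReal_pow,
      ← RCLike.ofReal_mul, RCLike.ofReal_re]
    exact mul_le_mul_of_nonneg_right (hd i) (sq_nonneg _)
  -- Strong convergence is uniform on a finite-dimensional space: the coefficients of `x` are at
  -- most `‖x‖`, so the error is controlled on the basis vectors. The gap `d - c` absorbs it.
  have hdiff : ‖S b x - T x‖ ≤ (d - c) * ‖x‖ := by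
    have e : S b x - T x = ∑ i, a i • (S b (f i) - T (f i)) := by
      rw [hxdef, map_sum, map_sum, ← Finset.sum_sub_distrib]
      simp only [map_smul, smul_sub]
    rw [e]
    refine (norm_sum_le _ _).trans ?_
    calc ∑ i, ‖a i • (S b (f i) - T (f i))‖ ≤ ∑ i, ‖x‖ * ‖S b (f i) - T (f i)‖ :=
          Finset.sum_le_sum fun i _ => by
            rw [norm_smul]
            exact mul_le_mul_of_nonneg_right (hai i) (norm_nonneg _)
      _ = (∑ i, ‖S b (f i) - T (f i)‖) * ‖x‖ := by rw [← Finset.mul_sum, mul_comm]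
      _ ≤ _ := mul_le_mul_of_nonneg_right hb.le (norm_nonneg _)
  have h1 : -RCLike.re (inner 𝕜 (S b x - T x) x) ≤ (d - c) * ‖x‖ ^ 2 := by
    refine (neg_le_abs _).trans ((RCLike.abs_re_le_norm _).trans ((norm_inner_le_norm _ _).trans ?_))
    have := mul_le_mul_of_nonneg_right hdiff (norm_nonneg x)
    linarith
  rw [inner_sub_left, map_sub] at h1
  linarith

end Operators

/-! ### The moving boundary point -/

theorem zero_mem_timeInterval {T : EReal} (hT : 0 < T) : (0 : ℝ) ∈ timeInterval T :=
  ⟨le_rfl, by simpa using hT⟩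

theorem mem_timeInterval_of_le {T : EReal} {b t : ℝ} (hb : b ∈ timeInterval T)
    (ht : t ∈ Set.Icc 0 b) : t ∈ timeInterval T :=
  ⟨ht.1, lt_of_le_of_lt (EReal.coe_le_coe_iff.2 ht.2) hb.2⟩

theorem Icc_subset_timeInterval {T : EReal} {b : ℝ} (hb : b ∈ timeInterval T) :
    Set.Icc 0 b ⊆ timeInterval T := fun _ ht => mem_timeInterval_of_le hb ht

theorem restrict_Icc_le_timeMeasure {T : EReal} {b : ℝ} (hb : b ∈ timeInterval T) :
    volume.restrict (Set.Icc 0 b) ≤ timeMeasure T :=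
  Measure.restrict_mono_set _ (Icc_subset_timeInterval hb)

theorem exists_gt_mem_timeInterval {T : EReal} {t : ℝ} (ht : t ∈ timeInterval T) :
    ∃ b ∈ timeInterval T, t < b := by
  obtain ⟨q, h1, h2⟩ := EReal.lt_iff_exists_rat_btwn.1 ht.2
  have h1' : t < (q : ℝ) := by exact_mod_cast h1
  exact ⟨q, ⟨ht.1.trans h1'.le, by exact_mod_cast h2⟩, h1'⟩

theorem LipField.const_mul {Q : ℝ → ℝ → ℝ} {b C : ℝ} (hQ : LipField Q b C) (l : ℝ) :
    LipField (fun s x => l * Q s x) b ((|l| + 1) * C) := by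
  have h1 : |l| * C ≤ (|l| + 1) * C := by nlinarith [hQ.pos]
  refine ⟨mul_pos (by positivity) hQ.pos, fun φ hφ => (hQ.meas φ hφ).const_mul l,
    fun s hs x => ?_, fun s hs x y => ?_⟩
  · rw [abs_mul]
    exact (mul_le_mul_of_nonneg_left (hQ.bound s hs x) (abs_nonneg l)).trans h1
  · rw [← mul_sub, abs_mul]
    calc |l| * |Q s x - Q s y| ≤ |l| * (C * |x - y|) :=
          mul_le_mul_of_nonneg_left (hQ.lip s hs x y) (abs_nonneg l)
      _ = |l| * C * |x - y| := by ring
      _ ≤ _ := mul_le_mul_of_nonneg_right h1 (abs_nonneg _)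

theorem cayleyBoundary_boundaryPoint {u : Fin 2 → ℝ} (hu : u ≠ 0) :
    cayleyBoundary (boundaryPoint u) =
      ((u 0 : ℂ) - u 1 * Complex.I) / ((u 0 : ℂ) + u 1 * Complex.I) := by
  unfold cayleyBoundary boundaryPoint
  split_ifs with h
  · have h0 : u 0 ≠ 0 := by
      intro h0
      exact hu (by ext i; fin_cases i <;> simp [h, h0])
    have : (u 0 : ℂ) ≠ 0 := by exact_mod_cast h0
    rw [h]
    change (1 : ℂ) = _
    simp [this]
  · change cayley ((u 0 / u 1 : ℝ) : ℂ) = _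
    have h1 : (u 1 : ℂ) ≠ 0 := by exact_mod_cast h
    unfold cayley
    push_cast
    rw [← mul_div_mul_right _ _ h1]
    congr 1 <;> field_simp

theorem add_mul_I_ne_zero {a b : ℝ} (h : a ≠ 0 ∨ b ≠ 0) : (a : ℂ) + b * Complex.I ≠ 0 := by
  intro h0
  have h1 := congrArg Complex.re h0
  have h2 := congrArg Complex.im h0
  simp at h1 h2
  simp [h1, h2] at h

theorem ne_zero_or_ne_zero {u : Fin 2 → ℝ} (hu : u ≠ 0) : u 0 ≠ 0 ∨ u 1 ≠ 0 := by
  by_contra! h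
  exact hu (by ext i; fin_cases i <;> simp [h])

/-- After clearing denominators, the two sides differ by `2i (u 0 * w 1 - u 1 * w 0)`: boundary
points coincide exactly for parallel vectors. -/
theorem cayleyBoundary_eq_iff {u w : Fin 2 → ℝ} (hu : u ≠ 0) (hw : w ≠ 0) :
    cayleyBoundary (boundaryPoint u) = cayleyBoundary (boundaryPoint w) ↔
      u 0 * w 1 = u 1 * w 0 := by
  rw [cayleyBoundary_boundaryPoint hu, cayleyBoundary_boundaryPoint hw,
    div_eq_div_iff (add_mul_I_ne_zero (ne_zero_or_ne_zero hu))
      (add_mul_I_ne_zero (ne_zero_or_ne_zero hw))]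
  constructor
  · intro h
    have h1 := congrArg Complex.im h
    simp at h1
    linarith
  · intro h
    have h' : (u 0 : ℂ) * w 1 = u 1 * w 0 := by exact_mod_cast h
    linear_combination (2 * Complex.I) * h'

theorem norm_cayleyBoundary_boundaryPoint {u : Fin 2 → ℝ} (hu : u ≠ 0) :
    ‖cayleyBoundary (boundaryPoint u)‖ = 1 := by
  rw [cayleyBoundary_boundaryPoint hu, norm_div]
  have e : ‖(u 0 : ℂ) - u 1 * Complex.I‖ = ‖(u 0 : ℂ) + u 1 * Complex.I‖ := by
    rw [← Complex.norm_conj]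
    simp
  rw [e, div_self (norm_ne_zero_iff.2 (add_mul_I_ne_zero (ne_zero_or_ne_zero hu)))]

theorem exp_arg_cayleyBoundary {u : Fin 2 → ℝ} (hu : u ≠ 0) :
    Complex.exp (Complex.arg (cayleyBoundary (boundaryPoint u)) * Complex.I) =
      cayleyBoundary (boundaryPoint u) := by
  have := Complex.norm_mul_exp_arg_mul_I (cayleyBoundary (boundaryPoint u))
  rwa [norm_cayleyBoundary_boundaryPoint hu, Complex.ofReal_one, one_mul] at this

theorem boundaryPoint_ne {u w : Fin 2 → ℝ} (hu : u ≠ 0) (hw : w ≠ 0)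
    (h : u 0 * w 1 ≠ u 1 * w 0) : boundaryPoint u ≠ boundaryPoint w := fun e =>
  h ((cayleyBoundary_eq_iff hu hw).1 (by rw [e]))

/-- The boundary point in the direction `(-cos (φ / 2), sin (φ / 2))` has angle `φ`. -/
theorem cayleyBoundary_direction {r φ : ℝ} (hr : r ≠ 0) :
    cayleyBoundary (boundaryPoint ![-(r * Real.cos (φ / 2)), r * Real.sin (φ / 2)]) =
      Complex.exp (φ * Complex.I) := by
  have hcs : Real.cos (φ / 2) ≠ 0 ∨ Real.sin (φ / 2) ≠ 0 := by
    by_contra! h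
    have := Real.sin_sq_add_cos_sq (φ / 2)
    rw [h.1, h.2] at this
    norm_num at this
  have hu : ![-(r * Real.cos (φ / 2)), r * Real.sin (φ / 2)] ≠ (0 : Fin 2 → ℝ) := by
    intro h
    have h0 := congrFun h 0
    have h1 := congrFun h 1
    simp [hr] at h0 h1
    simp [h0, h1] at hcs
  have e : (φ : ℂ) * Complex.I = (φ / 2 : ℝ) * Complex.I + (φ / 2 : ℝ) * Complex.I := by
    push_cast; ring
  have hp := Complex.cos_sq_add_sin_sq ((φ / 2 : ℝ) : ℂ)
  rw [cayleyBoundary_boundaryPoint hu, div_eq_iff (add_mul_I_ne_zero (ne_zero_or_ne_zero hu)), e,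
    Complex.exp_add, Complex.exp_mul_I]
  simp only [Matrix.cons_val_zero, Matrix.cons_val_one]
  push_cast at hp ⊢
  have hI := Complex.I_sq
  set c := Complex.cos (φ / 2)
  set s := Complex.sin (φ / 2)
  linear_combination (r * (c + s * Complex.I)) * hp - (r * (c + s * Complex.I) * s ^ 2) * hI

namespace DiracData

variable (D : DiracData)

/-- The angular velocity, for `lam = 1`, of a boundary point at angle `φ`. -/
noncomputable def rate (s φ : ℝ) : ℝ :=
  2 * (D.f s / (D.z s).im * ((Real.cos (φ / 2) + (D.z s).re * Real.sin (φ / 2)) ^ 2 +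
    (D.z s).im ^ 2 * Real.sin (φ / 2) ^ 2))

theorem R_zero_zero (t : ℝ) : D.R t 0 0 = D.f t / (D.z t).im := by simp [R]

theorem R_zero_one (t : ℝ) : D.R t 0 1 = -(D.f t / (D.z t).im * (D.z t).re) := by simp [R]

theorem R_one_zero (t : ℝ) : D.R t 1 0 = -(D.f t / (D.z t).im * (D.z t).re) := by simp [R]

theorem R_one_one (t : ℝ) :
    D.R t 1 1 = D.f t / (D.z t).im * ((D.z t).re ^ 2 + (D.z t).im ^ 2) := by simp [R]

/-- This is `2 pᵗ R p` for the unit direction `p = (-cos (φ/2), sin (φ/2))`, the form in which the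
linear equation produces it. -/
theorem rate_eq_half (s φ : ℝ) : D.rate s φ = 2 * (D.R s 0 0 * Real.cos (φ / 2) ^ 2 -
    2 * D.R s 0 1 * (Real.cos (φ / 2) * Real.sin (φ / 2)) +
    D.R s 1 1 * Real.sin (φ / 2) ^ 2) := by
  rw [R_zero_zero, R_zero_one, R_one_one, rate]
  ring

/-- In the full angle the field is affine in `cos φ` and `sin φ` with entries of `R` as
coefficients, so condition (B) directly gives measurability, boundedness and the Lipschitz bound. -/
theorem rate_eq (s φ : ℝ) : D.rate s φ = D.R s 0 0 * (1 + Real.cos φ) -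
    2 * D.R s 0 1 * Real.sin φ + D.R s 1 1 * (1 - Real.cos φ) := by
  have h1 : Real.cos φ = 2 * Real.cos (φ / 2) ^ 2 - 1 := by
    rw [← Real.cos_two_mul]; ring_nf
  have h2 : Real.sin φ = 2 * Real.sin (φ / 2) * Real.cos (φ / 2) := by
    rw [← Real.sin_two_mul]; ring_nf
  have h3 := Real.sin_sq_add_cos_sq (φ / 2)
  rw [rate_eq_half, h1, h2]
  linear_combination (2 * D.R s 1 1) * h3

theorem rate_pos {s : ℝ} (hs : s ∈ timeInterval D.T) (φ : ℝ) : 0 < D.rate s φ := by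
  have hq : 0 < D.f s / (D.z s).im := div_pos (D.f_pos s hs) (D.z s).im_pos
  have hy := (D.z s).im_pos
  refine mul_pos two_pos (mul_pos hq ?_)
  rcases eq_or_ne (Real.sin (φ / 2)) 0 with h | h
  · have := Real.sin_sq_add_cos_sq (φ / 2)
    rw [h] at this ⊢
    nlinarith
  · have h1 : 0 < Real.sin (φ / 2) ^ 2 := by positivity
    positivity

/-- With `U` the Cayley transform, `e^{iφ} - U(z) = 2i e^{iφ/2} (z sin (φ/2) + cos (φ/2)) / (z + i)`
and `1 - |U(z)|² = 4 Im z / |z + i|²`; the factors `|z + i|²` cancel. -/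
theorem cayley_rate (z : UpperHalfPlane) (φ : ℝ) :
    ‖Complex.exp (φ * Complex.I) - cayley z‖ ^ 2 / (1 - ‖cayley z‖ ^ 2) =
      ((Real.cos (φ / 2) + z.re * Real.sin (φ / 2)) ^ 2 + z.im ^ 2 * Real.sin (φ / 2) ^ 2) /
        z.im := by
  have hy := z.im_pos
  have hne : (z : ℂ) + Complex.I ≠ 0 := by
    intro h
    have := congrArg Complex.im h
    simp at this
    have : z.im + 1 = 0 := this
    linarith
  set n : ℝ := ‖(z : ℂ) + Complex.I‖ ^ 2 with hn
  have hn0 : 0 < n := by positivity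
  have hnv : n = z.re ^ 2 + (z.im + 1) ^ 2 := by
    rw [hn, ← Complex.normSq_eq_norm_sq, Complex.normSq_apply]
    simp [← sq]
  have h1 : ‖cayley z‖ ^ 2 = (z.re ^ 2 + (z.im - 1) ^ 2) / n := by
    rw [cayley, norm_div, div_pow, ← hn, ← Complex.normSq_eq_norm_sq, Complex.normSq_apply]
    simp [← sq]
  have h2 : ‖Complex.exp (φ * Complex.I) - cayley z‖ ^ 2 =
      4 * ((Real.cos (φ / 2) + z.re * Real.sin (φ / 2)) ^ 2 +
        z.im ^ 2 * Real.sin (φ / 2) ^ 2) / n := by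
    have e : Complex.exp (φ * Complex.I) - cayley z = Complex.exp ((φ / 2 : ℝ) * Complex.I) *
        (2 * Complex.I * (Complex.sin (φ / 2 : ℝ) * z + Complex.cos (φ / 2 : ℝ))) /
          ((z : ℂ) + Complex.I) := by
      have e1 : (φ : ℂ) * Complex.I = (φ / 2 : ℝ) * Complex.I + (φ / 2 : ℝ) * Complex.I := by
        push_cast; ring
      rw [cayley, eq_div_iff hne, sub_mul, div_mul_cancel₀ _ hne, e1, Complex.exp_add,
        Complex.exp_mul_I]
      have hI := Complex.I_sq
      have hp := Complex.cos_sq_add_sin_sq ((φ / 2 : ℝ) : ℂ)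
      set c := Complex.cos (φ / 2 : ℝ)
      set s := Complex.sin (φ / 2 : ℝ)
      linear_combination ((z : ℂ) - Complex.I) * hp +
        (s ^ 2 * Complex.I - z * s ^ 2) * hI
    rw [e, norm_div, div_pow, ← hn, norm_mul, Complex.norm_exp_ofReal_mul_I, one_mul, norm_mul,
      mul_pow]
    congr 2
    · simp; norm_num
    · rw [← Complex.ofReal_sin, ← Complex.ofReal_cos, ← Complex.normSq_eq_norm_sq,
        Complex.normSq_apply]
      generalize Real.cos (φ / 2) = c
      generalize Real.sin (φ / 2) = s
      simp
      ring
  rw [h1, h2]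
  have h3 : 1 - (z.re ^ 2 + (z.im - 1) ^ 2) / n = 4 * z.im / n := by
    rw [eq_div_iff hn0.ne', sub_mul, div_mul_cancel₀ _ hn0.ne', hnv]
    ring
  rw [h3]
  field_simp

theorem angularVelocity_eq (lam : ℝ) (φ : ℝ → ℝ) (s : ℝ) :
    angularVelocity D.z D.f lam φ s = lam * D.rate s (φ s) := by
  rw [angularVelocity, cayley_rate, rate]
  ring

variable {D}

theorem lipField_rate (hB : D.CondB) {b : ℝ} (hb : b ∈ timeInterval D.T) :
    ∃ C, LipField D.rate b C := by
  obtain ⟨C, hC⟩ := hB.2 b hb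
  have hC0 : 0 ≤ C := (abs_nonneg _).trans (hC 0 ⟨le_rfl, hb.1⟩ 0 0).1
  refine ⟨6 * C + 1, by positivity, fun φ hφ => ?_, fun s hs x => ?_, fun s hs x y => ?_⟩
  · have hR : ∀ i j, AEMeasurable (fun t => D.R t i j) (volume.restrict (Set.Icc 0 b)) :=
      fun i j => (hB.1 i j).mono_measure (restrict_Icc_le_timeMeasure hb)
    have e : (fun s => D.rate s (φ s)) = fun s => D.R s 0 0 * (1 + Real.cos (φ s)) -
        2 * D.R s 0 1 * Real.sin (φ s) + D.R s 1 1 * (1 - Real.cos (φ s)) :=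
      funext fun s => D.rate_eq s (φ s)
    rw [e]
    have hc := Real.measurable_cos.comp_aemeasurable hφ
    have hs := Real.measurable_sin.comp_aemeasurable hφ
    exact (((hR 0 0).mul (hc.const_add 1)).sub (((hR 0 1).const_mul 2).mul hs)).add
      ((hR 1 1).mul (hc.const_sub 1))
  · have h0 := abs_le.1 (hC s hs 0 0).1
    have h1 := abs_le.1 (hC s hs 0 1).1
    have h2 := abs_le.1 (hC s hs 1 1).1
    have hc := abs_le.1 (Real.abs_cos_le_one x)
    have hs' := abs_le.1 (Real.abs_sin_le_one x)
    rw [rate_eq, abs_le]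
    constructor <;> nlinarith
  · have h0 := (hC s hs 0 0).1
    have h1 := (hC s hs 0 1).1
    have h2 := (hC s hs 1 1).1
    have hc : |Real.cos x - Real.cos y| ≤ |x - y| := Real.abs_cos_sub_cos_le x y
    have hs' : |Real.sin x - Real.sin y| ≤ |x - y| := Real.abs_sin_sub_sin_le x y
    have e : D.rate s x - D.rate s y = D.R s 0 0 * (Real.cos x - Real.cos y) +
        (-2 * D.R s 0 1 * (Real.sin x - Real.sin y) +
          -D.R s 1 1 * (Real.cos x - Real.cos y)) := by
      rw [rate_eq, rate_eq]; ring
    rw [e]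
    refine (abs_add_le _ _).trans ((add_le_add_right (abs_add_le _ _) _).trans ?_)
    simp only [abs_mul, abs_neg, abs_two]
    have a0 := mul_le_mul h0 hc (abs_nonneg _) hC0
    have a1 := mul_le_mul h1 hs' (abs_nonneg _) hC0
    have a2 := mul_le_mul h2 hc (abs_nonneg _) hC0
    nlinarith [abs_nonneg (x - y), mul_nonneg hC0 (abs_nonneg (x - y))]

theorem isCarouselAngle_iff {η₀ : OnePoint ℝ} {lam : ℝ} {φ : ℝ → ℝ} :
    IsCarouselAngle D.T D.z η₀ D.f lam φ ↔ φ 0 = Complex.arg (cayleyBoundary η₀) ∧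
      ∀ b ∈ timeInterval D.T, ACDeriv φ (fun s => lam * D.rate s (φ s)) b := by
  have e : angularVelocity D.z D.f lam φ = fun s => lam * D.rate s (φ s) :=
    funext (D.angularVelocity_eq lam φ)
  constructor
  · intro h
    refine ⟨h.initial, fun b hb => ⟨hb.1, ?_, fun t ht => ?_⟩⟩
    · have := h.integrable b hb
      rwa [e] at this
    · have := h.evolution t (mem_timeInterval_of_le hb ht)
      rwa [e] at this
  · rintro ⟨h0, h⟩
    refine ⟨h0, fun t ht => ?_, fun t ht => ?_, fun t ht => ?_⟩
    -- A later time `b` is needed to make `[0, b]` a neighbourhood of `t` within `[0, T)`.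
    · obtain ⟨b, hb, htb⟩ := exists_gt_mem_timeInterval ht
      refine ((h b hb).continuousOn t ⟨ht.1, htb.le⟩).mono_of_mem_nhdsWithin ?_
      rw [mem_nhdsWithin]
      exact ⟨Set.Iio b, isOpen_Iio, htb, fun x hx => ⟨hx.2.1, le_of_lt hx.1⟩⟩
    · rw [e]
      exact (h t ht).int
    · rw [e]
      exact (h t ht).eq t ⟨ht.1, le_rfl⟩

theorem exists_carouselAngle (hB : D.CondB) (η₀ : OnePoint ℝ) (lam : ℝ) :
    ∃ φ, IsCarouselAngle D.T D.z η₀ D.f lam φ := by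
  obtain ⟨φ, h0, h⟩ := LipField.exists_solution (Q := fun s x => lam * D.rate s x)
    (I := timeInterval D.T) (fun b hb => ⟨hb.1, fun c hc => mem_timeInterval_of_le hb hc⟩)
    (fun b hb => (lipField_rate hB hb).imp' _ fun C hC => hC.const_mul lam)
    (Complex.arg (cayleyBoundary η₀))
  exact ⟨φ, isCarouselAngle_iff.2 ⟨h0, h⟩⟩

theorem carouselAngle_unique (hB : D.CondB) {η₀ : OnePoint ℝ} {lam : ℝ} {φ ψ : ℝ → ℝ}
    (hφ : IsCarouselAngle D.T D.z η₀ D.f lam φ) (hψ : IsCarouselAngle D.T D.z η₀ D.f lam ψ) :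
    Set.EqOn ψ φ (timeInterval D.T) := by
  intro t ht
  obtain ⟨C, hC⟩ := lipField_rate hB ht
  rw [isCarouselAngle_iff] at hφ hψ
  exact (hC.const_mul lam).unique (hψ.2 t ht) (hφ.2 t ht) (hψ.1.trans hφ.1.symm) t
    ⟨ht.1, le_rfl⟩

theorem carouselAngle_lt (hB : D.CondB) {η₀ : OnePoint ℝ} {l m : ℝ} (hlm : l < m) {φ ψ : ℝ → ℝ}
    (hφ : IsCarouselAngle D.T D.z η₀ D.f l φ) (hψ : IsCarouselAngle D.T D.z η₀ D.f m ψ)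
    {b : ℝ} (hb : b ∈ timeInterval D.T) (hb0 : 0 < b) : φ b < ψ b := by
  obtain ⟨C, hC⟩ := lipField_rate hB hb
  rw [isCarouselAngle_iff] at hφ hψ
  exact hC.lt_of_lt hb0 (fun s hs x => D.rate_pos (mem_timeInterval_of_le hb hs) x) hlm
    (hφ.2 b hb) (hψ.2 b hb) (hφ.1.trans hψ.1.symm)

end DiracData

namespace DiracData

variable (D : DiracData)

/-! ### Bounds on the path -/

theorem det_R (t : ℝ) : (D.R t).det = D.f t ^ 2 := by
  have hy := (D.z t).im_pos.ne'
  rw [Matrix.det_fin_two, R_zero_zero, R_zero_one, R_one_zero, R_one_one]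
  field_simp
  ring

theorem isUnit_det_R {t : ℝ} (ht : t ∈ timeInterval D.T) : IsUnit (D.R t).det := by
  rw [det_R, isUnit_iff_ne_zero]
  exact pow_ne_zero 2 (D.f_pos t ht).ne'

theorem inv_R_zero_zero {t : ℝ} (ht : t ∈ timeInterval D.T) :
    (D.R t)⁻¹ 0 0 = ((D.z t).re ^ 2 + (D.z t).im ^ 2) / (D.f t * (D.z t).im) := by
  have hy := (D.z t).im_pos.ne'
  have hf := (D.f_pos t ht).ne'
  rw [Matrix.inv_def, Ring.inverse_eq_inv', det_R, Matrix.adjugate_fin_two]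
  simp only [Matrix.smul_apply, Matrix.of_apply, Matrix.cons_val', Matrix.cons_val_zero,
    smul_eq_mul, R_one_one]
  field_simp

theorem inv_R_one_one {t : ℝ} (ht : t ∈ timeInterval D.T) :
    (D.R t)⁻¹ 1 1 = 1 / (D.f t * (D.z t).im) := by
  have hy := (D.z t).im_pos.ne'
  have hf := (D.f_pos t ht).ne'
  rw [Matrix.inv_def, Ring.inverse_eq_inv', det_R, Matrix.adjugate_fin_two]
  simp only [Matrix.smul_apply, Matrix.of_apply, Matrix.cons_val', Matrix.cons_val_one,
    smul_eq_mul, R_zero_zero, Matrix.cons_val_fin_one]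
  field_simp

variable {D}

/-- Only the diagonal entries of `R` and `R⁻¹` are used. From `f ≤ C y` and `1 ≤ C f y` follows `1 ≤
C y`; multiplying `f (x² + y²) ≤ C y` by `x² + y² ≤ C f y` gives `x² + y² ≤ C y`. These bound `y` on
both sides, then `x` and `f`. -/
theorem exists_path_bound (hB : D.CondB) {b : ℝ} (hb : b ∈ timeInterval D.T) :
    ∃ C : ℝ, 0 < C ∧ ∀ t ∈ Set.Icc 0 b, |(D.z t).re| ≤ C ∧ C⁻¹ ≤ (D.z t).im ∧
      (D.z t).im ≤ C ∧ D.f t ≤ C ^ 2 := by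
  obtain ⟨C, hC⟩ := hB.2 b hb
  have key : ∀ t ∈ Set.Icc 0 b, 0 < C ∧ |(D.z t).re| ≤ C ∧ C⁻¹ ≤ (D.z t).im ∧
      (D.z t).im ≤ C ∧ D.f t ≤ C ^ 2 := by
    intro t ht
    have htT := mem_timeInterval_of_le hb ht
    have hy := (D.z t).im_pos
    have hf := D.f_pos t htT
    have h1 := (abs_le.1 (hC t ht 0 0).1).2
    have h2 := (abs_le.1 (hC t ht 1 1).1).2
    have h3 := (abs_le.1 (hC t ht 0 0).2).2
    have h4 := (abs_le.1 (hC t ht 1 1).2).2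
    rw [R_zero_zero, div_le_iff₀ hy] at h1
    rw [R_one_one, div_mul_eq_mul_div, div_le_iff₀ hy] at h2
    rw [D.inv_R_zero_zero htT, div_le_iff₀ (by positivity)] at h3
    rw [D.inv_R_one_one htT, div_le_iff₀ (by positivity)] at h4
    set x := (D.z t).re
    set y := (D.z t).im
    set f := D.f t
    have hC0 : 0 < C := by
      by_contra! h
      nlinarith [mul_pos hf hy]
    have h5 : 1 ≤ C * y := by
      have : 1 ≤ (C * y) ^ 2 := by nlinarith [mul_pos hC0 hy]
      nlinarith [mul_pos hC0 hy]
    have h6 : x ^ 2 + y ^ 2 ≤ C * y := by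
      have hs : 0 ≤ x ^ 2 + y ^ 2 := by positivity
      have : (x ^ 2 + y ^ 2) ^ 2 ≤ (C * y) ^ 2 := by
        have a1 : (x ^ 2 + y ^ 2) * (f * (x ^ 2 + y ^ 2)) ≤ C * (f * y) * (C * y) :=
          mul_le_mul h3 h2 (by positivity) (by positivity)
        have a2 : f * (x ^ 2 + y ^ 2) ^ 2 ≤ f * (C * y) ^ 2 := by nlinarith
        exact le_of_mul_le_mul_left a2 hf
      exact (pow_le_pow_iff_left₀ hs (by positivity) two_ne_zero).1 this
    have h7 : y ≤ C := by
      have : y * y ≤ C * y := by nlinarith [sq_nonneg x]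
      exact le_of_mul_le_mul_right this hy
    refine ⟨hC0, abs_le_of_sq_le_sq (by nlinarith [sq_nonneg y]) hC0.le, ?_, h7, by nlinarith⟩
    rwa [inv_le_iff_one_le_mul₀' hC0]
  exact ⟨C, (key 0 ⟨le_rfl, hb.1⟩).1, fun t ht => (key t ht).2⟩

theorem isBounded_path (hB : D.CondB) {b : ℝ} (hb : b ∈ timeInterval D.T) :
    Bornology.IsBounded (D.z '' Set.Icc 0 b) := by
  obtain ⟨C, hC0, hC⟩ := exists_path_bound hB hb
  -- The metric on the half plane is the hyperbolic one. The rectangle is compact and stays away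
  -- from the real axis, so it is compact, hence bounded, there too.
  set k : Set ℂ := Set.Icc (-C) C ×ℂ Set.Icc C⁻¹ C with hk
  have hkc : IsCompact k := isCompact_Icc.reProdIm isCompact_Icc
  have hpre : IsCompact (((↑) : UpperHalfPlane → ℂ) ⁻¹' k) := by
    rw [UpperHalfPlane.isEmbedding_coe.isInducing.isCompact_iff, Set.image_preimage_eq_of_subset]
    · exact hkc
    · intro w hw
      exact ⟨⟨w, (inv_pos.2 hC0).trans_le hw.2.1⟩, rfl⟩
  refine hpre.isBounded.subset ?_
  rintro _ ⟨t, ht, rfl⟩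
  obtain ⟨h1, h2, h3, -⟩ := hC t ht
  exact ⟨⟨(abs_le.1 h1).1, (abs_le.1 h1).2⟩, h2, h3⟩

theorem integrableOn_f (hB : D.CondB) {b : ℝ} (hb : b ∈ timeInterval D.T) :
    IntegrableOn D.f (Set.Icc 0 b) := by
  obtain ⟨C, hC0, hC⟩ := exists_path_bound hB hb
  refine Integrable.of_bound
    (D.f_meas.mono_measure (restrict_Icc_le_timeMeasure hb)).aestronglyMeasurable (C ^ 2) ?_
  filter_upwards [ae_restrict_mem measurableSet_Icc] with t ht
  rw [Real.norm_of_nonneg (D.f_pos t (mem_timeInterval_of_le hb ht)).le]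
  exact (hC t ht).2.2.2

/-! ### The differential expression -/

section Vector

variable {𝕜 : Type*} [RCLike 𝕜]

variable (D) in
/-- `R w`. -/
noncomputable def weight (t : ℝ) (w : Fin 2 → 𝕜) : Fin 2 → 𝕜 :=
  ((D.R t).map (algebraMap ℝ 𝕜)).mulVec w

variable (D) in
/-- The vector `-J R w`; the equation `τ v = w` means that `v' = -J R w`. -/
noncomputable def velocity (t : ℝ) (w : Fin 2 → 𝕜) : Fin 2 → 𝕜 :=
  ![D.weight t w 1, -D.weight t w 0]

theorem weight_apply (t : ℝ) (w : Fin 2 → 𝕜) (i : Fin 2) :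
    D.weight t w i = (D.R t i 0 : 𝕜) * w 0 + (D.R t i 1 : 𝕜) * w 1 := by
  simp [weight, Matrix.mulVec, dotProduct, Fin.sum_univ_two]

theorem velocity_smul (t : ℝ) (c : 𝕜) (w : Fin 2 → 𝕜) :
    D.velocity t (c • w) = c • D.velocity t w := by
  ext i
  fin_cases i <;> simp [velocity, weight_apply] <;> ring

theorem velocity_sub (t : ℝ) (v w : Fin 2 → 𝕜) :
    D.velocity t (v - w) = D.velocity t v - D.velocity t w := by
  ext i
  fin_cases i <;> simp [velocity, weight_apply] <;> ring

theorem velocity_zero (t : ℝ) : D.velocity t (0 : Fin 2 → 𝕜) = 0 := by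
  ext i
  fin_cases i <;> simp [velocity, weight_apply]

theorem J_mulVec (w : Fin 2 → 𝕜) : (J.map (algebraMap ℝ 𝕜)).mulVec w = ![-w 1, w 0] := by
  ext i
  fin_cases i <;> simp [J, Matrix.mulVec, dotProduct, Fin.sum_univ_two]

theorem J_velocity (t : ℝ) (w : Fin 2 → 𝕜) :
    (J.map (algebraMap ℝ 𝕜)).mulVec (D.velocity t w) = D.weight t w := by
  rw [J_mulVec]
  ext i
  fin_cases i <;> simp [velocity]

theorem map_inv_mul_map {t : ℝ} (ht : t ∈ timeInterval D.T) :
    ((D.R t)⁻¹.map (algebraMap ℝ 𝕜)) * ((D.R t).map (algebraMap ℝ 𝕜)) = 1 := by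
  rw [← Matrix.map_mul, Matrix.nonsing_inv_mul _ (D.isUnit_det_R ht)]
  simp

theorem map_mul_map_inv {t : ℝ} (ht : t ∈ timeInterval D.T) :
    ((D.R t).map (algebraMap ℝ 𝕜)) * ((D.R t)⁻¹.map (algebraMap ℝ 𝕜)) = 1 := by
  rw [← Matrix.map_mul, Matrix.mul_nonsing_inv _ (D.isUnit_det_R ht)]
  simp

theorem tau_eq_of_velocity {t : ℝ} (ht : t ∈ timeInterval D.T) {h : ℝ → Fin 2 → 𝕜}
    {w : Fin 2 → 𝕜} (hh : h t = D.velocity t w) : D.tau h t = w := by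
  rw [tau, hh, J_velocity, weight, Matrix.mulVec_mulVec, map_inv_mul_map ht, Matrix.one_mulVec]

theorem velocity_tau {t : ℝ} (ht : t ∈ timeInterval D.T) (h : ℝ → Fin 2 → 𝕜) :
    D.velocity t (D.tau h t) = h t := by
  have e : D.weight t (D.tau h t) = ![-h t 1, h t 0] := by
    rw [weight, tau, Matrix.mulVec_mulVec, map_mul_map_inv ht, Matrix.one_mulVec, J_mulVec]
  ext i
  fin_cases i <;> simp [velocity, e]

theorem norm_velocity_le {t C : ℝ} (hC : ∀ i j, |D.R t i j| ≤ C) (w : Fin 2 → 𝕜) :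
    ‖D.velocity t w‖ ≤ 2 * C * ‖w‖ := by
  have hC0 : 0 ≤ C := (abs_nonneg _).trans (hC 0 0)
  have hw : ∀ i, ‖D.weight t w i‖ ≤ 2 * C * ‖w‖ := by
    intro i
    rw [weight_apply]
    refine (norm_add_le _ _).trans ?_
    rw [norm_mul, norm_mul, RCLike.norm_ofReal, RCLike.norm_ofReal]
    have h0 := mul_le_mul (hC i 0) (norm_le_pi_norm w 0) (norm_nonneg _) hC0
    have h1 := mul_le_mul (hC i 1) (norm_le_pi_norm w 1) (norm_nonneg _) hC0
    linarith
  refine (pi_norm_le_iff_of_nonneg (by positivity)).2 fun i => ?_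
  fin_cases i
  · simpa [velocity] using hw 1
  · simpa [velocity] using hw 0

/-- Uniqueness for the linear equation `v' = -μ J R v`. -/
theorem eq_zero_of_velocity (hB : D.CondB) {b : ℝ} (hb : b ∈ timeInterval D.T) {μ : 𝕜}
    {g h : ℝ → Fin 2 → 𝕜} (H : ACDeriv g h b) (h0 : g 0 = 0)
    (hh : ∀ᵐ x : ℝ, x ∈ Set.Ioo 0 b → h x = D.velocity x (μ • g x)) :
    ∀ t ∈ Set.Icc 0 b, g t = 0 := by
  obtain ⟨C, hC⟩ := hB.2 b hb
  refine H.eq_zero_of_norm_deriv_le (C := 2 * C * ‖μ‖) h0 ?_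
  filter_upwards [hh] with x hx hxb
  rw [hx hxb]
  refine (norm_velocity_le (fun i j => (hC x ⟨hxb.1.le, hxb.2.le⟩ i j).1) _).trans ?_
  rw [norm_smul, mul_assoc (2 * C)]

end Vector

/-! ### The solution of the initial value problem -/

theorem _root_.ACDeriv.pi_two {𝕜 : Type*} [RCLike 𝕜] {g h : ℝ → Fin 2 → 𝕜} {b : ℝ}
    (H : ∀ i, ACDeriv (fun t => g t i) (fun t => h t i) b) : ACDeriv g h b := by
  have e : ∀ v : Fin 2 → 𝕜, v = ContinuousLinearMap.single ℝ (fun _ : Fin 2 => 𝕜) 0 (v 0) +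
      ContinuousLinearMap.single ℝ (fun _ : Fin 2 => 𝕜) 1 (v 1) := by
    intro v
    ext i
    fin_cases i <;> simp
  have := ((H 0).clm (ContinuousLinearMap.single ℝ (fun _ : Fin 2 => 𝕜) 0)).add
    ((H 1).clm (ContinuousLinearMap.single ℝ (fun _ : Fin 2 => 𝕜) 1))
  simpa only [← e] using this

theorem _root_.ACDeriv.apply {𝕜 : Type*} [RCLike 𝕜] {g h : ℝ → Fin 2 → 𝕜} {b : ℝ}
    (H : ACDeriv g h b) (i : Fin 2) : ACDeriv (fun t => g t i) (fun t => h t i) b :=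
  H.clm (ContinuousLinearMap.proj i)

/-- A boundary point fixes a direction only up to sign, so `r` is nonzero but possibly negative. -/
theorem exists_direction {u : Fin 2 → ℝ} (hu : u ≠ 0) {φ : ℝ}
    (h : Complex.exp (φ * Complex.I) = cayleyBoundary (boundaryPoint u)) :
    ∃ r : ℝ, r ≠ 0 ∧ u = ![-(r * Real.cos (φ / 2)), r * Real.sin (φ / 2)] := by
  have h1 := cayleyBoundary_direction (φ := φ) one_ne_zero
  rw [h] at h1
  set p : Fin 2 → ℝ := ![-(1 * Real.cos (φ / 2)), 1 * Real.sin (φ / 2)] with hp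
  have hcs := Real.sin_sq_add_cos_sq (φ / 2)
  have hp0 : p ≠ 0 := by
    intro h0
    have e0 := congrFun h0 0
    have e1 := congrFun h0 1
    simp [hp] at e0 e1
    rw [e0, e1] at hcs
    norm_num at hcs
  have h2 := (cayleyBoundary_eq_iff hp0 hu).1 h1
  simp [hp] at h2
  have e0 : u 0 = -((u 1 * Real.sin (φ / 2) - u 0 * Real.cos (φ / 2)) * Real.cos (φ / 2)) := by
    linear_combination (-Real.sin (φ / 2)) * h2 - u 0 * hcs
  have e1 : u 1 = (u 1 * Real.sin (φ / 2) - u 0 * Real.cos (φ / 2)) * Real.sin (φ / 2) := by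
    linear_combination (-Real.cos (φ / 2)) * h2 - u 1 * hcs
  refine ⟨u 1 * Real.sin (φ / 2) - u 0 * Real.cos (φ / 2), fun h0 => hu ?_, ?_⟩
  · rw [h0] at e0 e1
    ext i
    fin_cases i
    · simpa using e0
    · simpa using e1
  · ext i
    fin_cases i
    · exact e0
    · exact e1

/-- The solution of `v' = -lam J R v` with `v(0) = u₀`, in polar coordinates. -/
theorem exists_solution (hB : D.CondB) {lam : ℝ} {φ : ℝ → ℝ}
    (hφ : IsCarouselAngle D.T D.z (boundaryPoint D.u₀) D.f lam φ) :
    ∃ v : ℝ → Fin 2 → ℝ, v 0 = D.u₀ ∧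
      (∀ b ∈ timeInterval D.T, ACDeriv v (fun s => D.velocity s (lam • v s)) b) ∧
      ∀ t, v t ≠ 0 ∧ cayleyBoundary (boundaryPoint (v t)) = Complex.exp (φ t * Complex.I) := by
  rw [isCarouselAngle_iff] at hφ
  obtain ⟨r, hr, hu⟩ := exists_direction D.u₀_ne (φ := φ 0) (by
    rw [hφ.1]; exact exp_arg_cayleyBoundary D.u₀_ne)
  -- Insert `v = ρ (-cos (φ/2), sin (φ/2))` in `v' = -lam J R v`. The radial component reads `ρ' = k
  -- ρ`, and the angular component is the carousel equation, so the given angle only has to be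
  -- completed by a radius.
  set k : ℝ → ℝ := fun s => lam * ((D.R s 0 0 - D.R s 1 1) *
    (Real.sin (φ s / 2) * Real.cos (φ s / 2)) +
      D.R s 0 1 * (Real.cos (φ s / 2) ^ 2 - Real.sin (φ s / 2) ^ 2)) with hk
  set ρ : ℝ → ℝ := fun t => r * Real.exp (∫ s in (0 : ℝ)..t, k s) with hρ
  have hρ0 : ∀ t, ρ t ≠ 0 := fun t => mul_ne_zero hr (Real.exp_ne_zero _)
  refine ⟨fun t => ![-(ρ t * Real.cos (φ t / 2)), ρ t * Real.sin (φ t / 2)], ?_, fun b hb => ?_,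
    fun t => ?_⟩
  · simp only [hρ, intervalIntegral.integral_same, Real.exp_zero, mul_one]
    exact hu.symm
  · have H := hφ.2 b hb
    obtain ⟨C, hC⟩ := hB.2 b hb
    have hki : IntervalIntegrable k volume 0 b := by
      rw [intervalIntegrable_iff_integrableOn_Icc_of_le hb.1]
      have hR : ∀ i j, AEMeasurable (fun t => D.R t i j) (volume.restrict (Set.Icc 0 b)) :=
        fun i j => (hB.1 i j).mono_measure (restrict_Icc_le_timeMeasure hb)
      have hφm : AEMeasurable (fun s => φ s / 2) (volume.restrict (Set.Icc 0 b)) :=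
        (H.continuousOn.aemeasurable measurableSet_Icc).div_const 2
      have hc := Real.measurable_cos.comp_aemeasurable hφm
      have hs := Real.measurable_sin.comp_aemeasurable hφm
      have hkm : AEMeasurable k (volume.restrict (Set.Icc 0 b)) :=
        ((((hR 0 0).sub (hR 1 1)).mul (hs.mul hc)).add
          ((hR 0 1).mul ((hc.pow_const 2).sub (hs.pow_const 2)))).const_mul lam
      refine Integrable.of_bound hkm.aestronglyMeasurable (|lam| * (4 * C)) ?_
      filter_upwards [ae_restrict_mem measurableSet_Icc] with s hs
      have h0 := (hC s hs 0 0).1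
      have h1 := (hC s hs 0 1).1
      have h2 := (hC s hs 1 1).1
      have hC0 := (abs_nonneg _).trans h0
      have c1 := Real.abs_cos_le_one (φ s / 2)
      have s1 := Real.abs_sin_le_one (φ s / 2)
      rw [hk, Real.norm_eq_abs, abs_mul]
      refine mul_le_mul_of_nonneg_left ?_ (abs_nonneg lam)
      refine (abs_add_le _ _).trans ?_
      rw [abs_mul, abs_mul, abs_mul]
      have a1 : |D.R s 0 0 - D.R s 1 1| ≤ 2 * C := (abs_sub _ _).trans (by linarith)
      have a2 : |Real.sin (φ s / 2)| * |Real.cos (φ s / 2)| ≤ 1 :=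
        mul_le_one₀ s1 (abs_nonneg _) c1
      have a3 : |Real.cos (φ s / 2) ^ 2 - Real.sin (φ s / 2) ^ 2| ≤ 2 := by
        refine (abs_sub _ _).trans ?_
        rw [abs_pow, abs_pow]
        have := pow_le_one₀ (n := 2) (abs_nonneg _) c1
        have := pow_le_one₀ (n := 2) (abs_nonneg _) s1
        linarith
      have b1 := mul_le_mul a1 a2 (by positivity) (by positivity)
      have b2 := mul_le_mul h1 a3 (by positivity) (by positivity)
      linarith
    have hK : ACDeriv (fun t => ∫ s in (0 : ℝ)..t, k s) k b := ⟨hb.1, hki, fun t _ => by simp⟩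
    have hE : ACDeriv ρ (fun t => ρ t * k t) b := by
      refine (((ACDeriv.const hb.1 r).mul
        (hK.comp Real.hasDerivAt_exp Real.continuous_exp))).congr_deriv
          (Eventually.of_forall fun s _ => ?_)
      simp only [hρ]
      ring
    have hc := H.comp (G := fun x => Real.cos (x / 2)) (dG := fun x => -Real.sin (x / 2) * (1 / 2))
      (fun x => ((hasDerivAt_id' x).div_const 2).cos) (by fun_prop)
    have hs := H.comp (G := fun x => Real.sin (x / 2)) (dG := fun x => Real.cos (x / 2) * (1 / 2))
      (fun x => ((hasDerivAt_id' x).div_const 2).sin) (by fun_prop)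
    refine ACDeriv.pi_two fun i => ?_
    fin_cases i
    · refine ((hE.mul hc).neg).congr_deriv (Eventually.of_forall fun s _ => ?_)
      have hcs := Real.sin_sq_add_cos_sq (φ s / 2)
      simp [velocity, weight_apply, rate_eq_half, hk, R_one_zero, ← R_zero_one]
      set c := Real.cos (φ s / 2)
      set d := Real.sin (φ s / 2)
      linear_combination (lam * ρ s * (D.R s 1 1 * d - D.R s 0 1 * c)) * hcs
    · refine (hE.mul hs).congr_deriv (Eventually.of_forall fun s _ => ?_)
      have hcs := Real.sin_sq_add_cos_sq (φ s / 2)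
      simp [velocity, weight_apply, rate_eq_half, hk]
      set c := Real.cos (φ s / 2)
      set d := Real.sin (φ s / 2)
      linear_combination (lam * ρ s * (D.R s 0 0 * c - D.R s 0 1 * d)) * hcs
  · refine ⟨fun h0 => ?_, cayleyBoundary_direction (hρ0 t)⟩
    have e0 := congrFun h0 0
    have e1 := congrFun h0 1
    have hcs := Real.sin_sq_add_cos_sq (φ t / 2)
    simp [hρ0 t] at e0 e1
    rw [e0, e1] at hcs
    norm_num at hcs

end DiracData

/-! ### Truncation in `L²_R` -/

section LeftEnd

theorem leftEnd_eventually_gt {T : EReal} {t : ℝ} (ht : t ∈ timeInterval T) :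
    ∀ᶠ b in leftEnd T, t < b := by
  have h : ∀ᶠ y in 𝓝[<] T, (t : EReal) < y := mem_nhdsWithin_of_mem_nhds (Ioi_mem_nhds ht.2)
  filter_upwards [h.comap (fun t : ℝ => (t : EReal))] with b hb
  exact EReal.coe_lt_coe_iff.1 hb

theorem leftEnd_eventually_mem {T : EReal} (hT : 0 < T) :
    ∀ᶠ b in leftEnd T, b ∈ timeInterval T := by
  have h : ∀ᶠ y in 𝓝[<] T, y < T := self_mem_nhdsWithin
  filter_upwards [h.comap (fun t : ℝ => (t : EReal)),
    leftEnd_eventually_gt (zero_mem_timeInterval hT)] with b hb h0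
  exact ⟨h0.le, hb⟩

theorem leftEnd_neBot {T : EReal} (hT : 0 < T) : (leftEnd T).NeBot := by
  refine comap_neBot_iff.2 fun s hs => ?_
  obtain ⟨l, hl, hls⟩ := (mem_nhdsLT_iff_exists_Ioo_subset' hT).1 hs
  obtain ⟨q, h1, h2⟩ := EReal.lt_iff_exists_rat_btwn.1 (show l < T from hl)
  exact ⟨(q : ℝ), hls ⟨h1, h2⟩⟩

/-- Needed for dominated convergence along `s ↑ T`. -/
instance {T : EReal} : (leftEnd T).IsCountablyGenerated := by
  unfold leftEnd
  infer_instance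

end LeftEnd

namespace DiracData

variable {D : DiracData} {𝕜 : Type*} [RCLike 𝕜]

namespace L2R

variable (D) in
/-- The class of a measurable function of finite norm. -/
noncomputable def ofFun (v : ℝ → Fin 2 → 𝕜) (hv : AEStronglyMeasurable v (timeMeasure D.T))
    (hi : Integrable (D.form v v) (timeMeasure D.T)) : D.L2R 𝕜 :=
  ⟨AEEqFun.mk v hv, (integrable_congr
    (D.form_congr (AEEqFun.coeFn_mk v hv) (AEEqFun.coeFn_mk v hv))).2 hi⟩

theorem coeFn_ofFun (v : ℝ → Fin 2 → 𝕜) (hv : AEStronglyMeasurable v (timeMeasure D.T))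
    (hi : Integrable (D.form v v) (timeMeasure D.T)) :
    (ofFun D v hv hi : ℝ → Fin 2 → 𝕜) =ᵐ[timeMeasure D.T] v :=
  AEEqFun.coeFn_mk v hv

end L2R

theorem form_indicator_left (s : Set ℝ) (v w : ℝ → Fin 2 → 𝕜) :
    D.form (s.indicator v) w = s.indicator (D.form v w) := by
  ext t
  by_cases h : t ∈ s <;> simp [form, h]

theorem form_indicator_right (s : Set ℝ) (v w : ℝ → Fin 2 → 𝕜) :
    D.form v (s.indicator w) = s.indicator (D.form v w) := by
  ext t
  by_cases h : t ∈ s <;> simp [form, h]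

theorem integrable_form_indicator {s : Set ℝ} (hs : MeasurableSet s) {v : ℝ → Fin 2 → 𝕜}
    (hi : Integrable (D.form v v) (timeMeasure D.T)) :
    Integrable (D.form (s.indicator v) (s.indicator v)) (timeMeasure D.T) := by
  rw [form_indicator_left, form_indicator_right, Set.indicator_indicator, Set.inter_self]
  exact hi.indicator hs

theorem re_form_self_nonneg {t : ℝ} (ht : t ∈ timeInterval D.T) (v : ℝ → Fin 2 → 𝕜) :
    0 ≤ RCLike.re (D.form v v t) := by
  have hq := D.weight_nonneg ht
  rw [form_self_eq, RCLike.ofReal_re]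
  positivity

theorem norm_sq_eq (v : D.L2R 𝕜) :
    ‖v‖ ^ 2 = ∫ t, RCLike.re (D.form v v t) ∂timeMeasure D.T := by
  rw [← inner_self_eq_norm_sq (𝕜 := 𝕜), inner_def, integral_re (L2R.integrable D v v)]

variable (D 𝕜) in
/-- The orthogonal projection `v ↦ v 1_[0, b]`. -/
noncomputable def trunc (b : ℝ) : D.L2R 𝕜 →L[𝕜] D.L2R 𝕜 :=
  LinearMap.mkContinuous
    -- The measure lives on `[0, T)`, so `Iic b` cuts in the same way as `[0, b]`.
    { toFun := fun v => L2R.ofFun D ((Set.Iic b).indicator v)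
        ((L2R.aesm D v).indicator measurableSet_Iic)
        (integrable_form_indicator measurableSet_Iic (L2R.integrable D v v))
      map_add' := fun v w => by
        refine L2R.ext_ae D ?_
        refine (L2R.coeFn_ofFun _ _ _).trans (EventuallyEq.trans ?_ (L2R.coeFn_add D _ _).symm)
        filter_upwards [L2R.coeFn_add D v w,
          L2R.coeFn_ofFun (D := D) ((Set.Iic b).indicator v)
            ((L2R.aesm D v).indicator measurableSet_Iic)
            (integrable_form_indicator measurableSet_Iic (L2R.integrable D v v)),
          L2R.coeFn_ofFun (D := D) ((Set.Iic b).indicator w)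
            ((L2R.aesm D w).indicator measurableSet_Iic)
            (integrable_form_indicator measurableSet_Iic (L2R.integrable D w w))] with t h1 h2 h3
        rw [Pi.add_apply, h2, h3]
        by_cases h : t ∈ Set.Iic b <;> simp [h, h1]
      map_smul' := fun c v => by
        refine L2R.ext_ae D ?_
        refine (L2R.coeFn_ofFun _ _ _).trans (EventuallyEq.trans ?_ (L2R.coeFn_smul D _ _).symm)
        filter_upwards [L2R.coeFn_smul D c v,
          L2R.coeFn_ofFun (D := D) ((Set.Iic b).indicator v)
            ((L2R.aesm D v).indicator measurableSet_Iic)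
            (integrable_form_indicator measurableSet_Iic (L2R.integrable D v v))] with t h1 h2
        rw [RingHom.id_apply, Pi.smul_apply, h2]
        by_cases h : t ∈ Set.Iic b <;> simp [h, h1] }
    1 (fun v => by
      rw [one_mul]
      refine (pow_le_pow_iff_left₀ (norm_nonneg _) (norm_nonneg _) two_ne_zero).1 ?_
      rw [norm_sq_eq, norm_sq_eq]
      refine integral_mono_ae (L2R.integrable D _ _).re (L2R.integrable D _ _).re ?_
      filter_upwards [D.ae_mem, D.form_congr
        (L2R.coeFn_ofFun (D := D) ((Set.Iic b).indicator v)
            ((L2R.aesm D v).indicator measurableSet_Iic)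
            (integrable_form_indicator measurableSet_Iic (L2R.integrable D v v)))
        (L2R.coeFn_ofFun (D := D) ((Set.Iic b).indicator v)
            ((L2R.aesm D v).indicator measurableSet_Iic)
            (integrable_form_indicator measurableSet_Iic (L2R.integrable D v v)))] with t ht h
      simp only [LinearMap.coe_mk, AddHom.coe_mk]
      rw [h, form_indicator_left, form_indicator_right, Set.indicator_indicator, Set.inter_self]
      by_cases hb : t ∈ Set.Iic b
      · simp [hb]
      · simpa [hb] using re_form_self_nonneg ht v)

theorem coeFn_trunc (b : ℝ) (v : D.L2R 𝕜) :
    (trunc D 𝕜 b v : ℝ → Fin 2 → 𝕜) =ᵐ[timeMeasure D.T] (Set.Iic b).indicator v :=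
  L2R.coeFn_ofFun _ ((L2R.aesm D v).indicator measurableSet_Iic)
    (integrable_form_indicator measurableSet_Iic (L2R.integrable D v v))

theorem trunc_eq_self_iff {b : ℝ} {v : D.L2R 𝕜} :
    trunc D 𝕜 b v = v ↔ ∀ᵐ t ∂timeMeasure D.T, b < t → v t = 0 := by
  constructor
  · intro h
    have := coeFn_trunc b v
    rw [h] at this
    filter_upwards [this] with t ht hb
    rw [ht, Set.indicator_of_notMem (by simpa using hb)]
  · intro h
    refine L2R.ext_ae D ((coeFn_trunc b v).trans ?_)
    filter_upwards [h] with t ht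
    by_cases hb : t ≤ b
    · rw [Set.indicator_of_mem (show t ∈ Set.Iic b from hb)]
    · rw [Set.indicator_of_notMem (by simpa using hb), ht (not_le.1 hb)]

theorem trunc_trunc {a b : ℝ} (hab : a ≤ b) (v : D.L2R 𝕜) :
    trunc D 𝕜 b (trunc D 𝕜 a v) = trunc D 𝕜 a v := by
  rw [trunc_eq_self_iff]
  filter_upwards [coeFn_trunc a v] with t ht hb
  rw [ht, Set.indicator_of_notMem (by simpa using hab.trans_lt hb)]

theorem inner_trunc_left (b : ℝ) (v w : D.L2R 𝕜) :
    inner 𝕜 (trunc D 𝕜 b v) w = inner 𝕜 v (trunc D 𝕜 b w) := by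
  rw [inner_def, inner_def]
  refine integral_congr_ae ((D.form_congr (coeFn_trunc b v) (ae_eq_refl _)).trans
    (EventuallyEq.trans ?_ (D.form_congr (ae_eq_refl _) (coeFn_trunc b w)).symm))
  rw [form_indicator_left, form_indicator_right]

theorem norm_trunc_le (b : ℝ) (v : D.L2R 𝕜) : ‖trunc D 𝕜 b v‖ ≤ ‖v‖ := by
  have := (trunc D 𝕜 b).le_of_opNorm_le (LinearMap.mkContinuous_norm_le _ zero_le_one _) v
  simpa using this

/-- The squared error is the energy of `v` beyond `b`, which vanishes in the limit by dominated
convergence. -/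
theorem tendsto_trunc (v : D.L2R 𝕜) :
    Tendsto (fun b => trunc D 𝕜 b v) (leftEnd D.T) (𝓝 v) := by
  rw [tendsto_iff_norm_sub_tendsto_zero]
  have key : Tendsto (fun b => ‖trunc D 𝕜 b v - v‖ ^ 2) (leftEnd D.T) (𝓝 0) := by
    have e : ∀ b, ‖trunc D 𝕜 b v - v‖ ^ 2 =
        ∫ t, (Set.Ioi b).indicator (fun t => RCLike.re (D.form v v t)) t ∂timeMeasure D.T := by
      intro b
      rw [norm_sq_eq]
      have h1 : (trunc D 𝕜 b v - v : D.L2R 𝕜) =ᵐ[timeMeasure D.T]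
          (Set.Ioi b).indicator (fun t => -(v : ℝ → Fin 2 → 𝕜) t) := by
        rw [sub_eq_add_neg, ← neg_one_smul 𝕜 v]
        filter_upwards [L2R.coeFn_add D (trunc D 𝕜 b v) ((-1 : 𝕜) • v), coeFn_trunc b v,
          L2R.coeFn_smul D (-1 : 𝕜) v] with t h1 h2 h3
        rw [h1, Pi.add_apply, h2, h3]
        by_cases hb : t ≤ b
        · simp [hb]
        · simp [hb, not_le.1 hb]
      refine integral_congr_ae ?_
      filter_upwards [D.form_congr h1 h1] with t ht
      rw [ht, form_indicator_left, form_indicator_right, Set.indicator_indicator, Set.inter_self]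
      by_cases hb : t ∈ Set.Ioi b
      · rw [Set.indicator_of_mem hb, Set.indicator_of_mem hb]
        congr 1
        simp only [form_eq, Pi.neg_apply, star_sub, star_neg, star_mul']
        ring
      · rw [Set.indicator_of_notMem hb, Set.indicator_of_notMem hb, map_zero]
    simp only [e]
    have := tendsto_integral_filter_of_dominated_convergence (l := leftEnd D.T)
      (μ := timeMeasure D.T)
      (F := fun b => (Set.Ioi b).indicator (fun t => RCLike.re (D.form v v t))) (f := fun _ => 0)
      (fun t => ‖RCLike.re (D.form v v t)‖)
      (Eventually.of_forall fun b => ((L2R.integrable D v v).re.indicator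
        measurableSet_Ioi).aestronglyMeasurable)
      (Eventually.of_forall fun b => Eventually.of_forall fun t => norm_indicator_le_norm_self _ _)
      (L2R.integrable D v v).re.norm (by
        filter_upwards [D.ae_mem] with t ht
        refine tendsto_const_nhds.congr' ?_
        filter_upwards [leftEnd_eventually_gt ht] with b hb
        rw [Set.indicator_of_notMem (by simpa using hb.le)])
    simpa using this
  have := key.sqrt
  simpa using this

end DiracData

namespace DiracData

variable {D : DiracData} {𝕜 : Type*} [RCLike 𝕜]

/-! ### Boundary conditions -/

variable (𝕜) in
/-- A real vector, seen as a vector with entries in `𝕜`. -/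
noncomputable def ofRealVec (u : Fin 2 → ℝ) : Fin 2 → 𝕜 := fun i => (u i : 𝕜)

theorem wronskian_eq (v : Fin 2 → 𝕜) (u : Fin 2 → ℝ) :
    wronskian v u = v 1 * (u 0 : 𝕜) - v 0 * (u 1 : 𝕜) := by
  simp [wronskian, J, dotProduct, Matrix.mulVec, Fin.sum_univ_two]
  ring

theorem ofRealVec_ne_zero {u : Fin 2 → ℝ} (hu : u ≠ 0) : ofRealVec 𝕜 u ≠ 0 := by
  intro h
  refine hu (funext fun i => ?_)
  have := congrFun h i
  simpa [ofRealVec] using this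

theorem wronskian_ofRealVec {v u : Fin 2 → ℝ} :
    wronskian (ofRealVec 𝕜 v) u = 0 ↔ v 0 * u 1 = v 1 * u 0 := by
  rw [wronskian_eq, sub_eq_zero, eq_comm]
  simp only [ofRealVec]
  norm_cast

theorem wronskian_ofRealVec_self (u : Fin 2 → ℝ) : wronskian (ofRealVec 𝕜 u) u = 0 :=
  wronskian_ofRealVec.2 (mul_comm _ _)

theorem exists_smul_of_wronskian {u : Fin 2 → ℝ} (hu : u ≠ 0) {v : Fin 2 → 𝕜}
    (h : wronskian v u = 0) : ∃ c : 𝕜, v = c • ofRealVec 𝕜 u := by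
  rw [wronskian_eq, sub_eq_zero] at h
  rcases ne_zero_or_ne_zero hu with h0 | h0
  · have h0' : (u 0 : 𝕜) ≠ 0 := by exact_mod_cast h0
    refine ⟨v 0 / u 0, funext fun i => ?_⟩
    fin_cases i
    · simp [ofRealVec, h0']
    · simp only [ofRealVec, Pi.smul_apply, smul_eq_mul, Fin.mk_one]
      field_simp
      exact h
  · have h0' : (u 1 : 𝕜) ≠ 0 := by exact_mod_cast h0
    refine ⟨v 1 / u 1, funext fun i => ?_⟩
    fin_cases i
    · simp only [ofRealVec, Pi.smul_apply, smul_eq_mul, Fin.zero_eta]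
      field_simp
      exact h.symm
    · simp [ofRealVec, h0']

/-- Both vectors are multiples of the same `u`, and `u` is real, so conjugating one of them does no
harm. This is the boundary term in Lagrange's identity. -/
theorem star_mul_sub_eq_zero {u : Fin 2 → ℝ} (hu : u ≠ 0) {v w : Fin 2 → 𝕜}
    (hv : wronskian v u = 0) (hw : wronskian w u = 0) :
    star (v 1) * w 0 - star (v 0) * w 1 = 0 := by
  obtain ⟨a, rfl⟩ := exists_smul_of_wronskian hu hv
  obtain ⟨b, rfl⟩ := exists_smul_of_wronskian hu hw
  simp [ofRealVec]
  ring

/-! ### Integrability of quadratic forms -/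

theorem form_eq_sum (v w : ℝ → Fin 2 → 𝕜) (t : ℝ) :
    D.form v w t = star (v t 0) * D.weight t (w t) 0 + star (v t 1) * D.weight t (w t) 1 := by
  simp [form, weight, dotProduct, Fin.sum_univ_two]

theorem norm_form_le_of_bound {t C M : ℝ} (hC : ∀ i j, |D.R t i j| ≤ C) {v : ℝ → Fin 2 → 𝕜}
    (hM : ‖v t‖ ≤ M) : ‖D.form v v t‖ ≤ 4 * C * M ^ 2 := by
  have hC0 : 0 ≤ C := (abs_nonneg _).trans (hC 0 0)
  have hM0 : 0 ≤ M := (norm_nonneg _).trans hM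
  have hv : ∀ i, ‖v t i‖ ≤ M := fun i => (norm_le_pi_norm (v t) i).trans hM
  have hw : ∀ i, ‖D.weight t (v t) i‖ ≤ 2 * C * M := by
    intro i
    rw [weight_apply]
    refine (norm_add_le _ _).trans ?_
    rw [norm_mul, norm_mul, RCLike.norm_ofReal, RCLike.norm_ofReal]
    have h0 := mul_le_mul (hC i 0) (hv 0) (norm_nonneg _) hC0
    have h1 := mul_le_mul (hC i 1) (hv 1) (norm_nonneg _) hC0
    linarith
  rw [form_eq_sum]
  refine (norm_add_le _ _).trans ?_
  rw [norm_mul, norm_mul, norm_star, norm_star]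
  have h0 := mul_le_mul (hv 0) (hw 0) (norm_nonneg _) hM0
  have h1 := mul_le_mul (hv 1) (hw 1) (norm_nonneg _) hM0
  nlinarith

theorem aesm_indicator_Icc {b : ℝ} (hb : b ∈ timeInterval D.T) {v : ℝ → Fin 2 → 𝕜}
    (hv : ContinuousOn v (Set.Icc 0 b)) :
    AEStronglyMeasurable ((Set.Icc 0 b).indicator v) (timeMeasure D.T) := by
  rw [aestronglyMeasurable_indicator_iff measurableSet_Icc, timeMeasure,
    Measure.restrict_restrict measurableSet_Icc,
    Set.inter_eq_self_of_subset_left (Icc_subset_timeInterval hb)]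
  exact hv.aestronglyMeasurable measurableSet_Icc

theorem integrable_form_Icc (hB : D.CondB) {b : ℝ} (hb : b ∈ timeInterval D.T)
    {v : ℝ → Fin 2 → 𝕜} (hv : ContinuousOn v (Set.Icc 0 b)) :
    Integrable (D.form ((Set.Icc 0 b).indicator v) ((Set.Icc 0 b).indicator v))
      (timeMeasure D.T) := by
  obtain ⟨C, hC⟩ := hB.2 b hb
  obtain ⟨M, hM⟩ := isCompact_Icc.exists_bound_of_continuousOn hv
  have hm := D.aesm_form (aesm_indicator_Icc hb hv) (aesm_indicator_Icc hb hv)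
  rw [form_indicator_left, form_indicator_right, Set.indicator_indicator, Set.inter_self] at hm ⊢
  rw [integrable_indicator_iff measurableSet_Icc, IntegrableOn, timeMeasure,
    Measure.restrict_restrict measurableSet_Icc,
    Set.inter_eq_self_of_subset_left (Icc_subset_timeInterval hb)]
  rw [aestronglyMeasurable_indicator_iff measurableSet_Icc, timeMeasure,
    Measure.restrict_restrict measurableSet_Icc,
    Set.inter_eq_self_of_subset_left (Icc_subset_timeInterval hb)] at hm
  refine Integrable.of_bound hm (4 * C * M ^ 2) ?_
  filter_upwards [ae_restrict_mem measurableSet_Icc] with t ht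
  exact norm_form_le_of_bound (fun i j => (hC t ht i j).1) (hM t ht)

variable (D) in
/-- The constant vector `c` has finite energy. -/
def ConstEnergy (c : Fin 2 → 𝕜) : Prop :=
  Integrable (D.form (fun _ => c) (fun _ => c)) (timeMeasure D.T)

theorem ConstEnergy.integrable {c d : Fin 2 → 𝕜} (hc : D.ConstEnergy c) (hd : D.ConstEnergy d) :
    Integrable (D.form (fun _ => c) (fun _ => d)) (timeMeasure D.T) :=
  D.integrable_form aestronglyMeasurable_const aestronglyMeasurable_const hc hd

theorem ConstEnergy.smul {c : Fin 2 → 𝕜} (hc : D.ConstEnergy c) (a : 𝕜) :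
    D.ConstEnergy (a • c) := by
  have e : D.form (fun _ => a • c) (fun _ => a • c) =
      star a • a • D.form (fun _ => c) (fun _ => c) := by
    rw [← form_smul_right, ← form_smul_left]
    rfl
  rw [ConstEnergy, e]
  exact (Integrable.smul a hc).smul (star a)

theorem ConstEnergy.add {c d : Fin 2 → 𝕜} (hc : D.ConstEnergy c) (hd : D.ConstEnergy d) :
    D.ConstEnergy (c + d) := by
  have e : D.form (fun _ => c + d) (fun _ => c + d) =
      (D.form (fun _ => c) (fun _ => c) + D.form (fun _ => c) (fun _ => d)) +
        (D.form (fun _ => d) (fun _ => c) + D.form (fun _ => d) (fun _ => d)) := by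
    rw [← form_add_right, ← form_add_right, ← form_add_left]
    rfl
  rw [ConstEnergy, e]
  exact (Integrable.add hc (hc.integrable hd)).add ((hd.integrable hc).add hd)

theorem constEnergy_ofRealVec {u : Fin 2 → ℝ} (hu : D.FiniteEnergy u) :
    D.ConstEnergy (ofRealVec 𝕜 u) := by
  have e : D.form (fun _ => ofRealVec 𝕜 u) (fun _ => ofRealVec 𝕜 u) =
      fun t => ((u ⬝ᵥ (D.R t).mulVec u : ℝ) : 𝕜) := by
    ext t
    rw [form_eq_sum, weight_apply, weight_apply]
    simp [ofRealVec, dotProduct, Matrix.mulVec, Fin.sum_univ_two]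
  rw [ConstEnergy, e]
  exact Integrable.ofReal hu

/-- In the limit circle case all constants have finite energy, so the property that the convention
demands of `u₁` holds in both cases. -/
theorem finiteEnergy_u₁ (hend : D.EndConvention) : D.FiniteEnergy D.u₁ := by
  by_cases h : D.LimitCircle
  · have e : (fun t => D.u₁ ⬝ᵥ (D.R t).mulVec D.u₁) = fun t =>
        D.u₁ 0 * (D.R t 0 0 * D.u₁ 0 + D.R t 0 1 * D.u₁ 1) +
          D.u₁ 1 * (D.R t 1 0 * D.u₁ 0 + D.R t 1 1 * D.u₁ 1) := by
      ext t
      simp [dotProduct, Matrix.mulVec, Fin.sum_univ_two]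
    rw [FiniteEnergy, e]
    exact ((((h 0 0).mul_const _).add ((h 0 1).mul_const _)).const_mul _).add
      ((((h 1 0).mul_const _).add ((h 1 1).mul_const _)).const_mul _)
  · exact hend h

/-- Two independent constant vectors of finite energy force the limit circle case. -/
theorem limitCircle_of_constEnergy {c : Fin 2 → 𝕜} {u : Fin 2 → ℝ} (hc : D.ConstEnergy c)
    (hu : D.ConstEnergy (ofRealVec 𝕜 u)) (hw : wronskian c u ≠ 0) : D.LimitCircle := by
  -- By Cramer's rule the standard basis vectors are combinations of `c` and `u`; the entries of `R`
  -- are their mutual forms.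
  have he : ∀ i : Fin 2, D.ConstEnergy (fun j => if j = i then (1 : 𝕜) else 0) := by
    intro i
    rw [wronskian_eq] at hw
    fin_cases i
    · have e : (fun j : Fin 2 => if j = 0 then (1 : 𝕜) else 0) =
          (-(u 1 : 𝕜) / (c 1 * u 0 - c 0 * u 1)) • c +
            (c 1 / (c 1 * u 0 - c 0 * u 1)) • ofRealVec 𝕜 u := by
        ext j
        fin_cases j
        · change (1 : 𝕜) = _ / _ * c 0 + _ / _ * (u 0 : 𝕜)
          rw [div_mul_eq_mul_div, div_mul_eq_mul_div, ← add_div, eq_comm, div_eq_one_iff_eq hw]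
          ring
        · change (0 : 𝕜) = _ / _ * c 1 + _ / _ * (u 1 : 𝕜)
          rw [div_mul_eq_mul_div, div_mul_eq_mul_div, ← add_div, eq_comm, div_eq_zero_iff]
          exact Or.inl (by ring)
      simp only [Fin.zero_eta, e]
      exact (hc.smul _).add (hu.smul _)
    · have e : (fun j : Fin 2 => if j = 1 then (1 : 𝕜) else 0) =
          ((u 0 : 𝕜) / (c 1 * u 0 - c 0 * u 1)) • c +
            (-c 0 / (c 1 * u 0 - c 0 * u 1)) • ofRealVec 𝕜 u := by
        ext j
        fin_cases j
        · change (0 : 𝕜) = _ / _ * c 0 + _ / _ * (u 0 : 𝕜)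
          rw [div_mul_eq_mul_div, div_mul_eq_mul_div, ← add_div, eq_comm, div_eq_zero_iff]
          exact Or.inl (by ring)
        · change (1 : 𝕜) = _ / _ * c 1 + _ / _ * (u 1 : 𝕜)
          rw [div_mul_eq_mul_div, div_mul_eq_mul_div, ← add_div, eq_comm, div_eq_one_iff_eq hw]
          ring
      simp only [Fin.mk_one, e]
      exact (hc.smul _).add (hu.smul _)
  intro i j
  have e : (fun t => D.R t i j) = fun t => RCLike.re (D.form (fun _ k => if k = i then (1 : 𝕜) else 0)
      (fun _ k => if k = j then (1 : 𝕜) else 0) t) := by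
    ext t
    rw [form_eq_sum, weight_apply, weight_apply]
    fin_cases i <;> fin_cases j <;> simp
  rw [e]
  exact ((he i).integrable (he j)).re

/-! ### The inverse operator -/

theorem isPair_iff {K : D.L2R 𝕜 →L[𝕜] D.L2R 𝕜} (hK : IsResolvent (D.operator 𝕜) 0 K)
    (v w : D.L2R 𝕜) : D.IsPair v w ↔ K w = v := by
  have hg : D.IsPair v w ↔ (v, w) ∈ (D.operator 𝕜).graph := by
    rw [operator_graph]
    rfl
  rw [hg, LinearPMap.mem_graph_iff]
  constructor
  · rintro ⟨y, hy, hy'⟩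
    simp only at hy hy'
    have := hK.1 y
    rw [zero_smul, sub_zero, hy'] at this
    rw [this, hy]
  · rintro rfl
    obtain ⟨y, hy, hy'⟩ := hK.2 w
    rw [zero_smul, sub_zero] at hy'
    exact ⟨y, hy, hy'⟩

theorem ae_Ioo_of_ae {p : ℝ → Prop} (h : ∀ᵐ t ∂timeMeasure D.T, p t) {b : ℝ}
    (hb : b ∈ timeInterval D.T) : ∀ᵐ t : ℝ, t ∈ Set.Ioo 0 b → p t := by
  have := (ae_restrict_iff' (measurableSet_timeInterval D.T)).1 h
  filter_upwards [this] with t ht htb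
  exact ht (mem_timeInterval_of_le hb ⟨htb.1.le, htb.2.le⟩)

theorem IsPair.exists_rep {v w : D.L2R 𝕜} (h : D.IsPair v w) :
    ∃ g : ℝ → Fin 2 → 𝕜, v =ᵐ[timeMeasure D.T] g ∧
      (∀ b ∈ timeInterval D.T, ACDeriv g (fun s => D.velocity s (w s)) b) ∧
      wronskian (g 0) D.u₀ = 0 ∧
      (D.LimitCircle → Tendsto (fun s => wronskian (g s) D.u₁) (leftEnd D.T) (𝓝 0)) := by
  obtain ⟨g, h, h1, h2, h3, h4, h5⟩ := h
  refine ⟨g, h2, fun b hb => ?_, h4, h5⟩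
  have H : ACDeriv g h b := ⟨hb.1, (h1 b hb).1, fun t ht => (h1 t (mem_timeInterval_of_le hb ht)).2⟩
  refine H.congr_deriv ?_
  filter_upwards [ae_Ioo_of_ae h3 hb] with t ht htb
  rw [ht htb, velocity_tau (mem_timeInterval_of_le hb ⟨htb.1.le, htb.2.le⟩)]

theorem IsPair.of_rep {v w : D.L2R 𝕜} {g w' : ℝ → Fin 2 → 𝕜} (hv : v =ᵐ[timeMeasure D.T] g)
    (hw : w =ᵐ[timeMeasure D.T] w')
    (H : ∀ b ∈ timeInterval D.T, ACDeriv g (fun s => D.velocity s (w' s)) b)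
    (h0 : wronskian (g 0) D.u₀ = 0)
    (h1 : D.LimitCircle → Tendsto (fun s => wronskian (g s) D.u₁) (leftEnd D.T) (𝓝 0)) :
    D.IsPair v w := by
  refine ⟨g, fun s => D.velocity s (w' s), fun t ht => ⟨(H t ht).int, (H t ht).eq t
    ⟨ht.1, le_rfl⟩⟩, hv, hw.trans ?_, h0, h1⟩
  filter_upwards [D.ae_mem] with t ht
  rw [tau_eq_of_velocity ht rfl]

/-- If `τ v` vanishes after time `b`, then `v` is constant after `b`, and parallel to `u₁`. -/
theorem wronskian_u₁_of_support (hB : D.CondB) (hend : D.EndConvention) {b : ℝ}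
    (hb : b ∈ timeInterval D.T)
    {v w : D.L2R 𝕜} (hw : ∀ᵐ t ∂timeMeasure D.T, b < t → w t = 0) {g : ℝ → Fin 2 → 𝕜}
    (hv : v =ᵐ[timeMeasure D.T] g)
    (H : ∀ b ∈ timeInterval D.T, ACDeriv g (fun s => D.velocity s (w s)) b)
    (h1 : D.LimitCircle → Tendsto (fun s => wronskian (g s) D.u₁) (leftEnd D.T) (𝓝 0)) :
    (∀ t ∈ timeInterval D.T, b ≤ t → g t = g b) ∧ wronskian (g b) D.u₁ = 0 := by
  have hconst : ∀ t ∈ timeInterval D.T, b ≤ t → g t = g b := by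
    intro t ht hbt
    rw [← sub_eq_zero, (H t ht).sub_eq ⟨hb.1, hbt⟩ ⟨ht.1, le_rfl⟩]
    refine intervalIntegral.integral_zero_ae ?_
    filter_upwards [ae_Ioo_of_ae hw ht, ACDeriv.ae_ne t] with s hs hst hsb
    rw [Set.uIoc_of_le hbt] at hsb
    rw [hs ⟨hb.1.trans_lt hsb.1, lt_of_le_of_ne hsb.2 hst⟩ hsb.1, velocity_zero]
  refine ⟨hconst, ?_⟩
  -- If `g(b)` were not parallel to `u₁`, the constant `g(b)` would have finite energy, since it is
  -- the tail of `v` beyond `b` and `R` is bounded up to `b`. Together with `u₁` this forces the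
  -- limit circle case, where the boundary condition at `T` says that `g(b)` is parallel to `u₁`
  -- after all.
  by_contra hne
  have hLC : D.LimitCircle := by
    refine limitCircle_of_constEnergy (c := g b) ?_ (constEnergy_ofRealVec (finiteEnergy_u₁ hend))
      hne
    have e : D.form (fun _ => g b) (fun _ => g b) =ᵐ[timeMeasure D.T]
        D.form ((Set.Icc 0 b).indicator fun _ => g b) ((Set.Icc 0 b).indicator fun _ => g b) +
          (Set.Ioi b).indicator (D.form v v) := by
      filter_upwards [D.form_congr hv hv, D.ae_mem] with t ht htT
      rw [Pi.add_apply, form_indicator_left, form_indicator_right, Set.indicator_indicator,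
        Set.inter_self]
      by_cases hbt : t ≤ b
      · rw [Set.indicator_of_mem (show t ∈ Set.Icc 0 b from ⟨htT.1, hbt⟩),
          Set.indicator_of_notMem (by simpa using hbt), add_zero]
      · rw [Set.indicator_of_notMem (fun h => hbt h.2),
          Set.indicator_of_mem (show t ∈ Set.Ioi b from not_le.1 hbt), zero_add, ht]
        simp only [form, hconst t htT (not_le.1 hbt).le]
    exact (integrable_congr e).2 ((integrable_form_Icc hB hb continuousOn_const).add
      ((L2R.integrable D v v).indicator measurableSet_Ioi))
  have := leftEnd_neBot D.T_pos
  have hlim : Tendsto (fun s => wronskian (g s) D.u₁) (leftEnd D.T) (𝓝 (wronskian (g b) D.u₁)) := by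
    refine tendsto_const_nhds.congr' ?_
    filter_upwards [leftEnd_eventually_gt hb, leftEnd_eventually_mem D.T_pos] with s hs hsT
    rw [hconst s hsT hs.le]
  exact hne (tendsto_nhds_unique hlim (h1 hLC))

/-! ### Symmetry of the inverse -/

theorem integral_timeMeasure_eq {b : ℝ} (hb : b ∈ timeInterval D.T) {F : ℝ → 𝕜}
    (hF : ∀ᵐ t ∂timeMeasure D.T, b < t → F t = 0) :
    ∫ t, F t ∂timeMeasure D.T = ∫ t in (0 : ℝ)..b, F t := by
  rw [intervalIntegral.integral_of_le hb.1, ← integral_Icc_eq_integral_Ioc, timeMeasure]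
  refine setIntegral_eq_of_subset_of_ae_sdiff_eq_zero
    (measurableSet_timeInterval D.T).nullMeasurableSet (Icc_subset_timeInterval hb) ?_
  filter_upwards [(ae_restrict_iff' (measurableSet_timeInterval D.T)).1 hF] with t ht htd
  exact ht htd.1 (not_le.1 fun h => htd.2 ⟨htd.1.1, h⟩)

/-- Lagrange's identity: for representatives `g`, `g'` the derivative of `conj (g 1) g' 0 - conj (g
0) g' 1` is the difference of the two integrands. The boundary term vanishes at `0` because of `u₀`
and at `b` because both functions are parallel to `u₁` there. -/
theorem inner_eq_of_isPair_of_support (hB : D.CondB) (hend : D.EndConvention) {b : ℝ}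
    (hb : b ∈ timeInterval D.T) {v w v' w' : D.L2R 𝕜} (h : D.IsPair v w) (h' : D.IsPair v' w')
    (hw : ∀ᵐ t ∂timeMeasure D.T, b < t → w t = 0)
    (hw' : ∀ᵐ t ∂timeMeasure D.T, b < t → w' t = 0) : inner 𝕜 v w' = inner 𝕜 w v' := by
  obtain ⟨g, hv, H, h0, h1⟩ := h.exists_rep
  obtain ⟨g', hv', H', h0', h1'⟩ := h'.exists_rep
  have e := (wronskian_u₁_of_support hB hend hb hw hv H h1).2
  have e' := (wronskian_u₁_of_support hB hend hb hw' hv' H' h1').2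
  rw [inner_def, inner_def]
  have i1 : ∀ᵐ t ∂timeMeasure D.T, b < t → D.form v w' t = 0 := by
    filter_upwards [hw'] with t ht hbt
    simp [form, ht hbt]
  have i2 : ∀ᵐ t ∂timeMeasure D.T, b < t → D.form w v' t = 0 := by
    filter_upwards [hw] with t ht hbt
    simp [form, ht hbt]
  have j1 : IntervalIntegrable (D.form v w') volume 0 b :=
    (intervalIntegrable_iff_integrableOn_Icc_of_le hb.1).2
      ((L2R.integrable D v w').mono_measure (restrict_Icc_le_timeMeasure hb))
  have j2 : IntervalIntegrable (D.form w v') volume 0 b :=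
    (intervalIntegrable_iff_integrableOn_Icc_of_le hb.1).2
      ((L2R.integrable D w v').mono_measure (restrict_Icc_le_timeMeasure hb))
  rw [integral_timeMeasure_eq hb i1, integral_timeMeasure_eq hb i2, ← sub_eq_zero,
    ← intervalIntegral.integral_sub j1 j2]
  have hconj : ∀ i, ACDeriv (fun t => star (g t i)) (fun t => star (D.velocity t (w t) i)) b :=
    fun i => ((H b hb).apply i).clm (RCLike.conjCLE (K := 𝕜)).toContinuousLinearMap
  have hP := ((hconj 1).mul ((H' b hb).apply 0)).sub ((hconj 0).mul ((H' b hb).apply 1))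
  have hP' := hP.congr_deriv (h' := fun t => D.form v w' t - D.form w v' t) (by
    filter_upwards [ae_Ioo_of_ae hv hb, ae_Ioo_of_ae hv' hb] with t ht ht' htb
    rw [form_eq_sum, D.form_conj w v' t |>.symm, form_eq_sum, ht htb, ht' htb]
    simp [velocity]
    ring)
  have := hP'.sub_eq ⟨le_rfl, hb.1⟩ ⟨hb.1, le_rfl⟩
  rw [← this, star_mul_sub_eq_zero D.u₁_ne e e', star_mul_sub_eq_zero D.u₀_ne h0 h0', sub_zero]

/-- Truncated vectors are dense and `K` is continuous, so boundary terms at `T` never have to be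
analysed. -/
theorem isSymmetric_of_isResolvent (hB : D.CondB) (hend : D.EndConvention)
    {K : D.L2R 𝕜 →L[𝕜] D.L2R 𝕜} (hK : IsResolvent (D.operator 𝕜) 0 K) :
    K.toLinearMap.IsSymmetric := by
  intro w w'
  have := leftEnd_neBot D.T_pos
  simp only [ContinuousLinearMap.coe_coe]
  have l1 : Tendsto (fun b => inner 𝕜 (K (trunc D 𝕜 b w)) (trunc D 𝕜 b w')) (leftEnd D.T)
      (𝓝 (inner 𝕜 (K w) w')) :=
    ((K.continuous.tendsto _).comp (tendsto_trunc w)).inner (tendsto_trunc w')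
  have l2 : Tendsto (fun b => inner 𝕜 (trunc D 𝕜 b w) (K (trunc D 𝕜 b w'))) (leftEnd D.T)
      (𝓝 (inner 𝕜 w (K w'))) :=
    (tendsto_trunc w).inner ((K.continuous.tendsto _).comp (tendsto_trunc w'))
  refine tendsto_nhds_unique l1 (l2.congr' ?_)
  filter_upwards [leftEnd_eventually_mem D.T_pos] with b hb
  exact (inner_eq_of_isPair_of_support hB hend hb ((isPair_iff hK _ _).2 rfl)
    ((isPair_iff hK _ _).2 rfl) (trunc_eq_self_iff.1 (trunc_trunc le_rfl w))
    (trunc_eq_self_iff.1 (trunc_trunc le_rfl w'))).symm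

end DiracData

namespace DiracData

variable {D : DiracData} {𝕜 : Type*} [RCLike 𝕜]

/-! ### Eigenvectors -/

variable (D) in
/-- `V` solves `V' = -μ J R V` with `V(0) = u₀`. -/
structure IsSolution (μ : ℝ) (V : ℝ → Fin 2 → ℝ) : Prop where
  init : V 0 = D.u₀
  acDeriv : ∀ b ∈ timeInterval D.T, ACDeriv V (fun s => D.velocity s (μ • V s)) b
  ne_zero : ∀ t, V t ≠ 0

theorem weight_ofRealVec (t : ℝ) (u : Fin 2 → ℝ) :
    D.weight t (ofRealVec 𝕜 u) = ofRealVec 𝕜 (D.weight t u) := by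
  ext i
  simp only [weight_apply, ofRealVec]
  push_cast
  rfl

theorem velocity_ofRealVec (t : ℝ) (u : Fin 2 → ℝ) :
    D.velocity t (ofRealVec 𝕜 u) = ofRealVec 𝕜 (D.velocity t u) := by
  ext i
  rw [velocity, weight_ofRealVec]
  fin_cases i <;> simp [velocity, ofRealVec]

theorem ofRealVec_smul (a : ℝ) (u : Fin 2 → ℝ) :
    ofRealVec 𝕜 (a • u) = (a : 𝕜) • ofRealVec 𝕜 u := by
  ext i
  simp [ofRealVec]

theorem IsSolution.acDeriv_ofRealVec {μ : ℝ} {V : ℝ → Fin 2 → ℝ} (hV : D.IsSolution μ V) {b : ℝ}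
    (hb : b ∈ timeInterval D.T) :
    ACDeriv (fun t => ofRealVec 𝕜 (V t))
      (fun s => D.velocity s ((μ : 𝕜) • ofRealVec 𝕜 (V s))) b := by
  refine ACDeriv.pi_two fun i => ?_
  refine (((hV.acDeriv b hb).apply i).clm (RCLike.ofRealCLM (K := 𝕜))).congr_deriv
    (Eventually.of_forall fun s _ => ?_)
  rw [← ofRealVec_smul, velocity_ofRealVec]
  rfl

theorem IsSolution.eq_smul (hB : D.CondB) {μ : ℝ} {V : ℝ → Fin 2 → ℝ} (hV : D.IsSolution μ V)
    {b : ℝ} (hb : b ∈ timeInterval D.T) {g w : ℝ → Fin 2 → 𝕜}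
    (H : ACDeriv g (fun s => D.velocity s (w s)) b)
    (hw : ∀ᵐ s : ℝ, s ∈ Set.Ioo 0 b → w s = (μ : 𝕜) • g s) {c : 𝕜}
    (hc : g 0 = c • ofRealVec 𝕜 D.u₀) : ∀ t ∈ Set.Icc 0 b, g t = c • ofRealVec 𝕜 (V t) := by
  have H1 : ACDeriv (fun t => c • ofRealVec 𝕜 (V t)) _ b :=
    (hV.acDeriv_ofRealVec (𝕜 := 𝕜) hb).clm
      ((c • ContinuousLinearMap.id 𝕜 (Fin 2 → 𝕜)).restrictScalars ℝ)
  intro t ht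
  refine sub_eq_zero.1 (eq_zero_of_velocity hB hb (μ := (μ : 𝕜)) (H.sub H1)
    (by simp [hc, hV.init]) ?_ t ht)
  filter_upwards [hw] with s hs hsb
  rw [hs hsb]
  change _ - c • D.velocity s ((μ : 𝕜) • ofRealVec 𝕜 (V s)) = _
  rw [← velocity_smul, ← velocity_sub, smul_sub, smul_comm c]

theorem exists_smul_eq {F : ℝ → Fin 2 → 𝕜} {v w : D.L2R 𝕜} {c c' : 𝕜}
    (hv : v =ᵐ[timeMeasure D.T] c • F) (hw : w =ᵐ[timeMeasure D.T] c' • F) (hv0 : v ≠ 0) :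
    ∃ a : 𝕜, w = a • v := by
  have hc : c ≠ 0 := by
    rintro rfl
    refine hv0 (L2R.ext_ae D (hv.trans ?_))
    rw [zero_smul]
    exact (L2R.coeFn_zero D).symm
  refine ⟨c' / c, L2R.ext_ae D (hw.trans (EventuallyEq.trans ?_ (L2R.coeFn_smul D _ _).symm))⟩
  filter_upwards [hv] with t ht
  rw [Pi.smul_apply, Pi.smul_apply, ht, Pi.smul_apply, smul_smul, div_mul_cancel₀ _ hc]

variable {K : D.L2R 𝕜 →L[𝕜] D.L2R 𝕜}

/-- The representative of `K w` starts parallel to `u₀` and solves the equation of `V`, so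
uniqueness applies. Simplicity of the eigenvalues follows from the condition at `0` alone. -/
theorem eigenvector_eq_smul (hB : D.CondB) (hK : IsResolvent (D.operator 𝕜) 0 K) {μ : ℝ}
    {V : ℝ → Fin 2 → ℝ} (hV : D.IsSolution μ V) {w : D.L2R 𝕜} (hw : (μ : 𝕜) • K w = w) :
    ∃ c : 𝕜, w =ᵐ[timeMeasure D.T] c • fun t => ofRealVec 𝕜 (V t) := by
  obtain ⟨g, hg, H, h0, -⟩ := ((isPair_iff hK _ _).2 (rfl : K w = K w)).exists_rep
  obtain ⟨c, hc⟩ := exists_smul_of_wronskian D.u₀_ne h0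
  have hwg : ∀ᵐ t ∂timeMeasure D.T, w t = (μ : 𝕜) • g t := by
    have h1 := L2R.coeFn_smul D (μ : 𝕜) (K w)
    rw [hw] at h1
    filter_upwards [h1, hg] with t h1 h2
    rw [h1, Pi.smul_apply, h2]
  refine ⟨(μ : 𝕜) * c, ?_⟩
  filter_upwards [hwg, D.ae_mem] with t ht htT
  rw [ht, hV.eq_smul hB htT (H t htT) (ae_Ioo_of_ae hwg htT) hc t ⟨htT.1, le_rfl⟩,
    Pi.smul_apply, smul_smul]

/-- Compressing `K` to `[0, b]` amounts to imposing the condition `u₁` at `b`. Up to `b` the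
function `K w` solves the eigenvalue equation; afterwards its image under `τ` vanishes, so it stays
constant and must be parallel to `u₁`. -/
theorem trunc_eigenvector_eq_smul (hB : D.CondB) (hend : D.EndConvention)
    (hK : IsResolvent (D.operator 𝕜) 0 K) {b : ℝ} (hb : b ∈ timeInterval D.T) {μ : ℝ}
    {V : ℝ → Fin 2 → ℝ} (hV : D.IsSolution μ V) {w : D.L2R 𝕜}
    (hw : (μ : 𝕜) • trunc D 𝕜 b (K (trunc D 𝕜 b w)) = w) :
    ∃ c : 𝕜, w =ᵐ[timeMeasure D.T] c • (Set.Iic b).indicator (fun t => ofRealVec 𝕜 (V t)) ∧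
      (w ≠ 0 → V b 0 * D.u₁ 1 = V b 1 * D.u₁ 0) := by
  have hwb : trunc D 𝕜 b w = w := by
    rw [← hw, map_smul, trunc_trunc le_rfl, hw]
  rw [hwb] at hw
  obtain ⟨g, hg, H, h0, h1⟩ := ((isPair_iff hK _ _).2 (rfl : K w = K w)).exists_rep
  obtain ⟨c, hc⟩ := exists_smul_of_wronskian D.u₀_ne h0
  have hsupp := trunc_eq_self_iff.1 hwb
  have hwg : ∀ᵐ t ∂timeMeasure D.T, t ≤ b → w t = (μ : 𝕜) • g t := by
    have h1 := L2R.coeFn_smul D (μ : 𝕜) (trunc D 𝕜 b (K w))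
    rw [hw] at h1
    filter_upwards [h1, hg, coeFn_trunc b (K w)] with t h1 h2 h3 htb
    rw [h1, Pi.smul_apply, h3, Set.indicator_of_mem (show t ∈ Set.Iic b from htb), h2]
  have hgV := hV.eq_smul hB hb (H b hb) (by
    filter_upwards [ae_Ioo_of_ae hwg hb] with t ht htb using ht htb htb.2.le) hc
  have hwV : w =ᵐ[timeMeasure D.T]
      ((μ : 𝕜) * c) • (Set.Iic b).indicator (fun t => ofRealVec 𝕜 (V t)) := by
    filter_upwards [hwg, hsupp, D.ae_mem] with t ht hs htT
    rw [Pi.smul_apply]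
    by_cases htb : t ≤ b
    · rw [ht htb, hgV t ⟨htT.1, htb⟩, Set.indicator_of_mem (show t ∈ Set.Iic b from htb), smul_smul]
    · rw [hs (not_le.1 htb), Set.indicator_of_notMem (by simpa using htb), smul_zero]
  refine ⟨_, hwV, fun hw0 => ?_⟩
  have hc0 : c ≠ 0 := by
    rintro rfl
    refine hw0 (L2R.ext_ae D (hwV.trans ?_))
    rw [mul_zero, zero_smul]
    exact (L2R.coeFn_zero D).symm
  have h2 := (wronskian_u₁_of_support hB hend hb hsupp hg H h1).2
  rw [hgV b ⟨hb.1, le_rfl⟩, wronskian_smul, smul_eq_zero] at h2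
  exact wronskian_ofRealVec.1 (h2.resolve_left hc0)

/-! ### Truncated solutions -/

theorem IsSolution.continuousOn {μ : ℝ} {V : ℝ → Fin 2 → ℝ} (hV : D.IsSolution μ V) {b : ℝ}
    (hb : b ∈ timeInterval D.T) : ContinuousOn (fun t => ofRealVec 𝕜 (V t)) (Set.Icc 0 b) :=
  (hV.acDeriv_ofRealVec hb).continuousOn

theorem indicator_Iic_ae (b : ℝ) (F : ℝ → Fin 2 → 𝕜) :
    (Set.Icc 0 b).indicator F =ᵐ[timeMeasure D.T] (Set.Iic b).indicator F := by
  filter_upwards [D.ae_mem] with t ht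
  by_cases h : t ≤ b
  · rw [Set.indicator_of_mem (show t ∈ Set.Icc 0 b from ⟨ht.1, h⟩),
      Set.indicator_of_mem (show t ∈ Set.Iic b from h)]
  · rw [Set.indicator_of_notMem (fun h' => h h'.2),
      Set.indicator_of_notMem (show t ∉ Set.Iic b from h)]

variable (𝕜) in
theorem IsSolution.exists_cut (hB : D.CondB) {μ : ℝ} {V : ℝ → Fin 2 → ℝ}
    (hV : D.IsSolution μ V) : ∃ X : ℝ → D.L2R 𝕜, ∀ b ∈ timeInterval D.T,
      X b =ᵐ[timeMeasure D.T] (Set.Iic b).indicator (fun t => ofRealVec 𝕜 (V t)) := by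
  have h : ∀ b, ∃ x : D.L2R 𝕜, b ∈ timeInterval D.T →
      x =ᵐ[timeMeasure D.T] (Set.Iic b).indicator (fun t => ofRealVec 𝕜 (V t)) := by
    intro b
    by_cases hb : b ∈ timeInterval D.T
    · exact ⟨L2R.ofFun D _ (aesm_indicator_Icc hb (hV.continuousOn hb))
        (integrable_form_Icc hB hb (hV.continuousOn hb)),
        fun _ => (L2R.coeFn_ofFun _ _ _).trans (indicator_Iic_ae b _)⟩
    · exact ⟨0, fun h => absurd h hb⟩
  choose X hX using h
  exact ⟨X, hX⟩

/-- If the solution is parallel to `u₁` at time `b`, the inverse operator maps its truncation to a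
multiple of the stopped solution. -/
theorem IsSolution.apply_cut (hend : D.EndConvention)
    (hK : IsResolvent (D.operator 𝕜) 0 K) {μ : ℝ} {V : ℝ → Fin 2 → ℝ} (hV : D.IsSolution μ V)
    {b : ℝ} (hb : b ∈ timeInterval D.T) (hVb : V b 0 * D.u₁ 1 = V b 1 * D.u₁ 0) {x : D.L2R 𝕜}
    (hx : x =ᵐ[timeMeasure D.T] (Set.Iic b).indicator (fun t => ofRealVec 𝕜 (V t))) :
    (μ : 𝕜) • K x =ᵐ[timeMeasure D.T] fun t => ofRealVec 𝕜 (V (min t b)) := by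
  set c : Fin 2 → 𝕜 := ofRealVec 𝕜 (V b) with hc
  have hcE : D.ConstEnergy c := by
    obtain ⟨a, ha⟩ := exists_smul_of_wronskian (𝕜 := 𝕜) D.u₁_ne (wronskian_ofRealVec.2 hVb)
    rw [hc, ha]
    exact (constEnergy_ofRealVec (finiteEnergy_u₁ hend)).smul a
  -- The stopped solution. Its constant tail is a multiple of `u₁`, which is what puts it in `L²_R`.
  set y : D.L2R 𝕜 := x + L2R.ofFun D ((Set.Ioi b).indicator fun _ => c)
    (aestronglyMeasurable_const.indicator measurableSet_Ioi)
    (integrable_form_indicator measurableSet_Ioi hcE) with hy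
  have hyV : y =ᵐ[timeMeasure D.T] fun t => ofRealVec 𝕜 (V (min t b)) := by
    refine (L2R.coeFn_add D _ _).trans ?_
    filter_upwards [hx, L2R.coeFn_ofFun (D := D) ((Set.Ioi b).indicator fun _ => c)
      (aestronglyMeasurable_const.indicator measurableSet_Ioi)
      (integrable_form_indicator measurableSet_Ioi hcE)] with t h1 h2
    rw [Pi.add_apply, h1, h2]
    by_cases h : t ≤ b
    · simp [h]
    · simp [h, not_le.1 h, (not_le.1 h).le, hc]
  -- `τ` of the stopped solution is `μ V` before `b` and `0` after it, and the tail satisfies the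
  -- boundary condition at `T`.
  have hpair : D.IsPair y ((μ : 𝕜) • x) := by
    refine IsPair.of_rep (w' := (Set.Iic b).indicator fun t => (μ : 𝕜) • ofRealVec 𝕜 (V t)) hyV
      ((L2R.coeFn_smul D _ _).trans ?_) (fun d hd => ?_) ?_ fun _ => ?_
    · filter_upwards [hx] with t ht
      rw [Pi.smul_apply, ht]
      by_cases h : t ≤ b
      · simp [h]
      · simp [h]
    · have hm : min b d ∈ timeInterval D.T :=
        mem_timeInterval_of_le hb ⟨le_min hb.1 hd.1, min_le_left _ _⟩
      have Hd := hV.acDeriv_ofRealVec (𝕜 := 𝕜) hd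
      have hI : IntervalIntegrable (fun s => D.velocity s
          ((Set.Iic b).indicator (fun t => (μ : 𝕜) • ofRealVec 𝕜 (V t)) s)) volume 0 d := by
        have e : (fun s => D.velocity s
            ((Set.Iic b).indicator (fun t => (μ : 𝕜) • ofRealVec 𝕜 (V t)) s)) =
            (Set.Iic b).indicator
              fun s => D.velocity s ((μ : 𝕜) • ofRealVec 𝕜 (V s)) := by
          ext s : 1
          by_cases h : s ≤ b
          · simp [h]
          · simp [h, velocity_zero]
        rw [e]
        have := Hd.int
        rw [intervalIntegrable_iff] at this ⊢
        exact this.indicator measurableSet_Iic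
      refine ⟨hd.1, hI, fun t ht => ?_⟩
      have ht' : min t b ∈ Set.Icc 0 d := ⟨le_min ht.1 hb.1, (min_le_left _ _).trans ht.2⟩
      have h1 := Hd.eq (min t b) ht'
      have h2 : ∫ s in (0 : ℝ)..min t b, D.velocity s ((μ : 𝕜) • ofRealVec 𝕜 (V s)) =
          ∫ s in (0 : ℝ)..min t b, D.velocity s
            ((Set.Iic b).indicator (fun t => (μ : 𝕜) • ofRealVec 𝕜 (V t)) s) := by
        refine intervalIntegral.integral_congr fun s hs => ?_
        rw [Set.uIcc_of_le ht'.1] at hs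
        have : s ≤ b := hs.2.trans (min_le_right _ _)
        simp [this]
      have h3 : ∫ s in (min t b)..t, D.velocity s
          ((Set.Iic b).indicator (fun t => (μ : 𝕜) • ofRealVec 𝕜 (V t)) s) = 0 := by
        refine intervalIntegral.integral_zero_ae (Eventually.of_forall fun s hs => ?_)
        rw [Set.uIoc_of_le (min_le_left _ _)] at hs
        have : ¬ s ≤ b := by
          intro h
          rcases min_lt_iff.1 hs.1 with h' | h'
          · exact absurd hs.2 (not_le.2 h')
          · exact absurd h (not_le.2 h')
        simp [this, velocity_zero]
      have hi1 := hI.mono_set (c := 0) (d := min t b) (by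
        rw [Set.uIcc_of_le hd.1]; exact Set.uIcc_subset_Icc ⟨le_rfl, hd.1⟩ ht')
      have hi2 := hI.mono_set (c := min t b) (d := t) (by
        rw [Set.uIcc_of_le hd.1]; exact Set.uIcc_subset_Icc ht' ht)
      rw [← intervalIntegral.integral_add_adjacent_intervals hi1 hi2, h3, add_zero, ← h2, h1]
      simp [min_eq_left hb.1]
    · rw [min_eq_left hb.1, hV.init]
      exact wronskian_ofRealVec_self _
    · refine tendsto_const_nhds.congr' ?_
      filter_upwards [leftEnd_eventually_gt hb] with s hs
      rw [min_eq_right hs.le]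
      exact (wronskian_ofRealVec.2 hVb).symm
  rw [← map_smul, (isPair_iff hK _ _).1 hpair]
  exact hyV

/-- If `a ≤ b`, the solution stopped at `b` agrees with `V` on the support of `x`. The other order
follows from the symmetry of `K`. -/
theorem inner_apply_cut (hB : D.CondB) (hend : D.EndConvention)
    (hK : IsResolvent (D.operator 𝕜) 0 K) {μ : ℝ} {V : ℝ → Fin 2 → ℝ} (hV : D.IsSolution μ V)
    {a b : ℝ} (ha : a ∈ timeInterval D.T) (hb : b ∈ timeInterval D.T)
    (hVa : V a 0 * D.u₁ 1 = V a 1 * D.u₁ 0)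
    (hVb : V b 0 * D.u₁ 1 = V b 1 * D.u₁ 0) {x y : D.L2R 𝕜}
    (hx : x =ᵐ[timeMeasure D.T] (Set.Iic a).indicator (fun t => ofRealVec 𝕜 (V t)))
    (hy : y =ᵐ[timeMeasure D.T] (Set.Iic b).indicator (fun t => ofRealVec 𝕜 (V t))) :
    inner 𝕜 x ((μ : 𝕜) • K y) = inner 𝕜 x y := by
  have key : ∀ {a b : ℝ} {x y : D.L2R 𝕜}, a ≤ b → b ∈ timeInterval D.T →
      V b 0 * D.u₁ 1 = V b 1 * D.u₁ 0 →
      x =ᵐ[timeMeasure D.T] (Set.Iic a).indicator (fun t => ofRealVec 𝕜 (V t)) →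
      y =ᵐ[timeMeasure D.T] (Set.Iic b).indicator (fun t => ofRealVec 𝕜 (V t)) →
      inner 𝕜 x ((μ : 𝕜) • K y) = inner 𝕜 x y := by
    intro a b x y hab hb hVb hx hy
    rw [inner_def, inner_def]
    refine integral_congr_ae ?_
    filter_upwards [D.form_congr hx (hV.apply_cut hend hK hb hVb hy), D.form_congr hx hy]
      with t h1 h2
    rw [h1, h2, form_indicator_left, form_indicator_left]
    by_cases h : t ≤ a
    · have h' : t ≤ b := h.trans hab
      simp [h, form, h']
    · have h'' : t ∉ Set.Iic a := h
      rw [Set.indicator_of_notMem h'', Set.indicator_of_notMem h'']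
  rcases le_total a b with hab | hab
  · exact key hab hb hVb hx hy
  · have hs := isSymmetric_of_isResolvent hB hend hK x y
    simp only [ContinuousLinearMap.coe_coe] at hs
    rw [inner_smul_right, ← hs, ← inner_conj_symm, ← RCLike.conj_ofReal (K := 𝕜) μ, ← map_mul,
      ← inner_smul_right, key hab ha hVa hy hx, inner_conj_symm]

theorem trunc_cut {V : ℝ → Fin 2 → ℝ} {a b : ℝ} (hab : a ≤ b) {x y : D.L2R 𝕜}
    (hx : x =ᵐ[timeMeasure D.T] (Set.Iic a).indicator (fun t => ofRealVec 𝕜 (V t)))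
    (hy : y =ᵐ[timeMeasure D.T] (Set.Iic b).indicator (fun t => ofRealVec 𝕜 (V t))) :
    trunc D 𝕜 a y = x := by
  refine L2R.ext_ae D ((coeFn_trunc a y).trans (EventuallyEq.trans ?_ hx.symm))
  filter_upwards [hy] with t ht
  by_cases h : t ≤ a
  · have h' : t ≤ b := h.trans hab
    simp [h, ht, h']
  · simp [h]

theorem cut_ne {V : ℝ → Fin 2 → ℝ} (hV : ∀ t, V t ≠ 0) {a b : ℝ} (ha : 0 ≤ a) (hab : a < b)
    (hb : b ∈ timeInterval D.T) {x y : D.L2R 𝕜}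
    (hx : x =ᵐ[timeMeasure D.T] (Set.Iic a).indicator (fun t => ofRealVec 𝕜 (V t)))
    (hy : y =ᵐ[timeMeasure D.T] (Set.Iic b).indicator (fun t => ofRealVec 𝕜 (V t))) :
    x ≠ y := by
  rintro rfl
  have h1 := ae_Ioo_of_ae (hx.symm.trans hy) hb
  have h2 : ∀ᵐ t : ℝ, t ∉ Set.Ioo a b := by
    filter_upwards [h1] with t ht htab
    have := ht ⟨ha.trans_lt htab.1, htab.2⟩
    rw [Set.indicator_of_notMem (by simpa using htab.1),
      Set.indicator_of_mem (show t ∈ Set.Iic b from htab.2.le)] at this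
    exact ofRealVec_ne_zero (hV t) this.symm
  have h3 : volume (Set.Ioo a b) = 0 := by
    exact measure_eq_zero_iff_ae_notMem.2 h2
  rw [Real.volume_Ioo, ENNReal.ofReal_eq_zero] at h3
  linarith

/-- Truncation at the largest of the earlier times fixes all earlier cuts but shortens the last one.
Times must be positive, as the cut at `0` is the zero vector. -/
theorem linearIndepOn_cut {V : ℝ → Fin 2 → ℝ} (hV : ∀ t, V t ≠ 0) {X : ℝ → D.L2R 𝕜}
    (hX : ∀ b ∈ timeInterval D.T,
      X b =ᵐ[timeMeasure D.T] (Set.Iic b).indicator (fun t => ofRealVec 𝕜 (V t)))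
    (F : Finset ℝ) (hF : ∀ t ∈ F, t ∈ timeInterval D.T ∧ 0 < t) :
    LinearIndepOn 𝕜 X (F : Set ℝ) := by
  induction F using Finset.induction_on_max with
  | empty => simp
  | insert m F hm ih =>
    rw [Finset.coe_insert]
    have hmT := hF m (Finset.mem_insert_self m F)
    refine (ih fun t ht => hF t (Finset.mem_insert_of_mem ht)).insert fun hmem => ?_
    obtain ⟨a, ha0, ham, haF⟩ : ∃ a, 0 ≤ a ∧ a < m ∧ ∀ t ∈ F, t ≤ a := by
      rcases F.eq_empty_or_nonempty with rfl | hne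
      · exact ⟨0, le_rfl, hmT.2, by simp⟩
      · exact ⟨F.max' hne, (hF _ (Finset.mem_insert_of_mem (F.max'_mem hne))).2.le,
          hm _ (F.max'_mem hne), fun t ht => F.le_max' t ht⟩
    have haT : a ∈ timeInterval D.T := mem_timeInterval_of_le hmT.1 ⟨ha0, ham.le⟩
    have hle : Submodule.span 𝕜 (X '' (F : Set ℝ)) ≤
        LinearMap.eqLocus (trunc D 𝕜 a).toLinearMap LinearMap.id := by
      rw [Submodule.span_le]
      rintro _ ⟨t, ht, rfl⟩
      have htT := (hF t (Finset.mem_insert_of_mem ht)).1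
      have e : trunc D 𝕜 t (X t) = X t := trunc_cut le_rfl (hX t htT) (hX t htT)
      change trunc D 𝕜 a (X t) = X t
      rw [← e, trunc_trunc (haF t ht)]
    have h1 : trunc D 𝕜 a (X m) = X m := hle hmem
    rw [trunc_cut ham.le (hX a haT) (hX m hmT.1)] at h1
    exact cut_ne hV ha0 ham hmT.1 (hX a haT) (hX m hmT.1) h1

end DiracData

namespace DiracData

variable {D : DiracData} {𝕜 : Type*} [RCLike 𝕜]

/-! ### Comparison of eigenvalues and crossings -/

/-- The angles of the moving boundary points, together with the solutions that represent them. -/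
theorem exists_angle_solution (hB : D.CondB) :
    ∃ (φ : ℝ → ℝ → ℝ) (V : ℝ → ℝ → Fin 2 → ℝ), ∀ μ,
      IsCarouselAngle D.T D.z (boundaryPoint D.u₀) D.f μ (φ μ) ∧ D.IsSolution μ (V μ) ∧
        ∀ t, cayleyBoundary (boundaryPoint (V μ t)) = Complex.exp (φ μ t * Complex.I) := by
  choose φ hφ using exists_carouselAngle hB (boundaryPoint D.u₀)
  choose V h0 hV h1 using fun μ => exists_solution hB (hφ μ)
  exact ⟨φ, V, fun μ => ⟨hφ μ, ⟨h0 μ, hV μ, fun t => (h1 μ t).1⟩, fun t => (h1 μ t).2⟩⟩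

theorem exp_angle_eq_iff {V : Fin 2 → ℝ} (hV : V ≠ 0) {x : ℝ}
    (h : cayleyBoundary (boundaryPoint V) = Complex.exp (x * Complex.I)) :
    Complex.exp (x * Complex.I) = cayleyBoundary (boundaryPoint D.u₁) ↔
      V 0 * D.u₁ 1 = V 1 * D.u₁ 0 := by
  rw [← h, cayleyBoundary_eq_iff hV D.u₁_ne]

theorem mem_crossingTimes_iff (hB : D.CondB) {lam : ℝ} {φ : ℝ → ℝ}
    (hφ : IsCarouselAngle D.T D.z (boundaryPoint D.u₀) D.f lam φ) {t : ℝ} :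
    t ∈ crossingTimes D.T D.z (boundaryPoint D.u₀) (boundaryPoint D.u₁) D.f lam ↔
      t ∈ timeInterval D.T ∧
        Complex.exp (φ t * Complex.I) = cayleyBoundary (boundaryPoint D.u₁) := by
  refine ⟨fun ⟨ht, ψ, hψ, h⟩ => ⟨ht, ?_⟩, fun ⟨ht, h⟩ => ⟨ht, φ, hφ, h⟩⟩
  rwa [← carouselAngle_unique hB hφ hψ ht]

theorem NonParallel.ne (hpar : D.NonParallel) : D.u₀ 0 * D.u₁ 1 ≠ D.u₀ 1 * D.u₁ 0 := by
  intro h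
  rw [NonParallel, LinearIndependent.pair_iff] at hpar
  rcases ne_zero_or_ne_zero D.u₁_ne with h0 | h0
  · have := (hpar (D.u₁ 0) (-D.u₀ 0) (by
      ext i
      fin_cases i
      · simp; ring
      · simp; linarith)).1
    exact h0 this
  · have := (hpar (D.u₁ 1) (-D.u₀ 1) (by
      ext i
      fin_cases i
      · simp; linarith
      · simp; ring)).1
    exact h0 this

variable {K : D.L2R 𝕜 →L[𝕜] D.L2R 𝕜}

theorem exists_smul_of_eigenvectors (hB : D.CondB) (hK : IsResolvent (D.operator 𝕜) 0 K) {μ : ℝ}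
    {v w : D.L2R 𝕜} (hv0 : v ≠ 0) (hv : (μ : 𝕜) • K v = v) (hw : (μ : 𝕜) • K w = w) :
    ∃ a : 𝕜, w = a • v := by
  obtain ⟨φ, V, h⟩ := exists_angle_solution hB
  obtain ⟨c, hc⟩ := eigenvector_eq_smul hB hK (h μ).2.1 hv
  obtain ⟨c', hc'⟩ := eigenvector_eq_smul hB hK (h μ).2.1 hw
  exact exists_smul_eq hc hc' hv0

theorem exists_smul_of_trunc_eigenvectors (hB : D.CondB) (hend : D.EndConvention)
    (hK : IsResolvent (D.operator 𝕜) 0 K) {b : ℝ} (hb : b ∈ timeInterval D.T) {μ : ℝ}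
    {v w : D.L2R 𝕜} (hv0 : v ≠ 0) (hv : (μ : 𝕜) • trunc D 𝕜 b (K (trunc D 𝕜 b v)) = v)
    (hw : (μ : 𝕜) • trunc D 𝕜 b (K (trunc D 𝕜 b w)) = w) :
    ∃ a : 𝕜, w = a • v := by
  obtain ⟨φ, V, h⟩ := exists_angle_solution hB
  obtain ⟨c, hc, -⟩ := trunc_eigenvector_eq_smul hB hend hK hb (h μ).2.1 hv
  obtain ⟨c', hc', -⟩ := trunc_eigenvector_eq_smul hB hend hK hb (h μ).2.1 hw
  exact exists_smul_eq hc hc' hv0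

/-- Used with `σ = ±1` to treat both signs of `lam` at once: an eigenvalue `κ > 0` of `σ K` belongs
to `μ = σ κ⁻¹`. -/
theorem _root_.smul_eq_of_eigenvector {H : Type*} [NormedAddCommGroup H] [InnerProductSpace 𝕜 H]
    {σ κ : ℝ} (hκ : κ ≠ 0) {x v : H}
    (h : (σ : 𝕜) • x = (κ : 𝕜) • v) : ((σ * κ⁻¹ : ℝ) : 𝕜) • x = v := by
  have hκ' : (κ : 𝕜) ≠ 0 := RCLike.ofReal_ne_zero.2 hκ
  rw [RCLike.ofReal_mul, mul_comm, mul_smul, h, smul_smul, RCLike.ofReal_inv, inv_mul_cancel₀ hκ',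
    one_smul]

theorem isSymmetric_real_smul {H : Type*} [NormedAddCommGroup H] [InnerProductSpace 𝕜 H]
    {S : H →L[𝕜] H} (hS : S.toLinearMap.IsSymmetric) (σ : ℝ) :
    ((σ : 𝕜) • S).toLinearMap.IsSymmetric := by
  intro x y
  have := hS x y
  simp only [ContinuousLinearMap.coe_coe] at this
  simp [inner_smul_left, inner_smul_right, this]

theorem _root_.IsCompactOperator.real_smul {H : Type*} [NormedAddCommGroup H]
    [InnerProductSpace 𝕜 H] {K : H →L[𝕜] H} (hK : IsCompactOperator K) (σ : ℝ) :
    IsCompactOperator ((σ : 𝕜) • K) :=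
  hK.smul (σ : 𝕜)

/-- There are at least as many eigenvalues between `0` and `lam` as crossings for `lam`. -/
theorem exists_eigenvalues_of_crossings [CompleteSpace (D.L2R 𝕜)] (hB : D.CondB)
    (hend : D.EndConvention)
    (hK : IsResolvent (D.operator 𝕜) 0 K) (hKc : IsCompactOperator K) {σ lam : ℝ}
    (hσ : σ * σ = 1) (hlam : 0 < σ * lam) {V : ℝ → Fin 2 → ℝ} (hV : D.IsSolution lam V)
    {F : Finset ℝ} (hF : ∀ t ∈ F, t ∈ timeInterval D.T ∧ 0 < t ∧ V t 0 * D.u₁ 1 = V t 1 * D.u₁ 0) :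
    ∃ s : Finset ℝ, s.card = F.card ∧
      ∀ μ ∈ s, (0 < σ * μ ∧ σ * μ ≤ σ * lam) ∧ ∃ v : D.L2R 𝕜, v ≠ 0 ∧ (μ : 𝕜) • K v = v := by
  obtain ⟨X, hX⟩ := hV.exists_cut 𝕜 hB
  have hsym := isSymmetric_of_isResolvent hB hend hK
  have hlin : LinearIndependent 𝕜 fun t : F => X t :=
    linearIndepOn_cut hV.ne_zero hX F fun t ht => ⟨(hF t ht).1, (hF t ht).2.1⟩
  set E := Submodule.span 𝕜 (Set.range fun t : F => X t) with hE
  have : FiniteDimensional 𝕜 E := FiniteDimensional.span_of_finite 𝕜 (Set.finite_range _)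
  -- On the span of the cuts the form of `σ K` is exactly `(σ lam)⁻¹ ‖x‖²`, so the lower bound
  -- required below holds with equality.
  have hform : ∀ x ∈ E, ∀ y ∈ E, inner 𝕜 x ((lam : 𝕜) • K y) = inner 𝕜 x y := by
    intro x hx y hy
    induction hx, hy using Submodule.span_induction₂ with
    | mem_mem x y hx hy =>
      obtain ⟨⟨s, hs⟩, rfl⟩ := hx
      obtain ⟨⟨t, ht⟩, rfl⟩ := hy
      exact inner_apply_cut hB hend hK hV (hF s hs).1 (hF t ht).1 (hF s hs).2.2 (hF t ht).2.2
        (hX s (hF s hs).1) (hX t (hF t ht).1)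
    | zero_left y hy => simp
    | zero_right x hx => simp
    | add_left x y z _ _ _ h1 h2 => rw [inner_add_left, inner_add_left, h1, h2]
    | add_right x y z _ _ _ h1 h2 =>
      rw [map_add, smul_add, inner_add_right, inner_add_right, h1, h2]
    | smul_left r x y _ _ h => rw [inner_smul_left, inner_smul_left, h]
    | smul_right r x y _ _ h =>
      rw [map_smul, smul_comm, inner_smul_right _ _ r, h, inner_smul_right]
  have hlam0 : lam ≠ 0 := by
    rintro rfl
    simp at hlam
  obtain ⟨s, hs, hs'⟩ := exists_eigenvalues_ge (T := (σ : 𝕜) • K) (hKc.real_smul σ)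
    (isSymmetric_real_smul hsym σ) (inv_pos.2 hlam) E
    (fun x hx => by
      have h1 := hform x hx x hx
      rw [inner_smul_right, inner_self_eq_norm_sq_to_K, ← inner_conj_symm] at h1
      have h2 := congrArg RCLike.re h1
      rw [RCLike.re_ofReal_mul, RCLike.conj_re] at h2
      have h3 : RCLike.re ((‖x‖ : 𝕜) ^ 2) = ‖x‖ ^ 2 := by
        rw [← RCLike.ofReal_pow, RCLike.ofReal_re]
      rw [h3] at h2
      rw [_root_.smul_apply, inner_smul_left, RCLike.conj_ofReal,
        RCLike.re_ofReal_mul, ← h2, ← mul_assoc, mul_inv, mul_assoc σ⁻¹, inv_mul_cancel₀ hlam0,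
        mul_one, ← eq_inv_of_mul_eq_one_left hσ])
    (fun κ hκ v w hv0 hv hw => exists_smul_of_eigenvectors hB hK hv0
      (smul_eq_of_eigenvector ((inv_pos.2 hlam).trans_le hκ).ne' hv)
      (smul_eq_of_eigenvector ((inv_pos.2 hlam).trans_le hκ).ne' hw))
  have hσ0 : σ ≠ 0 := left_ne_zero_of_mul_eq_one hσ
  refine ⟨s.image fun κ => σ * κ⁻¹, ?_, fun μ hμ => ?_⟩
  · rw [Finset.card_image_of_injective _ fun x y h => inv_injective (mul_left_cancel₀ hσ0 h), hs,
      hE, finrank_span_eq_card hlin, Fintype.card_coe]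
  · obtain ⟨κ, hκ, rfl⟩ := Finset.mem_image.1 hμ
    obtain ⟨h1, v, hv0, hv⟩ := hs' κ hκ
    have hκ0 := (inv_pos.2 hlam).trans_le h1
    rw [← mul_assoc, hσ, one_mul]
    exact ⟨⟨inv_pos.2 hκ0, inv_le_of_inv_le₀ hlam h1⟩, v, hv0,
      smul_eq_of_eigenvector hκ0.ne' hv⟩

/-- Eigenvalues strictly between `0` and `lam` are approximated by as many values for which the
moving boundary point is at `η₁` at a common time. -/
theorem exists_time_of_eigenvalues [CompleteSpace (D.L2R 𝕜)] (hB : D.CondB)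
    (hend : D.EndConvention)
    (hK : IsResolvent (D.operator 𝕜) 0 K) (hKc : IsCompactOperator K) {σ lam : ℝ}
    (hσ : σ * σ = 1) (hlam : 0 < σ * lam) {V : ℝ → ℝ → Fin 2 → ℝ}
    (hV : ∀ μ, D.IsSolution μ (V μ)) {s : Finset ℝ}
    (hs : ∀ μ ∈ s, (0 < σ * μ ∧ σ * μ < σ * lam) ∧
      ∃ v : D.L2R 𝕜, v ≠ 0 ∧ (μ : 𝕜) • K v = v) :
    ∃ b ∈ timeInterval D.T, ∃ s' : Finset ℝ, s'.card = s.card ∧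
      ∀ μ ∈ s', (0 < σ * μ ∧ σ * μ < σ * lam) ∧ V μ b 0 * D.u₁ 1 = V μ b 1 * D.u₁ 0 := by
  have hσ0 : σ ≠ 0 := left_ne_zero_of_mul_eq_one hσ
  have hsym := isSymmetric_of_isResolvent hB hend hK
  have := leftEnd_neBot D.T_pos
  obtain ⟨f, hf, hfT⟩ := exists_orthonormal_eigenvectors (T := (σ : 𝕜) • K)
    (isSymmetric_real_smul hsym σ) (κ := fun μ : s => (σ * (μ : ℝ))⁻¹)
    (fun x y h => Subtype.ext (mul_left_cancel₀ hσ0 (inv_injective h)))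
    (fun μ => by
      obtain ⟨h1, v, hv0, hv⟩ := hs μ μ.2
      refine ⟨v, hv0, ?_⟩
      have hμ : ((μ : ℝ) : 𝕜) ≠ 0 :=
        RCLike.ofReal_ne_zero.2 (right_ne_zero_of_mul h1.1.ne')
      have h2 : σ = σ⁻¹ := eq_inv_of_mul_eq_one_left hσ
      conv_rhs => rw [← hv]
      rw [_root_.smul_apply, smul_smul, mul_inv, ← h2, RCLike.ofReal_mul,
        RCLike.ofReal_inv, mul_assoc, inv_mul_cancel₀ hμ, mul_one])
  -- There is room below the finitely many eigenvalues `(σ μ)⁻¹`: the drop from `d` to `c` pays for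
  -- the approximation by `S b`, and `c` above `(σ lam)⁻¹` keeps the new values strictly short of
  -- `lam`.
  obtain ⟨d, hd, hd0⟩ : ∃ d, (∀ μ : s, d ≤ (σ * (μ : ℝ))⁻¹) ∧ (σ * lam)⁻¹ < d := by
    have h1 : ∀ᶠ d in 𝓝[>] (σ * lam)⁻¹, ∀ μ : s, d ≤ (σ * (μ : ℝ))⁻¹ := by
      refine eventually_all.2 fun μ => ?_
      have hμ := (hs μ μ.2).1
      have := eventually_lt_nhds (inv_strictAnti₀ hμ.1 hμ.2)
      exact (this.filter_mono nhdsWithin_le_nhds).mono fun _ h => h.le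
    exact (h1.and self_mem_nhdsWithin).exists
  obtain ⟨c, hc0, hcd⟩ := exists_between hd0
  have hcpos : 0 < c := (inv_pos.2 hlam).trans hc0
  set S : ℝ → D.L2R 𝕜 →L[𝕜] D.L2R 𝕜 := fun b =>
    (σ : 𝕜) • (trunc D 𝕜 b ∘L K ∘L trunc D 𝕜 b) with hS
  have hSa : ∀ b x, S b x = (σ : 𝕜) • trunc D 𝕜 b (K (trunc D 𝕜 b x)) := fun b x => rfl
  have hlim : ∀ x, Tendsto (fun b => S b x) (leftEnd D.T) (𝓝 (((σ : 𝕜) • K) x)) := by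
    intro x
    refine Tendsto.const_smul ?_ (σ : 𝕜)
    have h1 : Tendsto (fun b => trunc D 𝕜 b (K (trunc D 𝕜 b x) - K x)) (leftEnd D.T) (𝓝 0) := by
      refine squeeze_zero_norm (fun b => norm_trunc_le b _) ?_
      rw [← tendsto_iff_norm_sub_tendsto_zero]
      exact (K.continuous.tendsto _).comp (tendsto_trunc x)
    simpa using h1.add (tendsto_trunc (K x))
  obtain ⟨b, hb, hbT⟩ := ((eventually_form_ge hf hfT hcd hd hlim).and
    (leftEnd_eventually_mem D.T_pos)).exists
  have : FiniteDimensional 𝕜 (Submodule.span 𝕜 (Set.range f)) :=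
    FiniteDimensional.span_of_finite 𝕜 (Set.finite_range _)
  obtain ⟨r, hr, hr'⟩ := exists_eigenvalues_ge (T := S b)
    (((hKc.comp_clm (trunc D 𝕜 b)).clm_comp (trunc D 𝕜 b)).real_smul 
      (K := trunc D 𝕜 b ∘L K ∘L trunc D 𝕜 b) σ)
    (isSymmetric_real_smul (fun x y => by
      have := hsym (trunc D 𝕜 b x) (trunc D 𝕜 b y)
      simp only [ContinuousLinearMap.coe_coe] at this
      simp only [ContinuousLinearMap.coe_coe, ContinuousLinearMap.comp_apply]
      rw [inner_trunc_left, this, inner_trunc_left]) σ)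
    hcpos (Submodule.span 𝕜 (Set.range f)) hb
    (fun κ hκ v w hv0 hv hw => exists_smul_of_trunc_eigenvectors hB hend hK hbT hv0
      (smul_eq_of_eigenvector (hcpos.trans_le hκ).ne' hv)
      (smul_eq_of_eigenvector (hcpos.trans_le hκ).ne' hw))
  refine ⟨b, hbT, r.image fun κ => σ * κ⁻¹, ?_, fun μ hμ => ?_⟩
  · rw [Finset.card_image_of_injective _ fun x y h => inv_injective (mul_left_cancel₀ hσ0 h), hr,
      finrank_span_eq_card hf.linearIndependent, Fintype.card_coe]
  · obtain ⟨κ, hκ, rfl⟩ := Finset.mem_image.1 hμ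
    obtain ⟨h1, v, hv0, hv⟩ := hr' κ hκ
    have hκ0 := hcpos.trans_le h1
    obtain ⟨-, -, h2⟩ := trunc_eigenvector_eq_smul hB hend hK hbT (hV (σ * κ⁻¹))
      (smul_eq_of_eigenvector hκ0.ne' hv)
    refine ⟨?_, h2 hv0⟩
    rw [← mul_assoc, hσ, one_mul]
    exact ⟨inv_pos.2 hκ0, inv_lt_of_inv_lt₀ hlam (hc0.trans_le h1)⟩

/-- Values between `0` and `lam` for which the moving boundary point is at `η₁` at a common time
give crossings for `lam`. -/
theorem exists_crossings (hB : D.CondB) (hpar : D.NonParallel) {σ lam : ℝ}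
    {φ : ℝ → ℝ → ℝ} (hφ : ∀ μ, IsCarouselAngle D.T D.z (boundaryPoint D.u₀) D.f μ (φ μ))
    {b : ℝ} (hb : b ∈ timeInterval D.T) {s : Finset ℝ} (hσ : σ * σ = 1)
    (hs : ∀ μ ∈ s, (0 < σ * μ ∧ σ * μ < σ * lam) ∧
      Complex.exp (φ μ b * Complex.I) = cayleyBoundary (boundaryPoint D.u₁)) :
    ∃ F : Finset ℝ, F.card = s.card ∧ ∀ t ∈ F,
      t ∈ crossingTimes D.T D.z (boundaryPoint D.u₀) (boundaryPoint D.u₁) D.f lam := by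
  classical
  have hb0 : s.Nonempty → 0 < b := by
    rintro ⟨μ, hμ⟩
    refine hb.1.lt_of_ne fun h => hpar.ne ?_
    have h1 := (hs μ hμ).2
    rw [← h, (hφ μ).initial, exp_arg_cayleyBoundary D.u₀_ne] at h1
    exact (cayleyBoundary_eq_iff D.u₀_ne D.u₁_ne).1 h1
  -- For the parameter `0` the point rests, so the values `φ μ b` with `μ` between `0` and `lam` lie
  -- between the start `φ lam 0` and the end `φ lam b` of one path.
  have h0 : φ 0 b = Complex.arg (cayleyBoundary (boundaryPoint D.u₀)) := by
    rw [(hφ 0).evolution b hb, (hφ 0).initial]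
    simp [angularVelocity]
  have hmono : 0 < b → StrictMono fun μ => φ μ b := fun hb0 l m hlm =>
    carouselAngle_lt hB hlm (hφ l) (hφ m) hb hb0
  have hcont : ContinuousOn (φ lam) (Set.uIcc 0 b) := by
    rw [Set.uIcc_of_le hb.1]
    exact (hφ lam).continuousOn.mono fun t ht => mem_timeInterval_of_le hb ht
  have hex : ∀ μ ∈ s, ∃ t, t ∈ Set.Icc 0 b ∧ φ lam t = φ μ b := by
    intro μ hμ
    have hm := (hmono (hb0 ⟨μ, hμ⟩)).monotone
    have h1 := (hs μ hμ).1
    have hmem : φ μ b ∈ Set.uIcc (φ lam 0) (φ lam b) := by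
      rw [(hφ lam).initial, ← h0, Set.mem_uIcc]
      rcases mul_self_eq_one_iff.1 hσ with rfl | rfl
      · exact Or.inl ⟨hm (by linarith), hm (by linarith)⟩
      · exact Or.inr ⟨hm (by linarith), hm (by linarith)⟩
    obtain ⟨t, ht, h⟩ := intermediate_value_uIcc hcont hmem
    rw [Set.uIcc_of_le hb.1] at ht
    exact ⟨t, ht, h⟩
  choose! τ hτ hτφ using hex
  refine ⟨s.image τ, Finset.card_image_of_injOn fun x hx y hy hxy => ?_, fun t ht => ?_⟩
  · refine (hmono (hb0 ⟨x, hx⟩)).injective ?_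
    rw [← hτφ x hx, ← hτφ y hy, hxy]
  · obtain ⟨μ, hμ, rfl⟩ := Finset.mem_image.1 ht
    rw [mem_crossingTimes_iff hB (hφ lam), hτφ μ hμ]
    exact ⟨mem_timeInterval_of_le hb (hτ μ hμ), (hs μ hμ).2⟩

/-- The set of the real numbers `μ` such that `μ⁻¹` is an eigenvalue of `K`. -/
noncomputable def _root_.reciprocalEigenvalues {H : Type*} [NormedAddCommGroup H] [InnerProductSpace 𝕜 H]
    (K : H →L[𝕜] H) : Set ℝ := {μ | ∃ v, v ≠ 0 ∧ (μ : 𝕜) • K v = v}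

theorem _root_.reciprocalEigenvalues_finite {H : Type*} [NormedAddCommGroup H]
    [InnerProductSpace 𝕜 H] {K : H →L[𝕜] H} (hKc : IsCompactOperator K)
    (hsym : K.toLinearMap.IsSymmetric) (a b : ℝ) :
    (reciprocalEigenvalues K ∩ Set.Icc a b).Finite := by
  -- Reciprocals of points of `[a, b]` are at least this large in modulus; the summand `1` covers `a
  -- = b = 0`.
  have hc : 0 < (max |a| |b| + 1)⁻¹ := by positivity
  refine Set.Finite.of_finite_image ((finite_eigenvalues hKc hsym hc).subset ?_)
    (f := fun x => x⁻¹) inv_injective.injOn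
  rintro _ ⟨μ, ⟨⟨v, hv0, hv⟩, hμ⟩, rfl⟩
  have hμ0 : μ ≠ 0 := by
    rintro rfl
    simp at hv
    exact hv0 hv.symm
  refine ⟨?_, v, hv0, ?_⟩
  · rw [abs_inv]
    refine inv_anti₀ (abs_pos.2 hμ0) ?_
    have := abs_le_max_abs_abs hμ.1 hμ.2
    linarith
  · conv_rhs => rw [← hv]
    rw [smul_smul, ← RCLike.ofReal_mul, inv_mul_cancel₀ hμ0, RCLike.ofReal_one, one_smul]

/-- The bounds differ only in whether `lam` itself is counted. This ambiguity is what passing to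
right limits removes. -/
theorem crossingTimes_bounds [CompleteSpace (D.L2R 𝕜)] (hB : D.CondB) (hend : D.EndConvention)
    (hpar : D.NonParallel) (hK : IsResolvent (D.operator 𝕜) 0 K) (hKc : IsCompactOperator K)
    {σ lam : ℝ} (hσ : σ * σ = 1) (hlam : 0 < σ * lam)
    (hfin : (reciprocalEigenvalues K ∩ {μ | 0 < σ * μ ∧ σ * μ ≤ σ * lam}).Finite) :
    let C := crossingTimes D.T D.z (boundaryPoint D.u₀) (boundaryPoint D.u₁) D.f lam
    C.Finite ∧
      C.ncard ≤ (reciprocalEigenvalues K ∩ {μ | 0 < σ * μ ∧ σ * μ ≤ σ * lam}).ncard ∧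
      (reciprocalEigenvalues K ∩ {μ | 0 < σ * μ ∧ σ * μ < σ * lam}).ncard ≤ C.ncard := by
  intro C
  obtain ⟨φ, V, h⟩ := exists_angle_solution hB
  have hup : ∀ F : Finset ℝ, (F : Set ℝ) ⊆ C →
      F.card ≤ (reciprocalEigenvalues K ∩ {μ | 0 < σ * μ ∧ σ * μ ≤ σ * lam}).ncard := by
    intro F hF
    obtain ⟨s, hs, hs'⟩ := exists_eigenvalues_of_crossings hB hend hK hKc hσ hlam (h lam).2.1
      (F := F) (fun t ht => by
        obtain ⟨htT, hte⟩ := (mem_crossingTimes_iff hB (h lam).1).1 (hF ht)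
        refine ⟨htT, htT.1.lt_of_ne ?_,
          (exp_angle_eq_iff ((h lam).2.1.ne_zero t) ((h lam).2.2 t)).1 hte⟩
        rintro rfl
        rw [(h lam).1.initial, exp_arg_cayleyBoundary D.u₀_ne] at hte
        exact hpar.ne ((cayleyBoundary_eq_iff D.u₀_ne D.u₁_ne).1 hte))
    rw [← hs, ← Set.ncard_coe_finset]
    exact Set.ncard_le_ncard (fun μ hμ => ⟨(hs' μ hμ).2, (hs' μ hμ).1⟩) hfin
  have hCfin : C.Finite := by
    by_contra hinf
    obtain ⟨F, hF, hcard⟩ := Set.Infinite.exists_subset_card_eq hinf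
      ((reciprocalEigenvalues K ∩ {μ | 0 < σ * μ ∧ σ * μ ≤ σ * lam}).ncard + 1)
    have := hup F hF
    omega
  refine ⟨hCfin, ?_, ?_⟩
  · rw [Set.ncard_eq_toFinset_card C hCfin]
    exact hup _ (by simp)
  · have hfin' : (reciprocalEigenvalues K ∩ {μ | 0 < σ * μ ∧ σ * μ < σ * lam}).Finite :=
      hfin.subset fun μ hμ => ⟨hμ.1, hμ.2.1, hμ.2.2.le⟩
    obtain ⟨b, hb, s', hs', hs''⟩ := exists_time_of_eigenvalues hB hend hK hKc hσ hlam
      (fun μ => (h μ).2.1) (s := hfin'.toFinset) (fun μ hμ => by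
        obtain ⟨h1, h2⟩ := hfin'.mem_toFinset.1 hμ
        exact ⟨h2, h1⟩)
    obtain ⟨F, hF, hF'⟩ := exists_crossings hB hpar (fun μ => (h μ).1) hb hσ
      (fun μ hμ => ⟨(hs'' μ hμ).1,
        (exp_angle_eq_iff ((h μ).2.1.ne_zero b) ((h μ).2.2 b)).2 (hs'' μ hμ).2⟩)
    rw [Set.ncard_eq_toFinset_card _ hfin', ← hs', ← hF, ← Set.ncard_coe_finset]
    exact Set.ncard_le_ncard hF' hCfin

end DiracData

/-! ### Counting functions of locally finite sets -/

section Counting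

variable {S : Set ℝ}

theorem countingFunction_sub (hS : ∀ a b : ℝ, (S ∩ Set.Icc a b).Finite) {a b : ℝ} (hab : a ≤ b) :
    countingFunction S b - countingFunction S a = ((S ∩ Set.Ioc a b).ncard : ℤ) := by
  have hf : ∀ (A : Set ℝ) (c d : ℝ), A ⊆ Set.Icc c d → (S ∩ A).Finite := fun A c d h =>
    (hS c d).subset (Set.inter_subset_inter_right _ h)
  have hu : ∀ A B C : Set ℝ, ∀ c d, A ∪ B = C → Disjoint A B → C ⊆ Set.Icc c d →
      ((S ∩ C).ncard : ℤ) = (S ∩ A).ncard + (S ∩ B).ncard := by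
    rintro A B C c d rfl hd hC
    rw [Set.inter_union_distrib_left, Set.ncard_union_eq
      (hd.mono Set.inter_subset_right Set.inter_subset_right)
      (hf A c d (Set.subset_union_left.trans hC)) (hf B c d (Set.subset_union_right.trans hC))]
    push_cast
    rfl
  unfold countingFunction
  rcases le_or_gt 0 a with ha | ha
  · rw [if_pos ha, if_pos (ha.trans hab), hu (Set.Icc 0 a) (Set.Ioc a b) (Set.Icc 0 b) 0 b
      (Set.Icc_union_Ioc_eq_Icc ha hab)
      (Set.disjoint_left.2 fun x h1 h2 => absurd h1.2 (not_le.2 h2.1)) subset_rfl]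
    ring
  · rw [if_neg (not_le.2 ha)]
    rcases le_or_gt 0 b with hb | hb
    · rw [if_pos hb, hu (Set.Ioo a 0) (Set.Icc 0 b) (Set.Ioc a b) a b
        (Set.Ioo_union_Icc_eq_Ioc ha hb)
        (Set.disjoint_left.2 fun x h1 h2 => absurd h1.2 (not_lt.2 h2.1)) Set.Ioc_subset_Icc_self]
      ring
    · rw [if_neg (not_le.2 hb), hu (Set.Ioc a b) (Set.Ioo b 0) (Set.Ioo a 0) a 0
        (Set.Ioc_union_Ioo_eq_Ioo hab hb)
        (Set.disjoint_left.2 fun x h1 h2 => absurd h1.2 (not_le.2 h2.1)) Set.Ioo_subset_Icc_self]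
      ring

/-- The counting function jumps from the left exactly at the points of `S`, so it determines `S`. -/
theorem mem_iff_countingFunction (hS : ∀ a b : ℝ, (S ∩ Set.Icc a b).Finite) (x : ℝ) :
    x ∈ S ↔ ∀ a < x, countingFunction S a ≠ countingFunction S x := by
  have hf : ∀ a, (S ∩ Set.Ioc a x).Finite := fun a =>
    (hS a x).subset (Set.inter_subset_inter_right _ Set.Ioc_subset_Icc_self)
  constructor
  · intro hx a ha h
    have h1 := countingFunction_sub hS ha.le
    rw [h, sub_self, eq_comm, Nat.cast_eq_zero, Set.ncard_eq_zero (hf a)] at h1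
    exact (Set.eq_empty_iff_forall_notMem.1 h1 x) ⟨hx, ha, le_rfl⟩
  · intro h
    by_contra hx
    have hc : (S ∩ Set.Icc (x - 1) x)ᶜ ∈ 𝓝 x :=
      (hS (x - 1) x).isClosed.isOpen_compl.mem_nhds fun h' => hx h'.1
    obtain ⟨l, hl, hlS⟩ := exists_Ioc_subset_of_mem_nhds hc (exists_lt x)
    have ha : max l (x - 1) < x := max_lt hl (by linarith)
    refine h _ ha ?_
    have h1 := countingFunction_sub hS ha.le
    have h2 : S ∩ Set.Ioc (max l (x - 1)) x = ∅ := by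
      refine Set.eq_empty_iff_forall_notMem.2 fun y hy => ?_
      exact hlS ⟨(le_max_left _ _).trans_lt hy.2.1, hy.2.2⟩
        ⟨hy.1, ((le_max_right _ _).trans_lt hy.2.1).le, hy.2.2⟩
    rw [h2, Set.ncard_empty, Nat.cast_zero, sub_eq_zero] at h1
    exact h1.symm

theorem eq_of_countingFunction_eq {S' : Set ℝ} (hS : ∀ a b : ℝ, (S ∩ Set.Icc a b).Finite)
    (hS' : ∀ a b : ℝ, (S' ∩ Set.Icc a b).Finite)
    (h : countingFunction S = countingFunction S') : S = S' := by
  ext x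
  rw [mem_iff_countingFunction hS, mem_iff_countingFunction hS', h]

theorem eventually_right_inter_Ioc_eq_empty (hS : ∀ a b : ℝ, (S ∩ Set.Icc a b).Finite) (x : ℝ) :
    ∀ᶠ y in 𝓝[>] x, S ∩ Set.Ioc x y = ∅ := by
  have hc : ((S ∩ Set.Icc x (x + 1)) \ {x})ᶜ ∈ 𝓝 x :=
    ((hS x (x + 1)).subset Set.sdiff_subset).isClosed.isOpen_compl.mem_nhds fun h' => h'.2 rfl
  obtain ⟨u, hu, huS⟩ := exists_Ico_subset_of_mem_nhds hc (exists_gt x)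
  filter_upwards [Ioo_mem_nhdsGT (lt_min hu (lt_add_one x))] with y hy
  refine Set.eq_empty_iff_forall_notMem.2 fun w hw => ?_
  refine huS ⟨hw.2.1.le, hw.2.2.trans_lt (hy.2.trans_le (min_le_left _ _))⟩
    ⟨⟨hw.1, hw.2.1.le, hw.2.2.trans (hy.2.le.trans (min_le_right _ _))⟩, hw.2.1.ne'⟩

end Counting

/-! ### Right limits of the crossing numbers -/

namespace DiracData

variable {D : DiracData} {𝕜 : Type*} [RCLike 𝕜] {K : D.L2R 𝕜 →L[𝕜] D.L2R 𝕜}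

theorem zero_notMem_reciprocalEigenvalues {H : Type*} [NormedAddCommGroup H]
    [InnerProductSpace 𝕜 H] {K : H →L[𝕜] H} : (0 : ℝ) ∉ reciprocalEigenvalues K := by
  rintro ⟨v, hv0, hv⟩
  simp at hv
  exact hv0 hv.symm

theorem crossingTimes_zero (hpar : D.NonParallel) :
    crossingTimes D.T D.z (boundaryPoint D.u₀) (boundaryPoint D.u₁) D.f 0 = ∅ := by
  refine Set.eq_empty_iff_forall_notMem.2 ?_
  rintro t ⟨ht, φ, hφ, h⟩
  have h0 : φ t = φ 0 := by
    rw [hφ.evolution t ht]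
    simp [angularVelocity]
  rw [h0, hφ.initial, exp_arg_cayleyBoundary D.u₀_ne] at h
  exact hpar.ne ((cayleyBoundary_eq_iff D.u₀_ne D.u₁_ne).1 h)

/-- For `y` slightly to the right of `x` there are no eigenvalues in `(x, y]`, so the two bounds
coincide at `y`. -/
theorem isRightContinuousVersion_signedCrossings [CompleteSpace (D.L2R 𝕜)] (hB : D.CondB)
    (hend : D.EndConvention) (hpar : D.NonParallel) (hK : IsResolvent (D.operator 𝕜) 0 K)
    (hKc : IsCompactOperator K) :
    IsRightContinuousVersion
      (signedCrossings D.T D.z (boundaryPoint D.u₀) (boundaryPoint D.u₁) D.f)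
      (countingFunction (reciprocalEigenvalues K)) := by
  set S := reciprocalEigenvalues K with hSdef
  have hS : ∀ a b, (S ∩ Set.Icc a b).Finite :=
    reciprocalEigenvalues_finite hKc (isSymmetric_of_isResolvent hB hend hK)
  have h0 : (0 : ℝ) ∉ S := zero_notMem_reciprocalEigenvalues
  intro x
  refine tendsto_const_nhds.congr' ?_
  rcases le_or_gt 0 x with hx | hx
  · filter_upwards [eventually_right_inter_Ioc_eq_empty hS x, self_mem_nhdsWithin] with y hy hxy
    have hxy' : x < y := hxy
    have hy0 : 0 < y := hx.trans_lt hxy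
    have e1 : S ∩ {μ | 0 < 1 * μ ∧ 1 * μ ≤ 1 * y} = S ∩ Set.Icc 0 x := by
      ext μ
      simp only [one_mul, Set.mem_inter_iff, Set.mem_ofPred_eq, Set.mem_Icc]
      refine and_congr_right fun hμ => ⟨fun h => ⟨h.1.le, ?_⟩, fun h => ⟨?_, by linarith⟩⟩
      · by_contra! h'
        exact Set.eq_empty_iff_forall_notMem.1 hy μ ⟨hμ, h', h.2⟩
      · exact h.1.lt_of_ne (by rintro rfl; exact h0 hμ)
    have e2 : S ∩ {μ | 0 < 1 * μ ∧ 1 * μ < 1 * y} = S ∩ Set.Icc 0 x := by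
      ext μ
      simp only [one_mul, Set.mem_inter_iff, Set.mem_ofPred_eq, Set.mem_Icc]
      refine and_congr_right fun hμ => ⟨fun h => ⟨h.1.le, ?_⟩, fun h => ⟨?_, by linarith⟩⟩
      · by_contra! h'
        exact Set.eq_empty_iff_forall_notMem.1 hy μ ⟨hμ, h', h.2.le⟩
      · exact h.1.lt_of_ne (by rintro rfl; exact h0 hμ)
    obtain ⟨-, h1, h2⟩ := crossingTimes_bounds hB hend hpar hK hKc (σ := 1) (lam := y)
      (by norm_num) (by simpa using hy0) (by rw [← hSdef, e1]; exact hS 0 x)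
    rw [← hSdef, e1] at h1
    rw [← hSdef, e2] at h2
    rw [countingFunction, if_pos hx, signedCrossings, sign_pos hy0, le_antisymm h1 h2]
    simp
  · filter_upwards [eventually_right_inter_Ioc_eq_empty hS x, Ioo_mem_nhdsGT hx] with y hy hxy
    -- For negative parameters the count is over `[y, 0)`; since `(x, y]` is free of eigenvalues,
    -- this is `(x, 0)`, the open interval in the convention for counting functions.
    have e1 : S ∩ {μ | 0 < -1 * μ ∧ -1 * μ ≤ -1 * y} = S ∩ Set.Ioo x 0 := by
      ext μ
      simp only [neg_one_mul, Set.mem_inter_iff, Set.mem_ofPred_eq, Set.mem_Ioo]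
      refine and_congr_right fun hμ =>
        ⟨fun h => ⟨by linarith [hxy.1], by linarith⟩, fun h => ⟨by linarith, ?_⟩⟩
      by_contra! h'
      exact Set.eq_empty_iff_forall_notMem.1 hy μ ⟨hμ, h.1, by linarith⟩
    have e2 : S ∩ {μ | 0 < -1 * μ ∧ -1 * μ < -1 * y} = S ∩ Set.Ioo x 0 := by
      ext μ
      simp only [neg_one_mul, Set.mem_inter_iff, Set.mem_ofPred_eq, Set.mem_Ioo]
      refine and_congr_right fun hμ =>
        ⟨fun h => ⟨by linarith [hxy.1], by linarith⟩, fun h => ⟨by linarith, ?_⟩⟩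
      by_contra! h'
      exact Set.eq_empty_iff_forall_notMem.1 hy μ ⟨hμ, h.1, by linarith⟩
    obtain ⟨-, h1, h2⟩ := crossingTimes_bounds hB hend hpar hK hKc (σ := -1) (lam := y)
      (by norm_num) (by simpa using hxy.2) (by
        rw [← hSdef, e1]
        exact (hS x 0).subset (Set.inter_subset_inter_right _ Set.Ioo_subset_Icc_self))
    rw [← hSdef, e1] at h1
    rw [← hSdef, e2] at h2
    rw [countingFunction, if_neg (not_le.2 hx), signedCrossings, sign_neg hxy.2,
      le_antisymm h1 h2]
    simp

theorem crossingTimes_finite [CompleteSpace (D.L2R 𝕜)] (hB : D.CondB)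
    (hend : D.EndConvention) (hpar : D.NonParallel) (hK : IsResolvent (D.operator 𝕜) 0 K)
    (hKc : IsCompactOperator K) (lam : ℝ) :
    (crossingTimes D.T D.z (boundaryPoint D.u₀) (boundaryPoint D.u₁) D.f lam).Finite := by
  have hS := reciprocalEigenvalues_finite hKc (isSymmetric_of_isResolvent hB hend hK)
  rcases lt_trichotomy lam 0 with h | rfl | h
  · exact (crossingTimes_bounds hB hend hpar hK hKc (σ := -1) (by norm_num) (by linarith)
      ((hS lam 0).subset (Set.inter_subset_inter_right _ fun μ hμ =>
        ⟨by linarith [hμ.2], by linarith [hμ.1]⟩))).1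
  · rw [crossingTimes_zero hpar]
    exact Set.finite_empty
  · exact (crossingTimes_bounds hB hend hpar hK hKc (σ := 1) (by norm_num) (by linarith)
      ((hS 0 lam).subset (Set.inter_subset_inter_right _ fun μ hμ =>
        ⟨by linarith [hμ.1], by linarith [hμ.2]⟩))).1

end DiracData

/-! ### Uniqueness of the carousel set and the conclusion -/

theorem IsCarouselSet.eq {T : EReal} {z : ℝ → UpperHalfPlane} {η₀ η₁ : OnePoint ℝ} {f : ℝ → ℝ}
    {S S' : Set ℝ} (hS : IsCarouselSet T z η₀ η₁ f S) (hS' : IsCarouselSet T z η₀ η₁ f S') :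
    S' = S :=
  eq_of_countingFunction_eq hS'.1 hS.1 (funext fun x => tendsto_nhds_unique (hS'.2 x) (hS.2 x))

/-- Symmetry forces `μ` to equal its conjugate, so no eigenvalue is lost by looking at real ones
only. -/
theorem image_reciprocalEigenvalues {𝕜 H : Type*} [RCLike 𝕜] [NormedAddCommGroup H]
    [InnerProductSpace 𝕜 H] {K : H →L[𝕜] H} (hsym : K.toLinearMap.IsSymmetric) :
    (fun lam : ℝ => algebraMap ℝ 𝕜 lam) '' reciprocalEigenvalues K =
      {μ | ∃ v, v ≠ 0 ∧ μ • K v = v} := by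
  ext μ
  constructor
  · rintro ⟨x, hx, rfl⟩
    exact hx
  · rintro ⟨v, hv0, hv⟩
    have h1 := hsym v v
    simp only [ContinuousLinearMap.coe_coe] at h1
    have hKv : K v ≠ 0 := by
      intro h
      rw [h, smul_zero] at hv
      exact hv0 hv.symm
    have h2 : μ * inner 𝕜 (K v) (K v) = starRingEnd 𝕜 μ * inner 𝕜 (K v) (K v) := by
      rw [← inner_smul_right, ← inner_smul_left, hv, h1]
    have h3 := mul_right_cancel₀ (inner_self_ne_zero.2 hKv) h2
    obtain ⟨x, hx⟩ := RCLike.conj_eq_iff_real.1 h3.symm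
    exact ⟨x, ⟨v, hv0, by rw [← hx]; exact hv⟩, hx.symm⟩

theorem mainTheorem4 {𝕜 : Type*} [RCLike 𝕜] (D : DiracData)
    (hA : D.CondA) (hB : D.CondB) (hC : D.CondC) (hend : D.EndConvention)
    (hpar : D.NonParallel) (hHS : HasHilbertSchmidtInverse (D.operator 𝕜)) :
    CarouselWellDefined D.T D.z (boundaryPoint D.u₀) (boundaryPoint D.u₁) D.f ∧
    (fun lam : ℝ => algebraMap ℝ 𝕜 lam) ''
        hyperbolicCarousel D.T D.z (boundaryPoint D.u₀) (boundaryPoint D.u₁) D.f =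
      operatorSpectrum (D.operator 𝕜) := by
  obtain ⟨K, hK, hKHS⟩ := hHS
  have := hKHS.completeSpace
  have hKc := hKHS.isCompactOperator
  have hsym := D.isSymmetric_of_isResolvent hB hend hK
  have hS : IsCarouselSet D.T D.z (boundaryPoint D.u₀) (boundaryPoint D.u₁) D.f
      (reciprocalEigenvalues K) :=
    ⟨reciprocalEigenvalues_finite hKc hsym,
      D.isRightContinuousVersion_signedCrossings hB hend hpar hK hKc⟩
  refine ⟨⟨D.z_meas, fun b hb => D.isBounded_path hB hb,
    boundaryPoint_ne D.u₀_ne D.u₁_ne hpar.ne, D.f_pos, fun b hb => D.integrableOn_f hB hb,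
    fun lam => ?_, D.crossingTimes_finite hB hend hpar hK hKc,
    reciprocalEigenvalues K, hS, fun S hS' => hS.eq hS'⟩, ?_⟩
  · obtain ⟨φ, hφ⟩ := D.exists_carouselAngle hB (boundaryPoint D.u₀) lam
    exact ⟨φ, hφ, fun ψ hψ => D.carouselAngle_unique hB hφ hψ⟩
  · rw [operatorSpectrum_eq hK hKc, ← image_reciprocalEigenvalues hsym]
    congr 1
    ext x
    exact ⟨fun ⟨S, hS', hx⟩ => hS.eq hS' ▸ hx, fun hx => ⟨_, hS, hx⟩⟩
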